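/- Let $\mathbb D$ be the open unit disk, $\mathbb T$ the unit circle and $m$ the normalized Lebesgue measure on $\mathbb T$. For $0<p<\infty$ let $H^p$ be the space of analytic functions $f$ on $\mathbb D$ with $\|f\|_{H^p}^p=\sup_{0<r<1}\int_{\mathbb T}|f(r\zeta)|^p\,dm(\zeta)<\infty$, and let $H^\infty$ be the space of bounded analytic functions on $\mathbb D$ with the supremum norm. The value of $f\in H^p$ at a point $\zeta\in\mathbb T$ is its radial limit $\lim_{r\to1^-}f(r\zeta)$, which exists for almost every $\zeta$. Let $\mathfrak N$ be the class of all $f\in H^\infty$ with $$\operatorname*{ess\,sup}_{\eta\in\mathbb T}\int_{\mathbb T}\frac{|f(\zeta)-f(\eta)|}{|\zeta-\eta|}\,dm(\zeta)<\infty .$$ For $f\in H^\infty$ the Toeplitz operator $T_f$ on $H^p$ ($p=1,\infty$) is given by $$T_fh(z)=\int_{\mathbb T}\frac{\overline{f(\zeta)}\,h(\zeta)}{1-\overline{\zeta}z}\,dm(\zeta),\qquad h\in H^p,\ z\in\mathbb D ;$$ it is bounded on $H^p$ if $T_fh\in H^p$ and $\|T_fh\|_{H^p}\le C\|h\|_{H^p}$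 for all $h\in H^p$, with $C$ independent of $h$. For a sequence $\alpha=(\alpha_n)_{n\ge0}$ and $f\in H^\infty$ with Taylor coefficients $\hat f(n)$, let $(f*\alpha)(z)=\sum_n\hat f(n)\alpha_nz^n$ for $z\in\mathbb D$, where the sum is taken over $n\ge1$ or over $n\ge0$ (the theorem holds for both conventions). **Theorem.** Let $\varepsilon>0$ and let $\alpha$ be one of the sequences $$\alpha_n=\frac1{(n+1)^{\varepsilon}},\qquad \alpha_n=\frac1{\log^{1+\varepsilon}(n+2)},\qquad \alpha_n=\frac1{\log(n+2)\,\log^{1+\varepsilon}\log(n+3)},$$ or, more generally, for some integer $k\ge1$, $$\alpha_n=\frac1{\Bigl(\prod_{j=1}^{k-1}\log_j(n+c_j)\Bigr)\bigl(\log_k(n+c_k)\bigr)^{1+\varepsilon}},$$ where $\log_j$ is the $j$-fold iterated natural logarithm and $c_1,\dots,c_k$ are natural numbers such that $\log_i(c_j)>0$ for all $0\le i\le j$ (with $\log_0 x=x$), $1\le j\le k$. Then for every $f\in H^\infty$ the function $f*\alpha$ belongs to $\mathfrak N$, and the Toeplitz operator $T_{f*\alpha}$ is bounded on $H^1$ and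 on $H^\infty$. -/

import Mathlib

open MeasureTheory Filter Topology Set
open scoped ENNReal NNReal ComplexConjugate

noncomputable section

/-- Normalized Lebesgue measure `m` on the unit circle, as a measure on `ℂ`: the image of
`dθ / 2π` on `(0, 2π]` under `θ ↦ exp (iθ)`. -/
def circleMeasure : Measure ℂ :=
  ENNReal.ofReal (2 * Real.pi)⁻¹ •
    (volume.restrict (Ioc 0 (2 * Real.pi))).map (circleMap 0 1)

/-- The Hardy norm, for `0 < p ≤ ∞`, of a function on the open unit disk, with value `∞` if it is
unbounded. -/
def hardyNorm (p : ℝ≥0∞) (f : ℂ → ℂ) : ℝ≥0∞ :=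
  if p = ∞ then ⨆ z ∈ Metric.ball (0 : ℂ) 1, ‖f z‖ₑ
  else ⨆ r ∈ Ioo (0 : ℝ) 1,
    (∫⁻ ζ, ‖f (r * ζ)‖ₑ ^ p.toReal ∂circleMeasure) ^ (1 / p.toReal)

/-- The Hardy space `H^p` of the unit disk. Only the values of `f` inside the open disk matter. -/
def HardySpace (p : ℝ≥0∞) : Set (ℂ → ℂ) :=
  {f | AnalyticOnNhd ℂ f (Metric.ball 0 1) ∧ hardyNorm p f < ∞}

/-- The boundary function of `f`: its radial limit `lim_{r → 1-} f (r ζ)` at a point `ζ` of the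
unit circle. -/
def boundaryValue (f : ℂ → ℂ) (ζ : ℂ) : ℂ :=
  limUnder (𝓝[<] (1 : ℝ)) fun r : ℝ => f (r * ζ)

/-- The Toeplitz operator
`T_f h (z) = ∫_𝕋 conj (f ζ) h ζ / (1 - conj ζ * z) dm(ζ)`. -/
def toeplitz (f h : ℂ → ℂ) (z : ℂ) : ℂ :=
  ∫ ζ, conj (boundaryValue f ζ) * boundaryValue h ζ / (1 - conj ζ * z) ∂circleMeasure

/-- `T_f` is a bounded operator on `H^p`: for every `h ∈ H^p` the density `conj f * h` is
integrable on the circle (so that the integral defining `T_f h` converges in the disk),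
`T_f h ∈ H^p`, and `‖T_f h‖ ≤ C ‖h‖` with `C` independent of `h`. -/
def ToeplitzBoundedOn (p : ℝ≥0∞) (f : ℂ → ℂ) : Prop :=
  ∃ C : ℝ≥0, ∀ h ∈ HardySpace p,
    Integrable (fun ζ => conj (boundaryValue f ζ) * boundaryValue h ζ) circleMeasure ∧
    toeplitz f h ∈ HardySpace p ∧
    hardyNorm p (toeplitz f h) ≤ C * hardyNorm p h

/-- `Λ(f) = ess sup_{η ∈ 𝕋} ∫_𝕋 |f ζ - f η| / |ζ - η| dm(ζ)`, with boundary values of `f`. -/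
def lambdaSeminorm (f : ℂ → ℂ) : ℝ≥0∞ :=
  essSup (fun η => ∫⁻ ζ, ‖boundaryValue f ζ - boundaryValue f η‖ₑ / ‖ζ - η‖ₑ ∂circleMeasure)
    circleMeasure

/-- The class `𝔑` of all `f ∈ H^∞` with `Λ(f) < ∞`. -/
def classN : Set (ℂ → ℂ) :=
  {f | f ∈ HardySpace ∞ ∧ lambdaSeminorm f < ∞}

/-- The `n`-th Taylor coefficient of `f` at `0`. -/
def taylorCoeff (f : ℂ → ℂ) (n : ℕ) : ℂ :=
  iteratedDeriv n f 0 / (n.factorial : ℂ)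

/-- The function `f * α`, i.e. `z ↦ ∑_{n ≥ m} f̂(n) α_n z^n`, where `m` is the index at which the
summation starts. -/
def coeffProduct (m : ℕ) (f : ℂ → ℂ) (α : ℕ → ℝ) (z : ℂ) : ℂ :=
  ∑' n : ℕ, taylorCoeff f (n + m) * (α (n + m) : ℂ) * z ^ (n + m)

/-- The general member, with `k ≥ 1` logarithmic factors, of the logarithmic scale:
`α_n = 1 / (log (n + c₁) * log log (n + c₂) * ⋯ * (log ⋯ log (n + c_k)) ^ (1 + ε))`,
where the `j`-th factor is a `j`-fold logarithm. The shifts `c_j` are any natural numbers for which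
the iterated logarithms are defined and positive for all `n ≥ 0`. -/
def IsIteratedLogSequence (ε : ℝ) (α : ℕ → ℝ) : Prop :=
  ∃ k : ℕ, 1 ≤ k ∧ ∃ c : ℕ → ℕ,
    (∀ j ∈ Finset.Icc 1 k, ∀ i ≤ j, 0 < Real.log^[i] (c j : ℝ)) ∧
    ∀ n : ℕ, α n = 1 / ((∏ j ∈ Finset.Ico 1 k, Real.log^[j] ((n : ℝ) + c j)) *
      (Real.log^[k] ((n : ℝ) + c k)) ^ (1 + ε))

end

/-! Each listed sequence is nonnegative, decreasing, convex and satisfies `∑ α n / (n + 1) < ∞`;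
only this is used (`IsSlowConvex`).

Multiplier part. Convexity gives `α n = ∑ k, (k + 1 - n)₊ Δ²α k` with `Δ²α k ≥ 0`. The tents `(N -
n)₊` are the weights of the Cesàro sum `S_N`, the sum of the first `N` partial sums of `f`, so `f *
α = ∑ k, Δ²α k • S_{k+1}`. If `|f| ≤ M`, then `|S_N| ≤ M N` by positivity of the Fejér kernel, and
`|S_N'| ≤ M N²` by Bernstein. With `t = |ζ - η|` the difference quotient of `S_N` is therefore at
most `3 M N² / (1 + N t)`, whose integral over the circle is `O(M N log (N + 1))`. Thus the integral
defining `Λ` is controlled by `∑ (k + 1) log (k + 2) Δ²α k`. Inserting the tent representation into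
`∑ α n / (n + 1)` and exchanging sums shows that this series converges
(`IsSlowConvex.summable_log_mul_secondDiff`). The same superposition extends `f * α` continuously to
the closed disk.

Toeplitz part. For `z = r η`, Cauchy's formula lets the constant `conj (g η)` be subtracted: `T_g h
(z) = ∫ conj (g ζ - g η) h ζ / (1 - conj ζ z) dm + conj (g η) h z`. Since `|ζ - η| ≤ 2 |1 - conj ζ
z|`, the integral is dominated by the kernel `|g ζ - g η| / |ζ - η|`. Its uniform integral bound
settles `H^∞`; its symmetry and Tonelli settle `H¹` (`enorm_toeplitz_le`, `lintegral_toeplitz_le`).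

This requires boundary values on `H¹`: existence almost everywhere, mean convergence of dilations,
and Cauchy's formula. In `H²`, Fatou's theorem follows by differentiating a primitive that is
continuous up to the circle. A function in `H¹` is a product of two `H²` functions: polynomials are
factored explicitly root by root, and the general case follows by compactness from Cesàro means. -/

/-! ### Normalized Lebesgue measure on the circle and orthogonality of powers -/

theorem lintegral_circleMeasure {g : ℂ → ℝ≥0∞} (hg : Measurable g) :
    ∫⁻ ζ, g ζ ∂circleMeasure =
      ENNReal.ofReal (2 * Real.pi)⁻¹ * ∫⁻ θ in Ioc 0 (2 * Real.pi), g (circleMap 0 1 θ) := by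
  rw [circleMeasure, lintegral_smul_measure, lintegral_map hg (by fun_prop), smul_eq_mul]

theorem integral_circleMeasure {E : Type*} [NormedAddCommGroup E] [NormedSpace ℝ E] {g : ℂ → E}
    (hg : AEStronglyMeasurable g circleMeasure) :
    ∫ ζ, g ζ ∂circleMeasure =
      ((2 * Real.pi)⁻¹ : ℝ) • ∫ θ in Ioc 0 (2 * Real.pi), g (circleMap 0 1 θ) := by
  have h0 : ENNReal.ofReal (2 * Real.pi)⁻¹ ≠ 0 := by
    simp [Real.pi_pos]
  have hg' : AEStronglyMeasurable g ((volume.restrict (Ioc 0 (2 * Real.pi))).map (circleMap 0 1)) :=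
    hg.mono_ac (Measure.absolutelyContinuous_smul h0)
  rw [circleMeasure, integral_smul_measure, integral_map (by fun_prop) hg',
    ENNReal.toReal_ofReal (by positivity)]

instance : IsProbabilityMeasure circleMeasure := by
  constructor
  rw [← lintegral_one, lintegral_circleMeasure measurable_const]
  simp only [lintegral_one, MeasurableSet.univ, Measure.restrict_apply, univ_inter, Real.volume_Ioc,
    sub_zero]
  rw [← ENNReal.ofReal_mul (by positivity), inv_mul_cancel₀ (by positivity), ENNReal.ofReal_one]

theorem ae_circleMeasure_iff {p : ℂ → Prop} (hp : MeasurableSet {z | p z}) :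
    (∀ᵐ ζ ∂circleMeasure, p ζ) ↔
      ∀ᵐ θ ∂volume.restrict (Ioc 0 (2 * Real.pi)), p (circleMap 0 1 θ) := by
  have h0 : ENNReal.ofReal (2 * Real.pi)⁻¹ ≠ 0 := by
    simp [Real.pi_pos]
  rw [circleMeasure, Measure.ae_ennreal_smul_measure_iff h0, ae_map_iff (by fun_prop) hp]

theorem ae_norm_eq_one : ∀ᵐ ζ ∂circleMeasure, ‖ζ‖ = 1 := by
  rw [ae_circleMeasure_iff (measurableSet_eq_fun (by fun_prop) (by fun_prop))]
  simp

theorem ae_circleMeasure_of_forall {p : ℂ → Prop} (hp : ∀ ζ, ‖ζ‖ = 1 → p ζ) :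
    ∀ᵐ ζ ∂circleMeasure, p ζ := by
  filter_upwards [ae_norm_eq_one] with ζ hζ using hp ζ hζ

/-- Rotations of the circle are translations of `AddCircle (2 * Real.pi)`, whose measure is
translation invariant. -/
theorem lintegral_rotate {g : ℂ → ℝ≥0∞} (hg : Measurable g) {η : ℂ} (hη : ‖η‖ = 1) :
    ∫⁻ ζ, g (η * ζ) ∂circleMeasure = ∫⁻ ζ, g ζ ∂circleMeasure := by
  rw [lintegral_circleMeasure hg, lintegral_circleMeasure (by fun_prop)]
  congr 1
  have : Fact (0 < 2 * Real.pi) := ⟨by positivity⟩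
  have key : ∀ x : ℝ, circleMap 0 1 x = (AddCircle.toCircle (x : AddCircle (2 * Real.pi)) : ℂ) := by
    intro x
    rw [AddCircle.toCircle_apply_mk, div_self (by positivity), one_mul]
    simp [circleMap]
  have h1 : ∀ f : ℂ → ℝ≥0∞, ∫⁻ θ in Ioc 0 (2 * Real.pi), f (circleMap 0 1 θ) =
      ∫⁻ x : AddCircle (2 * Real.pi), f (AddCircle.toCircle x) := by
    intro f
    have := AddCircle.lintegral_preimage (2 * Real.pi) 0 (fun x => f (AddCircle.toCircle x))
    rw [zero_add] at this
    rw [← this]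
    simp only [key]
  rw [h1 (fun z => g (η * z)), h1 g]
  have hη' : η = circleMap 0 1 η.arg := by
    have := Complex.norm_mul_exp_arg_mul_I η
    rw [hη] at this
    simpa [circleMap] using this.symm
  rw [hη', key]
  conv_rhs => rw [← lintegral_add_left_eq_self _ ((η.arg : AddCircle (2 * Real.pi)))]
  simp [AddCircle.toCircle_add]

theorem aestronglyMeasurable_of_continuousOn {g : ℂ → ℂ}
    (hg : ContinuousOn g (Metric.closedBall 0 1)) : AEStronglyMeasurable g circleMeasure := by
  have h : circleMeasure.restrict (Metric.closedBall 0 1) = circleMeasure := by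
    rw [Measure.restrict_eq_self_of_ae_mem]
    filter_upwards [ae_norm_eq_one] with ζ hζ
    simp [hζ]
  rw [← h]
  exact hg.aestronglyMeasurable Metric.isClosed_closedBall.measurableSet

theorem integrable_of_bounded {g : ℂ → ℂ} (hg : AEStronglyMeasurable g circleMeasure) {C : ℝ}
    (hC : ∀ ζ, ‖ζ‖ = 1 → ‖g ζ‖ ≤ C) : Integrable g circleMeasure :=
  Integrable.of_bound hg C (ae_circleMeasure_of_forall hC)

theorem integral_pow_mul_conj_pow (a b : ℕ) :
    ∫ ζ, ζ ^ a * conj ζ ^ b ∂circleMeasure = if a = b then 1 else 0 := by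
  by_cases hab : a = b
  · subst hab
    rw [if_pos rfl]
    have : ∀ᵐ ζ ∂circleMeasure, ζ ^ a * conj ζ ^ a = 1 := by
      filter_upwards [ae_norm_eq_one] with ζ hζ
      rw [← mul_pow, Complex.mul_conj, Complex.normSq_eq_norm_sq, hζ]
      simp
    rw [integral_congr_ae this]
    simp
  · rw [if_neg hab, integral_circleMeasure (by fun_prop),
      ← intervalIntegral.integral_of_le (by positivity)]
    have h1 : ∀ θ : ℝ, circleMap 0 1 θ ^ a * conj (circleMap 0 1 θ) ^ b =
        Complex.exp ((((a : ℂ) - b) * Complex.I) * θ) := by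
      intro θ
      simp only [circleMap, Complex.ofReal_one, one_mul, zero_add]
      rw [← Complex.exp_conj, ← Complex.exp_nat_mul, ← Complex.exp_nat_mul, ← Complex.exp_add]
      congr 1
      simp
      ring
    simp only [h1]
    have hne : ((a : ℂ) - b) * Complex.I ≠ 0 := by
      simp [sub_eq_zero, hab]
    rw [integral_exp_mul_complex hne]
    have h2 : ((a : ℂ) - b) * Complex.I * ((2 * Real.pi : ℝ) : ℂ) =
        ((a - b : ℤ) : ℂ) * (2 * Real.pi * Complex.I) := by
      push_cast; ring
    rw [h2, Complex.exp_int_mul_two_pi_mul_I]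
    simp

/-- Absolute convergence of the coefficients permits termwise integration on the circle. For a
kernel `φ` with known moments this yields the Fejér, Parseval, Cauchy and derivative formulas below.
-/
theorem hasSum_integral_powerSeries_mul {c : ℕ → ℂ} (hc : Summable fun n => ‖c n‖) {φ : ℂ → ℂ}
    (hφ : Integrable φ circleMeasure) :
    HasSum (fun n => c n * ∫ ζ, ζ ^ n * φ ζ ∂circleMeasure)
      (∫ ζ, (∑' n, c n * ζ ^ n) * φ ζ ∂circleMeasure) := by
  have hint : ∀ n, Integrable (fun ζ => ζ ^ n * φ ζ) circleMeasure := fun n =>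
    hφ.bdd_mul (c := 1) (by fun_prop) (ae_circleMeasure_of_forall fun ζ hζ => by simp [hζ])
  have h := hasSum_integral_of_summable_integral_norm (μ := circleMeasure)
    (F := fun n ζ => c n * (ζ ^ n * φ ζ)) (fun n => (hint n).const_mul _) ?_
  · have h2 : (∫ ζ, ∑' n, c n * (ζ ^ n * φ ζ) ∂circleMeasure) =
        ∫ ζ, (∑' n, c n * ζ ^ n) * φ ζ ∂circleMeasure := by
      congr 1; ext ζ; rw [← tsum_mul_right]; simp only [mul_assoc]
    rw [h2] at h
    simpa only [integral_const_mul] using h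
  · have : ∀ n, ∫ ζ, ‖c n * (ζ ^ n * φ ζ)‖ ∂circleMeasure =
        ‖c n‖ * ∫ ζ, ‖φ ζ‖ ∂circleMeasure := by
      intro n
      rw [← integral_const_mul]
      refine integral_congr_ae ?_
      filter_upwards [ae_norm_eq_one] with ζ hζ
      simp [hζ]
    simp only [this]
    exact hc.mul_right _

/-! ### Fejér kernel, Cesàro sums and Bernstein's inequality -/

/-- The geometric sum `∑_{k < N} z ^ k`. -/
def dirichletSum (N : ℕ) (z : ℂ) : ℂ := ∑ k ∈ Finset.range N, z ^ k

@[fun_prop]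
theorem continuous_dirichletSum (N : ℕ) : Continuous (dirichletSum N) := by
  unfold dirichletSum; fun_prop

theorem integral_pow_mul_fejer (N a b : ℕ) :
    ∫ ζ, ζ ^ a * (conj ζ ^ b * (dirichletSum N ζ * conj (dirichletSum N ζ))) ∂circleMeasure =
      ∑ j ∈ Finset.range N, ∑ k ∈ Finset.range N, if a + j = b + k then (1 : ℂ) else 0 := by
  have h1 : ∀ ζ : ℂ, ζ ^ a * (conj ζ ^ b * (dirichletSum N ζ * conj (dirichletSum N ζ))) =
      ∑ j ∈ Finset.range N, ∑ k ∈ Finset.range N, ζ ^ (a + j) * conj ζ ^ (b + k) := by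
    intro ζ
    simp only [dirichletSum, map_sum, map_pow, Finset.sum_mul_sum]
    simp only [Finset.mul_sum]
    refine Finset.sum_congr rfl fun j _ => Finset.sum_congr rfl fun k _ => ?_
    ring
  have hint : ∀ c d : ℕ, Integrable (fun ζ => ζ ^ c * conj ζ ^ d) circleMeasure := fun c d =>
    integrable_of_bounded (C := 1) (by fun_prop) (fun ζ hζ => by simp [hζ])
  simp only [h1]
  rw [integral_finsetSum _ fun j _ => integrable_finsetSum _ fun k _ => hint _ _]
  refine Finset.sum_congr rfl fun j _ => ?_
  rw [integral_finsetSum _ fun k _ => hint _ _]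
  exact Finset.sum_congr rfl fun k _ => integral_pow_mul_conj_pow _ _

/-- The kernel `|D_N|²` is `N` times the Fejér kernel: its `n`-th moment counts the pairs `j, k < N`
with `n + j = k`. Truncated subtraction gives `0` for `n ≥ N`. -/
theorem integral_pow_mul_fejer_zero (N n : ℕ) :
    ∫ ζ, ζ ^ n * (dirichletSum N ζ * conj (dirichletSum N ζ)) ∂circleMeasure = ((N - n : ℕ) : ℂ) := by
  have h := integral_pow_mul_fejer N n 0
  simp only [pow_zero, one_mul] at h
  rw [h]
  have : ∀ j ∈ Finset.range N, (∑ k ∈ Finset.range N, if n + j = 0 + k then (1 : ℂ) else 0) =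
      if j < N - n then 1 else 0 := by
    intro j _
    simp only [zero_add, Finset.sum_ite_eq, Finset.mem_range]
    congr 1
    simp only [eq_iff_iff]; omega
  rw [Finset.sum_congr rfl this, Finset.sum_ite, Finset.sum_const_zero, add_zero, Finset.sum_const,
    nsmul_one]
  congr 1
  rw [show Finset.filter (fun j => j < N - n) (Finset.range N) = Finset.range (N - n) by
    ext; simp; omega, Finset.card_range]

/-- The factor `conj ζ ^ N` moves the rising side of the tent to `0 ≤ n ≤ N`, so the moments become
`n`: on polynomials of degree at most `N` this kernel acts as `z d/dz`, with the same total mass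
`N`. -/
theorem integral_pow_mul_shifted_fejer (N n : ℕ) (hn : n ≤ N) :
    ∫ ζ, ζ ^ n * (conj ζ ^ N * (dirichletSum N ζ * conj (dirichletSum N ζ))) ∂circleMeasure =
      (n : ℂ) := by
  rw [integral_pow_mul_fejer N n N]
  have : ∀ j ∈ Finset.range N, (∑ k ∈ Finset.range N, if n + j = N + k then (1 : ℂ) else 0) =
      if N - n ≤ j then 1 else 0 := by
    intro j hj
    rw [Finset.mem_range] at hj
    by_cases h : N - n ≤ j
    · rw [if_pos h, Finset.sum_eq_single (n + j - N)]
      · rw [if_pos (by omega)]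
      · intro k _ hk
        rw [if_neg (by omega)]
      · intro hk
        simp only [Finset.mem_range] at hk
        omega
    · rw [if_neg h]
      exact Finset.sum_eq_zero fun k _ => if_neg (by omega)
  rw [Finset.sum_congr rfl this, Finset.sum_ite, Finset.sum_const_zero, add_zero, Finset.sum_const,
    nsmul_one]
  congr 1
  rw [show Finset.filter (fun j => N - n ≤ j) (Finset.range N) = Finset.Ico (N - n) N by
    ext; simp; omega, Nat.card_Ico]
  omega

theorem mul_conj_eq_norm_sq (z : ℂ) : z * conj z = ((‖z‖ ^ 2 : ℝ) : ℂ) := by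
  rw [Complex.mul_conj, Complex.normSq_eq_norm_sq]

theorem integral_norm_dirichletSum_sq (N : ℕ) :
    ∫ ζ, ‖dirichletSum N ζ‖ ^ 2 ∂circleMeasure = N := by
  have h := integral_pow_mul_fejer_zero N 0
  simp only [pow_zero, one_mul, mul_conj_eq_norm_sq, Nat.sub_zero] at h
  rw [integral_complex_ofReal] at h
  exact_mod_cast h

theorem norm_dirichletSum_le (N : ℕ) {ζ : ℂ} (hζ : ‖ζ‖ = 1) : ‖dirichletSum N ζ‖ ≤ N := by
  refine (norm_sum_le _ _).trans ?_
  simp [hζ]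

theorem integrable_norm_dirichletSum_sq (N : ℕ) :
    Integrable (fun ζ => ‖dirichletSum N ζ‖ ^ 2) circleMeasure := by
  refine Integrable.of_bound (by fun_prop) ((N : ℝ) ^ 2) (ae_circleMeasure_of_forall fun ζ hζ => ?_)
  rw [norm_pow, norm_norm]
  gcongr
  exact norm_dirichletSum_le N hζ

theorem norm_integral_mul_fejer_le (N : ℕ) {g : ℂ → ℂ} {M : ℝ}
    (hM : ∀ ζ, ‖ζ‖ = 1 → ‖g ζ‖ ≤ M) :
    ‖∫ ζ, g ζ * (dirichletSum N ζ * conj (dirichletSum N ζ)) ∂circleMeasure‖ ≤ M * N := by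
  rw [← integral_norm_dirichletSum_sq, ← integral_const_mul]
  refine norm_integral_le_of_norm_le ((integrable_norm_dirichletSum_sq N).const_mul M)
    (ae_circleMeasure_of_forall fun ζ hζ => ?_)
  rw [norm_mul, norm_mul, RCLike.norm_conj, ← sq]
  gcongr
  exact hM ζ hζ

/-- The sum of the first `N` partial sums of the power series `∑ a n * z ^ n`. -/
def cesaroSum (a : ℕ → ℂ) (N : ℕ) (z : ℂ) : ℂ :=
  ∑ n ∈ Finset.range N, ((N - n : ℕ) : ℂ) * a n * z ^ n

@[fun_prop]
theorem continuous_cesaroSum (a : ℕ → ℂ) (N : ℕ) : Continuous (cesaroSum a N) := by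
  unfold cesaroSum; fun_prop

@[fun_prop]
theorem differentiable_cesaroSum (a : ℕ → ℂ) (N : ℕ) : Differentiable ℂ (cesaroSum a N) := by
  unfold cesaroSum; fun_prop

theorem summable_norm_powerSeries {a : ℕ → ℂ} {f : ℂ → ℂ}
    (hf : ∀ z, ‖z‖ < 1 → HasSum (fun n => a n * z ^ n) (f z)) {z : ℂ} (hz : ‖z‖ < 1) :
    Summable fun n => ‖a n * z ^ n‖ := (hf z hz).summable.norm

/-- Cesàro sums are averages of rotates of `f` against a positive kernel of mass `N`; hence sup and
mean norms grow by a factor of at most `N`. -/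
theorem cesaroSum_eq_integral {a : ℕ → ℂ} {f : ℂ → ℂ}
    (hf : ∀ z, ‖z‖ < 1 → HasSum (fun n => a n * z ^ n) (f z)) (N : ℕ) {z : ℂ} (hz : ‖z‖ < 1) :
    cesaroSum a N z =
      ∫ ζ, f (z * ζ) * (dirichletSum N ζ * conj (dirichletSum N ζ)) ∂circleMeasure := by
  have hφ : Integrable (fun ζ => dirichletSum N ζ * conj (dirichletSum N ζ)) circleMeasure :=
    integrable_of_bounded (C := N * N) (by fun_prop) fun ζ hζ => by
      rw [norm_mul, RCLike.norm_conj]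
      gcongr <;> exact norm_dirichletSum_le N hζ
  have h := hasSum_integral_powerSeries_mul (summable_norm_powerSeries hf hz) hφ
  have h2 : (∫ ζ, (∑' n, a n * z ^ n * ζ ^ n) *
      (dirichletSum N ζ * conj (dirichletSum N ζ)) ∂circleMeasure) =
      ∫ ζ, f (z * ζ) * (dirichletSum N ζ * conj (dirichletSum N ζ)) ∂circleMeasure := by
    refine integral_congr_ae (ae_circleMeasure_of_forall fun ζ hζ => ?_)
    have := (hf (z * ζ) (by simpa [hζ] using hz)).tsum_eq
    simp only [mul_pow, ← mul_assoc] at this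
    simp only [this]
  rw [← h2, ← h.tsum_eq, tsum_eq_sum (s := Finset.range N)]
  · refine Finset.sum_congr rfl fun n _ => ?_
    rw [integral_pow_mul_fejer_zero]; ring
  · intro n hn
    rw [integral_pow_mul_fejer_zero, Nat.sub_eq_zero_of_le (by simpa using hn)]
    simp

theorem closedBall_subset_of_ball {s : Set ℂ} (hs : IsClosed s)
    (h : Metric.ball (0 : ℂ) 1 ⊆ s) {z : ℂ} (hz : ‖z‖ ≤ 1) : z ∈ s := by
  have : closure (Metric.ball (0 : ℂ) 1) ⊆ s := hs.closure_subset_iff.mpr h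
  rw [closure_ball _ one_ne_zero] at this
  exact this (by simpa using hz)

theorem norm_cesaroSum_le {a : ℕ → ℂ} {f : ℂ → ℂ}
    (hf : ∀ z, ‖z‖ < 1 → HasSum (fun n => a n * z ^ n) (f z)) {M : ℝ}
    (hM : ∀ z, ‖z‖ < 1 → ‖f z‖ ≤ M) (N : ℕ) {z : ℂ} (hz : ‖z‖ ≤ 1) :
    ‖cesaroSum a N z‖ ≤ M * N := by
  refine closedBall_subset_of_ball (s := {z | ‖cesaroSum a N z‖ ≤ M * N})
    (isClosed_le (by fun_prop) continuous_const) (fun w hw => ?_) hz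
  have hw : ‖w‖ < 1 := by simpa using hw
  rw [mem_ofPred_eq, cesaroSum_eq_integral hf N hw]
  exact norm_integral_mul_fejer_le N fun ζ hζ => hM _ (by simpa [hζ] using hw)

/-- Bernstein's inequality on the closed unit disk. -/
theorem norm_deriv_polynomial_le {N : ℕ} {b : ℕ → ℂ} {M : ℝ}
    (hM : ∀ z, ‖z‖ ≤ 1 → ‖∑ n ∈ Finset.range (N + 1), b n * z ^ n‖ ≤ M) {z : ℂ} (hz : ‖z‖ ≤ 1) :
    ‖∑ n ∈ Finset.range (N + 1), b n * (n * z ^ (n - 1))‖ ≤ M * N := by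
  set p : ℂ → ℂ := fun z => ∑ n ∈ Finset.range (N + 1), b n * z ^ n with hp
  set q : ℂ → ℂ := fun z => ∑ n ∈ Finset.range (N + 1), b n * (n * z ^ (n - 1)) with hq
  have hqd : Differentiable ℂ q := by rw [hq]; fun_prop
  have hb : ∀ w, ‖w‖ = 1 → ‖q w‖ ≤ M * N := by
    intro w hw
    -- Multiplying by `w` does not change the modulus on the circle and turns the derivative into
    -- the multiplier `n`, which is what the shifted Fejér kernel reproduces.
    have h1 : w * q w = ∑ n ∈ Finset.range (N + 1), b n * w ^ n * n := by
      rw [hq, Finset.mul_sum]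
      refine Finset.sum_congr rfl fun n _ => ?_
      rcases n with _ | n
      · simp
      · simp only [Nat.add_sub_cancel, pow_succ]; ring
    have hint : ∀ n, Integrable (fun ζ => b n * w ^ n * (ζ ^ n * (conj ζ ^ N * (dirichletSum N ζ *
        conj (dirichletSum N ζ))))) circleMeasure := fun n =>
      integrable_of_bounded (C := ‖b n‖ * (N * N)) (by fun_prop) fun ζ hζ => by
        simp only [norm_mul, RCLike.norm_conj, norm_pow, hζ, hw, one_pow, mul_one, one_mul]
        gcongr <;> exact norm_dirichletSum_le N hζ
    have h2 : w * q w = ∫ ζ, (p (w * ζ) * conj ζ ^ N) *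
        (dirichletSum N ζ * conj (dirichletSum N ζ)) ∂circleMeasure := by
      have h3 : ∀ ζ, (p (w * ζ) * conj ζ ^ N) * (dirichletSum N ζ * conj (dirichletSum N ζ)) =
          ∑ n ∈ Finset.range (N + 1), b n * w ^ n * (ζ ^ n * (conj ζ ^ N * (dirichletSum N ζ *
            conj (dirichletSum N ζ)))) := by
        intro ζ
        simp only [hp, Finset.sum_mul]
        refine Finset.sum_congr rfl fun n _ => ?_
        rw [mul_pow]; ring
      simp only [h3]
      rw [integral_finsetSum _ fun n _ => hint n, h1]
      refine Finset.sum_congr rfl fun n hn => ?_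
      rw [integral_const_mul, integral_pow_mul_shifted_fejer N n
        (Nat.lt_succ_iff.mp (Finset.mem_range.mp hn))]
    have h4 : ‖q w‖ = ‖w * q w‖ := by simp [hw]
    rw [h4, h2]
    refine norm_integral_mul_fejer_le N fun ζ hζ => ?_
    simpa [hζ] using hM (w * ζ) (by simp [hw, hζ])
  refine Complex.norm_le_of_forall_mem_frontier_norm_le (U := Metric.ball 0 1)
    Metric.isBounded_ball hqd.diffContOnCl (fun w hw => hb w ?_) ?_
  · rw [frontier_ball _ one_ne_zero] at hw; simpa using hw
  · rw [closure_ball _ one_ne_zero]; simpa using hz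

/-- Bernstein's inequality for a polynomial bounded by `M * N`, followed by the mean value
inequality on the convex disk. The term `n = N` has weight zero, so adding it in order to reach the
form of degree `N` is harmless. -/
theorem norm_cesaroSum_sub_le {a : ℕ → ℂ} {f : ℂ → ℂ}
    (hf : ∀ z, ‖z‖ < 1 → HasSum (fun n => a n * z ^ n) (f z)) {M : ℝ}
    (hM : ∀ z, ‖z‖ < 1 → ‖f z‖ ≤ M) (N : ℕ) {z w : ℂ} (hz : ‖z‖ ≤ 1) (hw : ‖w‖ ≤ 1) :
    ‖cesaroSum a N z - cesaroSum a N w‖ ≤ M * N * N * ‖z - w‖ := by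
  have hc : ∀ z, cesaroSum a N z =
      ∑ n ∈ Finset.range (N + 1), (((N - n : ℕ) : ℂ) * a n) * z ^ n := by
    intro z
    rw [Finset.sum_range_succ]
    simp [cesaroSum]
  have hd : ∀ z, deriv (cesaroSum a N) z =
      ∑ n ∈ Finset.range (N + 1), (((N - n : ℕ) : ℂ) * a n) * (n * z ^ (n - 1)) := by
    intro z
    rw [funext hc]
    refine HasDerivAt.deriv ?_
    refine HasDerivAt.fun_sum fun n _ => ?_
    exact (hasDerivAt_pow n z).const_mul _
  refine (convex_closedBall (0 : ℂ) 1).norm_image_sub_le_of_norm_deriv_le (𝕜 := ℂ)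
    (fun x _ => (differentiable_cesaroSum a N) x) (fun x hx => ?_)
    (by simpa using hw) (by simpa using hz)
  rw [hd]
  refine norm_deriv_polynomial_le (fun z hz => ?_) (by simpa using hx)
  rw [← hc]
  exact norm_cesaroSum_le hf hM N hz

/-! ### Convex sequences as superpositions of tents -/

/-- A nonnegative, decreasing, convex sequence with `∑ α n / (n + 1) < ∞`. -/
structure IsSlowConvex (α : ℕ → ℝ) : Prop where
  nonneg : ∀ n, 0 ≤ α n
  antitone : Antitone α
  convex : ∀ n, 0 ≤ α n - 2 * α (n + 1) + α (n + 2)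
  summable : Summable fun n : ℕ => α n / (n + 1)

/-- The second difference of a sequence. -/
def secondDiff (α : ℕ → ℝ) (n : ℕ) : ℝ := α n - 2 * α (n + 1) + α (n + 2)

namespace IsSlowConvex

variable {α : ℕ → ℝ}

/-- A positive limit would make the harmonic series converge by comparison. -/
theorem tendsto_zero (h : IsSlowConvex α) : Tendsto α atTop (𝓝 0) := by
  obtain ⟨l, hl⟩ : ∃ l, Tendsto α atTop (𝓝 l) :=
    ⟨_, tendsto_atTop_ciInf h.antitone ⟨0, by rintro _ ⟨n, rfl⟩; exact h.nonneg n⟩⟩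
  have hle : ∀ n, l ≤ α n := fun n => h.antitone.le_of_tendsto hl n
  have h0 : 0 ≤ l := ge_of_tendsto' hl h.nonneg
  rcases h0.eq_or_lt with h0 | h0
  · rwa [h0]
  exfalso
  have hs : Summable fun n : ℕ => l / ((n : ℝ) + 1) :=
    Summable.of_nonneg_of_le (fun n => by positivity)
      (fun n => by gcongr; exact hle n) h.summable
  have h1 : Summable fun n : ℕ => 1 / ((n : ℝ) + 1) := by
    refine (hs.mul_left l⁻¹).congr fun n => ?_
    field_simp
  have h2 := (summable_nat_add_iff (f := fun n : ℕ => 1 / (n : ℝ)) 1).mp (by simpa using h1)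
  exact Real.not_summable_one_div_natCast h2

theorem secondDiff_nonneg (h : IsSlowConvex α) (n : ℕ) : 0 ≤ secondDiff α n := h.convex n

/-- Double summation by parts; the truncated weight vanishes for `k < j`, so the sum effectively
starts at `k = j`. -/
theorem sum_range_secondDiff (α : ℕ → ℝ) (j m : ℕ) :
    ∑ k ∈ Finset.range (j + m), ((k + 1 - j : ℕ) : ℝ) * secondDiff α k =
      α j - α (j + m) - m * (α (j + m) - α (j + m + 1)) := by
  induction m with
  | zero =>
    simp only [add_zero, Nat.cast_zero, zero_mul, sub_self]
    refine Finset.sum_eq_zero fun k hk => ?_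
    rw [Nat.sub_eq_zero_of_le (by simpa [Nat.succ_le_iff] using hk)]
    simp
  | succ m ih =>
    rw [← add_assoc, Finset.sum_range_succ, ih, show j + m + 1 - j = m + 1 by omega, secondDiff]
    push_cast
    ring

theorem hasSum_of_diff {u : ℕ → ℝ} (h : Tendsto u atTop (𝓝 0)) (hd : ∀ n, u (n + 1) ≤ u n) :
    HasSum (fun n => u n - u (n + 1)) (u 0) := by
  rw [hasSum_iff_tendsto_nat_of_nonneg (fun n => sub_nonneg.mpr (hd n))]
  simp only [Finset.sum_range_sub']
  simpa using h.const_sub (u 0)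

theorem hasSum_secondDiff (h : IsSlowConvex α) (j : ℕ) :
    HasSum (fun k => ((k + 1 - j : ℕ) : ℝ) * secondDiff α k) (α j) := by
  have hnn : ∀ k, 0 ≤ ((k + 1 - j : ℕ) : ℝ) * secondDiff α k := fun k =>
    mul_nonneg (Nat.cast_nonneg _) (h.secondDiff_nonneg k)
  have hd : ∀ n, 0 ≤ α n - α (n + 1) := fun n => sub_nonneg.mpr (h.antitone n.le_succ)
  have hsum : Summable (fun k => ((k + 1 - j : ℕ) : ℝ) * secondDiff α k) := by
    refine summable_of_sum_range_le (c := α j) hnn fun n => ?_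
    refine (Finset.sum_le_sum_of_subset_of_nonneg
      (Finset.range_mono (Nat.le_add_left n j)) fun k _ _ => hnn k).trans ?_
    rw [sum_range_secondDiff]
    have := mul_nonneg (Nat.cast_nonneg (α := ℝ) n) (hd (j + n))
    linarith [h.nonneg (j + n)]
  have htail := tendsto_sum_nat_add (fun k => ((k + 1 - j : ℕ) : ℝ) * secondDiff α k)
  -- The first difference at `j + m` is the sum of all second differences from there on. Each of
  -- these carries a weight of at least `m` in the convergent series, so the boundary term is
  -- dominated by a tail.
  have hlim : Tendsto (fun m : ℕ => (m : ℝ) * (α (j + m) - α (j + m + 1))) atTop (𝓝 0) := by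
    refine squeeze_zero (fun m => mul_nonneg (Nat.cast_nonneg _) (hd _)) (fun m => ?_)
      (htail.comp (tendsto_add_atTop_nat j))
    have hz : Tendsto (fun n => α (j + m + n) - α (j + m + n + 1)) atTop (𝓝 0) := by
      have h1 : Tendsto (fun n => α (j + m + n)) atTop (𝓝 0) := by
        simpa only [add_comm, Function.comp_def] using h.tendsto_zero.comp (tendsto_add_atTop_nat (j + m))
      have h2 : Tendsto (fun n => α (j + m + n + 1)) atTop (𝓝 0) :=
        h1.comp (tendsto_add_atTop_nat 1)
      simpa using h1.sub h2
    have h3 := hasSum_of_diff hz (fun n => by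
      have := h.convex (j + m + n)
      simp only [← add_assoc] at this ⊢
      linarith)
    simp only [add_zero] at h3
    have h4 := h3.mul_left (m : ℝ)
    rw [← h4.tsum_eq]
    refine h4.summable.tsum_le_tsum (fun i => ?_)
      ((summable_nat_add_iff (m + j)).mpr hsum)
    have h5 : α (j + m + i) - α (j + m + i + 1) - (α (j + m + (i + 1)) - α (j + m + (i + 1) + 1)) =
        secondDiff α (i + (m + j)) := by
      rw [secondDiff, show i + (m + j) = j + m + i by omega]
      simp only [← add_assoc]
      ring
    rw [h5]
    refine mul_le_mul_of_nonneg_right ?_ (h.secondDiff_nonneg _)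
    exact_mod_cast (by omega : m ≤ i + (m + j) + 1 - j)
  have h6 : Tendsto (fun m => ∑ k ∈ Finset.range (m + j), ((k + 1 - j : ℕ) : ℝ) * secondDiff α k)
      atTop (𝓝 (α j)) := by
    have h7 : Tendsto (fun m => α (j + m)) atTop (𝓝 0) := by
      simpa only [add_comm, Function.comp_def] using h.tendsto_zero.comp (tendsto_add_atTop_nat j)
    have := (h7.const_sub (α j)).sub hlim
    simp only [sub_zero] at this
    refine this.congr fun m => ?_
    rw [add_comm m j, sum_range_secondDiff]
  rw [hasSum_iff_tendsto_nat_of_nonneg hnn]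
  exact (tendsto_add_atTop_iff_nat j).mp h6

theorem summable_mul_secondDiff (h : IsSlowConvex α) :
    Summable fun k : ℕ => ((k : ℝ) + 1) * secondDiff α k := by
  simpa using (h.hasSum_secondDiff 0).summable

/-- Since `(k + 1 - n) / (n + 1) = (k + 2) / (n + 1) - 1`, the sum equals `(k + 2) H - (k + 1)` with
the harmonic number `H = H_{k+1} ≥ log (k + 2)`. -/
theorem sum_weights (k : ℕ) :
    ((k : ℝ) + 1) * (Real.log (k + 2) - 1) ≤
      ∑ n ∈ Finset.range (k + 1), ((k + 1 - n : ℕ) : ℝ) / (n + 1) := by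
  have h1 : ∑ n ∈ Finset.range (k + 1), ((k + 1 - n : ℕ) : ℝ) / (n + 1) =
      (k + 2) * ∑ n ∈ Finset.range (k + 1), ((n : ℝ) + 1)⁻¹ - (k + 1) := by
    have : ∀ n ∈ Finset.range (k + 1), ((k + 1 - n : ℕ) : ℝ) / (n + 1) =
        (k + 2) * ((n : ℝ) + 1)⁻¹ - 1 := by
      intro n hn
      rw [Nat.cast_sub (by simpa using (Finset.mem_range.mp hn).le)]
      push_cast
      field_simp
      ring
    rw [Finset.sum_congr rfl this, Finset.sum_sub_distrib, ← Finset.mul_sum]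
    simp
  have h2 : Real.log (k + 2) ≤ ∑ n ∈ Finset.range (k + 1), ((n : ℝ) + 1)⁻¹ := by
    have := log_add_one_le_harmonic (k + 1)
    simp only [harmonic] at this
    push_cast at this
    rwa [show (k : ℝ) + 1 + 1 = k + 2 by ring] at this
  have h3 : 0 ≤ Real.log ((k : ℝ) + 2) := Real.log_nonneg (by linarith [k.cast_nonneg (α := ℝ)])
  rw [h1]
  nlinarith [k.cast_nonneg (α := ℝ)]

/-- This is where `∑ α n / (n + 1) < ∞` enters quantitatively: replacing `α n` by its tent
representation and exchanging sums leaves `Δ²α k` with the weights of `sum_weights`. -/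
theorem summable_log_mul_secondDiff (h : IsSlowConvex α) :
    Summable fun k : ℕ => ((k : ℝ) + 1) * Real.log (k + 2) * secondDiff α k := by
  have hs : Summable fun k : ℕ =>
      (∑ n ∈ Finset.range (k + 1), ((k + 1 - n : ℕ) : ℝ) / (n + 1)) * secondDiff α k := by
    refine summable_of_sum_range_le (c := ∑' n : ℕ, α n / (n + 1))
      (fun k => mul_nonneg (Finset.sum_nonneg fun n _ => by positivity) (h.secondDiff_nonneg k))
      fun K => ?_
    have h1 : ∀ k ∈ Finset.range K,
        (∑ n ∈ Finset.range (k + 1), ((k + 1 - n : ℕ) : ℝ) / (n + 1)) * secondDiff α k =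
        ∑ n ∈ Finset.range K, ((k + 1 - n : ℕ) : ℝ) / (n + 1) * secondDiff α k := by
      intro k hk
      rw [Finset.sum_mul]
      refine Finset.sum_subset (Finset.range_mono (Finset.mem_range.mp hk)) fun n _ hn => ?_
      rw [Nat.sub_eq_zero_of_le (by simpa using hn)]
      simp
    rw [Finset.sum_congr rfl h1, Finset.sum_comm]
    refine (Finset.sum_le_sum fun n _ => ?_).trans
      (h.summable.sum_le_tsum (Finset.range K) fun n _ => div_nonneg (h.nonneg n) (by positivity))
    have h2 : ∀ k, ((k + 1 - n : ℕ) : ℝ) / (n + 1) * secondDiff α k =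
        (((k + 1 - n : ℕ) : ℝ) * secondDiff α k) / (n + 1) := fun k => by ring
    simp only [h2]
    rw [← Finset.sum_div]
    gcongr
    refine sum_le_hasSum _ (fun k _ => ?_) (h.hasSum_secondDiff n)
    exact mul_nonneg (Nat.cast_nonneg _) (h.secondDiff_nonneg k)
  -- The loss of `k + 1` in `sum_weights` is made up by the convergent series `∑ (k + 1) Δ²α k`.
  refine Summable.of_nonneg_of_le (fun k => ?_) (fun k => ?_) (hs.add h.summable_mul_secondDiff)
  · have := Real.log_nonneg (x := (k : ℝ) + 2) (by linarith [k.cast_nonneg (α := ℝ)])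
    have := h.secondDiff_nonneg k
    positivity
  · rw [← add_mul]
    refine mul_le_mul_of_nonneg_right ?_ (h.secondDiff_nonneg k)
    linarith [sum_weights k]

/-- The exponential of a convex function is convex. In this form products of logarithms become sums
of concave functions, and no second derivative is needed. -/
theorem of_exp_neg_concave {ψ : ℝ → ℝ} (hc : ConcaveOn ℝ (Ici 0) ψ) (hm : MonotoneOn ψ (Ici 0))
    (hα : ∀ n : ℕ, α n = Real.exp (-ψ n)) (hs : Summable fun n : ℕ => α n / (n + 1)) :
    IsSlowConvex α where
  nonneg n := by rw [hα]; positivity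
  antitone := by
    intro a b hab
    rw [hα, hα, Real.exp_le_exp, neg_le_neg_iff]
    exact hm (by simp) (by simp) (by exact_mod_cast hab)
  convex n := by
    have h1 := hc.2 (mem_Ici.mpr (Nat.cast_nonneg n)) (mem_Ici.mpr (Nat.cast_nonneg (n + 2)))
      (by norm_num : (0 : ℝ) ≤ 1 / 2) (by norm_num : (0 : ℝ) ≤ 1 / 2) (by norm_num)
    simp only [smul_eq_mul] at h1
    rw [show 1 / 2 * (n : ℝ) + 1 / 2 * ((n + 2 : ℕ) : ℝ) = ((n + 1 : ℕ) : ℝ) by push_cast; ring] at h1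
    have h2 := convexOn_exp.2 (mem_univ (-ψ n)) (mem_univ (-ψ ((n + 2 : ℕ) : ℝ)))
      (by norm_num : (0 : ℝ) ≤ 1 / 2) (by norm_num : (0 : ℝ) ≤ 1 / 2) (by norm_num)
    simp only [smul_eq_mul] at h2
    have h3 : Real.exp (-ψ ((n + 1 : ℕ) : ℝ)) ≤
        Real.exp (1 / 2 * -ψ n + 1 / 2 * -ψ ((n + 2 : ℕ) : ℝ)) :=
      Real.exp_le_exp.mpr (by linarith)
    rw [hα, hα, hα]
    linarith
  summable := hs

end IsSlowConvex

/-! ### The logarithmic scale: concavity and the Bertrand series -/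

theorem concaveOn_log_comp {s : Set ℝ} {u : ℝ → ℝ} (hu : ConcaveOn ℝ s u)
    (hpos : ∀ x ∈ s, 0 < u x) : ConcaveOn ℝ s fun x => Real.log (u x) := by
  refine ⟨hu.1, fun x hx y hy a b ha hb hab => ?_⟩
  have h1 := strictConcaveOn_log_Ioi.concaveOn.2 (mem_Ioi.mpr (hpos x hx)) (mem_Ioi.mpr (hpos y hy))
    ha hb hab
  have h2 := hu.2 hx hy ha hb hab
  have h3 := convex_Ioi (0 : ℝ) (mem_Ioi.mpr (hpos x hx)) (mem_Ioi.mpr (hpos y hy)) ha hb hab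
  exact h1.trans (Real.log_le_log h3 h2)

theorem isSlowConvex_rpow {ε : ℝ} (hε : 0 < ε) {α : ℕ → ℝ}
    (hα : ∀ n : ℕ, α n = 1 / ((n : ℝ) + 1) ^ ε) : IsSlowConvex α := by
  have hpos : ∀ x ∈ Ici (0 : ℝ), 0 < x + 1 := fun x hx => by have := mem_Ici.mp hx; linarith
  refine IsSlowConvex.of_exp_neg_concave (ψ := fun x => ε • Real.log (x + 1)) ?_ ?_ ?_ ?_
  · exact (concaveOn_log_comp ((concaveOn_id (convex_Ici 0)).add_const 1) hpos).smul hε.le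
  · intro x hx y hy hxy
    have := Real.log_le_log (hpos x hx) (by linarith : x + 1 ≤ y + 1)
    simp only [smul_eq_mul]
    gcongr
  · intro n
    rw [hα, Real.rpow_def_of_pos (by positivity), one_div, ← Real.exp_neg, smul_eq_mul, mul_comm]
  · have h1 : Summable fun n : ℕ => 1 / (n : ℝ) ^ (1 + ε) :=
      Real.summable_one_div_nat_rpow.mpr (by linarith)
    refine ((summable_nat_add_iff 1).mpr h1).congr fun n => ?_
    rw [hα, div_div, Nat.cast_add_one, Real.rpow_add (by positivity), Real.rpow_one, mul_comm]

theorem iterate_log_mono {k : ℕ} {x y : ℝ} (hx : ∀ i ≤ k, 0 < Real.log^[i] x) (hxy : x ≤ y) :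
    ∀ i ≤ k, Real.log^[i] x ≤ Real.log^[i] y := by
  intro i
  induction i with
  | zero => intro _; simpa using hxy
  | succ i ih =>
    intro hi
    rw [Function.iterate_succ_apply', Function.iterate_succ_apply']
    exact Real.log_le_log (hx i (by omega)) (ih (by omega))

theorem iterate_log_pos {k : ℕ} {x y : ℝ} (hx : ∀ i ≤ k, 0 < Real.log^[i] x) (hxy : x ≤ y) :
    ∀ i ≤ k, 0 < Real.log^[i] y := fun i hi => (hx i hi).trans_le (iterate_log_mono hx hxy i hi)

theorem concaveOn_iterate_log {k : ℕ} {c : ℝ} (hc : ∀ i ≤ k, 0 < Real.log^[i] c) :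
    ∀ i ≤ k, ConcaveOn ℝ (Ici 0) fun x => Real.log^[i] (x + c) := by
  intro i
  induction i with
  | zero => intro _; exact (concaveOn_id (convex_Ici (0 : ℝ))).add_const c
  | succ i ih =>
    intro hi
    simp only [Function.iterate_succ_apply']
    refine concaveOn_log_comp (ih (by omega)) fun x hx => ?_
    exact iterate_log_pos hc (by simpa using hx) i (by omega)

theorem hasDerivAt_iterate_log {k : ℕ} {x : ℝ} (hx : ∀ i ≤ k, 0 < Real.log^[i] x) :
    ∀ i ≤ k, HasDerivAt (Real.log^[i]) (∏ j ∈ Finset.range i, Real.log^[j] x)⁻¹ x := by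
  intro i
  induction i with
  | zero => intro _; simpa using hasDerivAt_id x
  | succ i ih =>
    intro hi
    have h := (ih (by omega)).log (hx i (by omega)).ne'
    rw [Finset.prod_range_succ, mul_inv, ← div_eq_mul_inv]
    refine h.congr_of_eventuallyEq (Eventually.of_forall fun y => ?_)
    rw [Function.iterate_succ_apply']

/-- The derivative of `-(log^[k] x) ^ (-ε) / ε`. -/
noncomputable def bertrandWeight (k : ℕ) (ε x : ℝ) : ℝ :=
  ((∏ j ∈ Finset.range k, Real.log^[j] x) * (Real.log^[k] x) ^ (1 + ε))⁻¹

theorem bertrandWeight_anti {k : ℕ} {ε x y : ℝ} (hε : 0 < ε) (hx : ∀ i ≤ k, 0 < Real.log^[i] x)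
    (hxy : x ≤ y) : bertrandWeight k ε y ≤ bertrandWeight k ε x := by
  have hp : 0 < ∏ j ∈ Finset.range k, Real.log^[j] x :=
    Finset.prod_pos fun i hi => hx i (Finset.mem_range.mp hi).le
  refine inv_anti₀ (mul_pos hp (Real.rpow_pos_of_pos (hx k le_rfl) _)) ?_
  refine mul_le_mul ?_ ?_ (Real.rpow_pos_of_pos (hx k le_rfl) _).le
    (Finset.prod_nonneg fun i hi => (iterate_log_pos hx hxy i (Finset.mem_range.mp hi).le).le)
  · exact Finset.prod_le_prod (fun i hi => (hx i (Finset.mem_range.mp hi).le).le)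
      fun i hi => iterate_log_mono hx hxy i (Finset.mem_range.mp hi).le
  · exact Real.rpow_le_rpow (hx k le_rfl).le (iterate_log_mono hx hxy k le_rfl) (by linarith)

theorem bertrandWeight_nonneg {k : ℕ} {ε x : ℝ} (hx : ∀ i ≤ k, 0 < Real.log^[i] x) :
    0 ≤ bertrandWeight k ε x :=
  inv_nonneg.mpr (mul_nonneg (Finset.prod_nonneg fun i hi => (hx i (Finset.mem_range.mp hi).le).le)
    (Real.rpow_nonneg (hx k le_rfl).le _))

/-- Mean value theorem on `[x, x + 1]`, with the weight decreasing. The right-hand side telescopes,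
giving an integral test without integrals. -/
theorem bertrandWeight_le_sub {k : ℕ} {ε x : ℝ} (hε : 0 < ε) (hx : ∀ i ≤ k, 0 < Real.log^[i] x) :
    ε * bertrandWeight k ε (x + 1) ≤ (Real.log^[k] x) ^ (-ε) - (Real.log^[k] (x + 1)) ^ (-ε) := by
  have hd : ∀ y, x ≤ y → HasDerivAt (fun y => (Real.log^[k] y) ^ (-ε))
      (-(ε * bertrandWeight k ε y)) y := by
    intro y hy
    have hy' := iterate_log_pos hx hy
    have h := (hasDerivAt_iterate_log hy' k le_rfl).rpow_const (p := -ε) (Or.inl (hy' k le_rfl).ne')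
    convert h using 1
    rw [bertrandWeight, mul_inv, ← Real.rpow_neg (hy' k le_rfl).le,
      show -(1 + ε) = -ε - 1 by ring]
    ring
  obtain ⟨ξ, hξ, h⟩ := exists_hasDerivAt_eq_slope (fun y => (Real.log^[k] y) ^ (-ε))
    (fun y => -(ε * bertrandWeight k ε y)) (by linarith : x < x + 1)
    (fun y hy => (hd y hy.1).continuousAt.continuousWithinAt) (fun y hy => hd y hy.1.le)
  have h2 := bertrandWeight_anti hε (iterate_log_pos hx hξ.1.le) hξ.2.le
  simp only [add_sub_cancel_left, div_one] at h
  nlinarith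

theorem summable_bertrandWeight {k : ℕ} {ε c : ℝ} (hε : 0 < ε)
    (hc : ∀ i ≤ k, 0 < Real.log^[i] c) :
    Summable fun n : ℕ => bertrandWeight k ε (c + n + 1) := by
  have hpos : ∀ n : ℕ, ∀ i ≤ k, 0 < Real.log^[i] (c + n) := fun n =>
    iterate_log_pos hc (by simp)
  refine summable_of_sum_range_le (c := (Real.log^[k] c) ^ (-ε) / ε)
    (fun n => bertrandWeight_nonneg (iterate_log_pos (hpos n) (by simp))) fun K => ?_
  rw [le_div_iff₀ hε, mul_comm, Finset.mul_sum]
  refine (Finset.sum_le_sum fun n _ => bertrandWeight_le_sub hε (hpos n)).trans ?_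
  have h := Finset.sum_range_sub' (fun n : ℕ => (Real.log^[k] (c + n)) ^ (-ε)) K
  simp only [Nat.cast_add, Nat.cast_one, ← add_assoc, Nat.cast_zero, add_zero] at h
  rw [h]
  linarith [Real.rpow_nonneg (hpos K k le_rfl).le (-ε)]

theorem isSlowConvex_iteratedLog {ε : ℝ} (hε : 0 < ε) {α : ℕ → ℝ}
    (hα : IsIteratedLogSequence ε α) : IsSlowConvex α := by
  obtain ⟨k, hk, c, hc, hα⟩ := hα
  have hc' : ∀ j, 1 ≤ j → j ≤ k → ∀ i ≤ j, 0 < Real.log^[i] (c j : ℝ) := fun j h1 h2 =>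
    hc j (Finset.mem_Icc.mpr ⟨h1, h2⟩)
  have hpos : ∀ j, 1 ≤ j → j ≤ k → ∀ x ∈ Ici (0 : ℝ), 0 < Real.log^[j] (x + c j) :=
    fun j h1 h2 x hx => iterate_log_pos (hc' j h1 h2) (by simpa using hx) j le_rfl
  have hconc : ∀ j, 1 ≤ j → j ≤ k →
      ConcaveOn ℝ (Ici 0) fun x => Real.log (Real.log^[j] (x + c j)) := fun j h1 h2 =>
    concaveOn_log_comp (concaveOn_iterate_log (hc' j h1 h2) j le_rfl) (hpos j h1 h2)
  have hmono : ∀ j, 1 ≤ j → j ≤ k →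
      MonotoneOn (fun x => Real.log (Real.log^[j] (x + c j))) (Ici 0) := by
    intro j h1 h2 x hx y hy hxy
    refine Real.log_le_log (hpos j h1 h2 x hx) ?_
    exact iterate_log_mono (iterate_log_pos (hc' j h1 h2) (by simpa using hx))
      (by linarith) j le_rfl
  refine IsSlowConvex.of_exp_neg_concave (ψ := fun x =>
    (∑ j ∈ Finset.Ico 1 k, Real.log (Real.log^[j] (x + c j))) +
      (1 + ε) * Real.log (Real.log^[k] (x + c k))) ?_ ?_ ?_ ?_
  · refine ConcaveOn.add ?_ ((hconc k hk le_rfl).smul (by linarith))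
    have : ∀ s : Finset ℕ, (∀ j ∈ s, 1 ≤ j ∧ j ≤ k) →
        ConcaveOn ℝ (Ici 0) fun x => ∑ j ∈ s, Real.log (Real.log^[j] (x + c j)) := by
      intro s
      induction s using Finset.induction_on with
      | empty => intro _; simpa using concaveOn_const (0 : ℝ) (convex_Ici (0 : ℝ))
      | insert a s ha ih =>
        intro hs
        simp only [Finset.sum_insert ha]
        exact (hconc a (hs a (by simp)).1 (hs a (by simp)).2).add
          (ih fun j hj => hs j (by simp [hj]))
    exact this _ fun j hj => ⟨(Finset.mem_Ico.mp hj).1, (Finset.mem_Ico.mp hj).2.le⟩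
  · intro x hx y hy hxy
    have h1 := hmono k hk le_rfl hx hy hxy
    refine add_le_add (Finset.sum_le_sum fun j hj => ?_)
      (mul_le_mul_of_nonneg_left h1 (by linarith))
    exact hmono j (Finset.mem_Ico.mp hj).1 (Finset.mem_Ico.mp hj).2.le hx hy hxy
  · intro n
    have hn : (n : ℝ) ∈ Ici (0 : ℝ) := by simp
    have h1 : Real.exp (∑ j ∈ Finset.Ico 1 k, Real.log (Real.log^[j] ((n : ℝ) + c j))) =
        ∏ j ∈ Finset.Ico 1 k, Real.log^[j] ((n : ℝ) + c j) := by
      rw [Real.exp_sum]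
      exact Finset.prod_congr rfl fun j hj => Real.exp_log
        (hpos j (Finset.mem_Ico.mp hj).1 (Finset.mem_Ico.mp hj).2.le _ hn)
    rw [hα, Real.exp_neg, Real.exp_add, h1, Real.rpow_def_of_pos (hpos k hk le_rfl _ hn), one_div,
      mul_comm (Real.log _)]
  -- Discarding `c k + 1` terms puts every factor at or beyond `x = c k + n + 1 ≥ c k`, where the
  -- unshifted iterated logarithms are positive. The denominator is then `x + 1 ≥ x`, and this `x`
  -- is the factor `log^[0] x` of the Bertrand weight.
  · refine (summable_nat_add_iff (c k + 1)).mp ?_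
    refine Summable.of_nonneg_of_le (fun n => ?_) (fun n => ?_)
      (summable_bertrandWeight hε (hc' k hk le_rfl))
    · rw [hα]
      have hn : (((n + (c k + 1) : ℕ)) : ℝ) ∈ Ici (0 : ℝ) := mem_Ici.mpr (Nat.cast_nonneg _)
      have h1 : 0 ≤ ∏ j ∈ Finset.Ico 1 k, Real.log^[j] (((n + (c k + 1) : ℕ) : ℝ) + c j) :=
        Finset.prod_nonneg fun j hj =>
          (hpos j (Finset.mem_Ico.mp hj).1 (Finset.mem_Ico.mp hj).2.le _ hn).le
      have h2 := Real.rpow_nonneg (hpos k hk le_rfl _ hn).le (1 + ε)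
      positivity
    · set x : ℝ := (c k : ℝ) + n + 1 with hx
      have hxn : (((n + (c k + 1) : ℕ)) : ℝ) = x := by push_cast; ring
      have hxp : ∀ i ≤ k, 0 < Real.log^[i] x := iterate_log_pos (hc' k hk le_rfl) (by
        rw [hx]; linarith [n.cast_nonneg (α := ℝ)])
      have hx0 : 0 < x := hxp 0 (by omega)
      rw [hα, hxn, bertrandWeight, div_div, one_div]
      refine inv_anti₀ (mul_pos (Finset.prod_pos fun i hi => hxp i (Finset.mem_range.mp hi).le)
        (Real.rpow_pos_of_pos (hxp k le_rfl) _)) ?_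
      rw [Finset.range_eq_Ico, Finset.prod_eq_prod_Ico_succ_bot (by omega : 0 < k)]
      have h1 : ∏ j ∈ Finset.Ico 1 k, Real.log^[j] x ≤
          ∏ j ∈ Finset.Ico 1 k, Real.log^[j] (x + c j) :=
        Finset.prod_le_prod (fun j hj => (hxp j (Finset.mem_Ico.mp hj).2.le).le) fun j hj =>
          iterate_log_mono hxp (by simp) j (Finset.mem_Ico.mp hj).2.le
      have h2 : (Real.log^[k] x) ^ (1 + ε) ≤ (Real.log^[k] (x + c k)) ^ (1 + ε) :=
        Real.rpow_le_rpow (hxp k le_rfl).le (iterate_log_mono hxp (by simp) k le_rfl) (by linarith)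
      have h3 : 0 ≤ ∏ j ∈ Finset.Ico 1 k, Real.log^[j] x :=
        Finset.prod_nonneg fun j hj => (hxp j (Finset.mem_Ico.mp hj).2.le).le
      have h4 : 0 ≤ (Real.log^[k] x) ^ (1 + ε) := Real.rpow_nonneg (hxp k le_rfl).le _
      have h5 := mul_le_mul h1 h2 h4 (h3.trans h1)
      calc Real.log^[0] x * (∏ j ∈ Finset.Ico (0 + 1) k, Real.log^[j] x) *
            (Real.log^[k] x) ^ (1 + ε)
          = ((∏ j ∈ Finset.Ico 1 k, Real.log^[j] x) * (Real.log^[k] x) ^ (1 + ε)) * x := by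
            simp only [Function.iterate_zero, id, zero_add]; ring
        _ ≤ _ := mul_le_mul h5 (by linarith) hx0.le
            (mul_nonneg (h3.trans h1) (h4.trans h2))

theorem isSlowConvex_of_cases {ε : ℝ} (hε : 0 < ε) {α : ℕ → ℝ}
    (hα : (∀ n : ℕ, α n = 1 / ((n : ℝ) + 1) ^ ε) ∨
      (∀ n : ℕ, α n = 1 / (Real.log ((n : ℝ) + 2)) ^ (1 + ε)) ∨
      (∀ n : ℕ, α n = 1 / (Real.log ((n : ℝ) + 2) *
        (Real.log (Real.log ((n : ℝ) + 3))) ^ (1 + ε))) ∨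
      IsIteratedLogSequence ε α) : IsSlowConvex α := by
  have hlog2 : 0 < Real.log 2 := Real.log_pos (by norm_num)
  have hlog3 : 1 < Real.log 3 := by
    rw [Real.lt_log_iff_exp_lt (by norm_num)]
    exact Real.exp_one_lt_d9.trans (by norm_num)
  rcases hα with hα | hα | hα | hα
  · exact isSlowConvex_rpow hε hα
  · refine isSlowConvex_iteratedLog hε ⟨1, le_rfl, fun _ => 2, ?_, fun n => ?_⟩
    · intro j hj i hi
      have : j = 1 := by simpa using hj
      subst this
      interval_cases i <;> simp [hlog2]
    · rw [hα]; simp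
  -- The shifts are `2` and `3`; the double logarithm of `3` is positive because `3 > e`.
  · refine isSlowConvex_iteratedLog hε ⟨2, by norm_num, fun j => j + 1, ?_, fun n => ?_⟩
    · intro j hj i hi
      have hj' := Finset.mem_Icc.mp hj
      have h3 := Real.log_pos hlog3
      obtain rfl | rfl : j = 1 ∨ j = 2 := by omega
      · interval_cases i <;> norm_num [hlog2]
      · interval_cases i <;> norm_num [h3, hlog3, zero_lt_one.trans hlog3]
    · rw [hα]; norm_num
  · exact isSlowConvex_iteratedLog hε hα

/-! ### The logarithmic integral on the circle -/

/-- The chord has length `2 sin (θ / 2)`; Jordan's inequality is applied on each half of the circle.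
-/
theorem le_norm_circleMap_sub_one {θ : ℝ} (hθ : θ ∈ Icc 0 (2 * Real.pi)) :
    2 / Real.pi * min θ (2 * Real.pi - θ) ≤ ‖circleMap 0 1 θ - 1‖ := by
  have hpi := Real.pi_pos
  have h1 : ‖circleMap 0 1 θ - 1‖ = 2 * Real.sin (θ / 2) := by
    have h0 : 0 ≤ Real.sin (θ / 2) :=
      Real.sin_nonneg_of_nonneg_of_le_pi (by linarith [hθ.1]) (by linarith [hθ.2])
    have := Complex.norm_exp_I_mul_ofReal_sub_one θ
    rw [show circleMap 0 1 θ = Complex.exp (Complex.I * θ) by simp [circleMap, mul_comm], this,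
      Real.norm_of_nonneg (by positivity)]
  rw [h1]
  rcases le_total θ Real.pi with h | h
  · have h2 := Real.mul_le_sin (x := θ / 2) (by linarith [hθ.1]) (by linarith)
    have h3 : 2 / Real.pi * min θ (2 * Real.pi - θ) ≤ 2 / Real.pi * θ := by
      gcongr; exact min_le_left _ _
    linarith
  · have h2 := Real.mul_le_sin (x := Real.pi - θ / 2) (by linarith [hθ.2]) (by linarith)
    rw [Real.sin_pi_sub] at h2
    have h3 : 2 / Real.pi * min θ (2 * Real.pi - θ) ≤ 2 / Real.pi * (2 * Real.pi - θ) := by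
      gcongr; exact min_le_right _ _
    linarith

theorem integral_one_div_one_add_mul {b : ℝ} (hb : 0 < b) :
    ∫ θ in (0 : ℝ)..(2 * Real.pi), 1 / (1 + b * θ) = Real.log (1 + b * (2 * Real.pi)) / b := by
  have hpi := Real.pi_pos
  have hpos : ∀ θ ∈ uIcc 0 (2 * Real.pi), 0 < 1 + b * θ := by
    intro θ hθ
    rw [uIcc_of_le (by positivity)] at hθ
    have := mul_nonneg hb.le hθ.1
    linarith
  have h := intervalIntegral.integral_eq_sub_of_hasDerivAt (a := 0) (b := 2 * Real.pi)
    (f := fun θ => Real.log (1 + b * θ) / b) (f' := fun θ => 1 / (1 + b * θ)) (fun θ hθ => ?_) ?_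
  · rw [h]; simp
  · have h1 : HasDerivAt (fun θ : ℝ => 1 + b * θ) b θ := by
      simpa using ((hasDerivAt_id θ).const_mul b).const_add 1
    have h2 := (h1.log (hpos θ hθ).ne').div_const b
    rwa [div_right_comm, div_self hb.ne'] at h2
  · refine ContinuousOn.intervalIntegrable ?_
    exact continuousOn_const.div (by fun_prop) fun θ hθ => (hpos θ hθ).ne'

theorem integral_one_div_one_add_norm_le {N : ℝ} (hN : 0 < N) :
    ∫ ζ, 1 / (1 + N * ‖ζ - 1‖) ∂circleMeasure ≤ Real.log (1 + 4 * N) / (2 * N) := by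
  have hpi := Real.pi_pos
  rw [integral_circleMeasure (Measurable.aestronglyMeasurable (by fun_prop)),
    ← intervalIntegral.integral_of_le (by positivity)]
  -- `N` times the slope `2 / π` of the chord bound. The minimum of the two arcs is handled by
  -- adding both candidate integrands, which have equal integrals.
  set b : ℝ := 2 * N / Real.pi with hb
  have hb0 : 0 < b := by positivity
  have hcont : ContinuousOn (fun θ => 1 / (1 + b * θ)) (Icc 0 (2 * Real.pi)) :=
    continuousOn_const.div (by fun_prop) fun θ hθ => by
      have := mul_nonneg hb0.le hθ.1
      positivity
  have hi1 : IntervalIntegrable (fun θ => 1 / (1 + b * θ)) volume 0 (2 * Real.pi) :=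
    ContinuousOn.intervalIntegrable_of_Icc (by positivity) hcont
  have hi2 : IntervalIntegrable (fun θ => 1 / (1 + b * (2 * Real.pi - θ))) volume 0
      (2 * Real.pi) := by
    have := (hi1.comp_sub_left (2 * Real.pi)).symm
    simpa using this
  have hle : ∫ θ in (0 : ℝ)..(2 * Real.pi), 1 / (1 + N * ‖circleMap 0 1 θ - 1‖) ≤
      ∫ θ in (0 : ℝ)..(2 * Real.pi), (1 / (1 + b * θ) + 1 / (1 + b * (2 * Real.pi - θ))) := by
    refine intervalIntegral.integral_mono_on (by positivity) ?_ (hi1.add hi2) fun θ hθ => ?_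
    · refine Continuous.intervalIntegrable ?_ _ _
      exact continuous_const.div (by fun_prop) fun θ => by positivity
    · have h1 := le_norm_circleMap_sub_one hθ
      have h2 : b * min θ (2 * Real.pi - θ) ≤ N * ‖circleMap 0 1 θ - 1‖ := by
        calc b * min θ (2 * Real.pi - θ) = N * (2 / Real.pi * min θ (2 * Real.pi - θ)) := by
              rw [hb]; ring
          _ ≤ _ := by gcongr
      have h3 : 0 ≤ b * θ := mul_nonneg hb0.le hθ.1
      have h4 : 0 ≤ b * (2 * Real.pi - θ) := mul_nonneg hb0.le (by linarith [hθ.2])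
      rcases min_choice θ (2 * Real.pi - θ) with h5 | h5 <;> rw [h5] at h2
      · have : 1 / (1 + N * ‖circleMap 0 1 θ - 1‖) ≤ 1 / (1 + b * θ) := by gcongr
        have : 0 ≤ 1 / (1 + b * (2 * Real.pi - θ)) := by positivity
        linarith
      · have : 1 / (1 + N * ‖circleMap 0 1 θ - 1‖) ≤ 1 / (1 + b * (2 * Real.pi - θ)) := by gcongr
        have : 0 ≤ 1 / (1 + b * θ) := by positivity
        linarith
  have hsub : ∫ θ in (0 : ℝ)..(2 * Real.pi), 1 / (1 + b * (2 * Real.pi - θ)) =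
      ∫ θ in (0 : ℝ)..(2 * Real.pi), 1 / (1 + b * θ) := by
    have := intervalIntegral.integral_comp_sub_left (a := 0) (b := 2 * Real.pi)
      (fun θ => 1 / (1 + b * θ)) (2 * Real.pi)
    simpa using this
  rw [intervalIntegral.integral_add hi1 hi2, hsub, integral_one_div_one_add_mul hb0] at hle
  rw [smul_eq_mul]
  calc (2 * Real.pi)⁻¹ * _ ≤ (2 * Real.pi)⁻¹ * _ := mul_le_mul_of_nonneg_left hle (by positivity)
    _ = Real.log (1 + 4 * N) / (2 * N) := by
      rw [show 1 + b * (2 * Real.pi) = 1 + 4 * N by rw [hb]; field_simp; ring, hb]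
      field_simp
      ring

theorem lintegral_one_div_one_add_norm_le {N c : ℝ} (hN : 0 < N) (hc : 0 ≤ c) {η : ℂ}
    (hη : ‖η‖ = 1) :
    ∫⁻ ζ, ENNReal.ofReal (c * (1 / (1 + N * ‖ζ - η‖))) ∂circleMeasure ≤
      ENNReal.ofReal (c * (Real.log (1 + 4 * N) / (2 * N))) := by
  have hη' : η ≠ 0 := by rw [← norm_pos_iff, hη]; norm_num
  rw [← lintegral_rotate (g := fun ζ => ENNReal.ofReal (c * (1 / (1 + N * ‖ζ - η‖))))
    (by fun_prop) hη]
  have h1 : ∀ ζ, ‖η * ζ - η‖ = ‖ζ - 1‖ := by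
    intro ζ
    rw [show η * ζ - η = η * (ζ - 1) by ring, norm_mul, hη, one_mul]
  simp only [h1]
  rw [← ofReal_integral_eq_lintegral_ofReal]
  · refine ENNReal.ofReal_le_ofReal ?_
    rw [integral_const_mul]
    exact mul_le_mul_of_nonneg_left (integral_one_div_one_add_norm_le hN) hc
  · refine Integrable.of_bound (Measurable.aestronglyMeasurable (by fun_prop)) c
      (Eventually.of_forall fun ζ => ?_)
    rw [Real.norm_of_nonneg (by positivity)]
    refine mul_le_of_le_one_right hc ?_
    rw [div_le_one (by positivity)]
    linarith [mul_nonneg hN.le (norm_nonneg (ζ - 1))]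
  · exact Eventually.of_forall fun ζ => by positivity

/-! ### The multiplier estimate -/

section Multiplier

variable {α : ℕ → ℝ} {a : ℕ → ℂ} {f : ℂ → ℂ} {M : ℝ}

/-- The Hadamard product `∑ a n * α n * z ^ n`, written as a superposition of Cesàro sums. -/
noncomputable def cesaroSuperposition (α : ℕ → ℝ) (a : ℕ → ℂ) (z : ℂ) : ℂ :=
  ∑' k : ℕ, (secondDiff α k : ℂ) * cesaroSum a (k + 1) z

theorem norm_superposition_term_le (hα : IsSlowConvex α)
    (hf : ∀ z, ‖z‖ < 1 → HasSum (fun n => a n * z ^ n) (f z))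
    (hM : ∀ z, ‖z‖ < 1 → ‖f z‖ ≤ M) {z : ℂ} (hz : ‖z‖ ≤ 1) (k : ℕ) :
    ‖(secondDiff α k : ℂ) * cesaroSum a (k + 1) z‖ ≤ M * ((k + 1) * secondDiff α k) := by
  rw [norm_mul, Complex.norm_real, Real.norm_of_nonneg (hα.secondDiff_nonneg k)]
  have := norm_cesaroSum_le hf hM (k + 1) hz
  push_cast at this
  calc _ ≤ secondDiff α k * (M * (k + 1)) :=
        mul_le_mul_of_nonneg_left this (hα.secondDiff_nonneg k)
    _ = _ := by ring

theorem summable_superposition (hα : IsSlowConvex α)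
    (hf : ∀ z, ‖z‖ < 1 → HasSum (fun n => a n * z ^ n) (f z))
    (hM : ∀ z, ‖z‖ < 1 → ‖f z‖ ≤ M) {z : ℂ} (hz : ‖z‖ ≤ 1) :
    Summable fun k : ℕ => (secondDiff α k : ℂ) * cesaroSum a (k + 1) z :=
  Summable.of_norm_bounded (hα.summable_mul_secondDiff.mul_left M)
    (norm_superposition_term_le hα hf hM hz)

theorem continuousOn_superposition (hα : IsSlowConvex α)
    (hf : ∀ z, ‖z‖ < 1 → HasSum (fun n => a n * z ^ n) (f z))
    (hM : ∀ z, ‖z‖ < 1 → ‖f z‖ ≤ M) :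
    ContinuousOn (cesaroSuperposition α a) (Metric.closedBall 0 1) :=
  continuousOn_tsum (fun k => by fun_prop) (hα.summable_mul_secondDiff.mul_left M)
    fun k _ hz => norm_superposition_term_le hα hf hM (by simpa using hz) k

theorem differentiableOn_superposition (hα : IsSlowConvex α)
    (hf : ∀ z, ‖z‖ < 1 → HasSum (fun n => a n * z ^ n) (f z))
    (hM : ∀ z, ‖z‖ < 1 → ‖f z‖ ≤ M) :
    DifferentiableOn ℂ (cesaroSuperposition α a) (Metric.ball 0 1) :=
  Complex.differentiableOn_tsum_of_summable_norm (hα.summable_mul_secondDiff.mul_left M)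
    (fun k => by fun_prop) Metric.isOpen_ball
    fun k _ hz => norm_superposition_term_le hα hf hM (by simpa using (Metric.mem_ball.mp hz).le) k

theorem norm_superposition_le (hα : IsSlowConvex α)
    (hf : ∀ z, ‖z‖ < 1 → HasSum (fun n => a n * z ^ n) (f z))
    (hM : ∀ z, ‖z‖ < 1 → ‖f z‖ ≤ M) {z : ℂ} (hz : ‖z‖ ≤ 1) :
    ‖cesaroSuperposition α a z‖ ≤ M * α 0 := by
  have h := (hα.hasSum_secondDiff 0).mul_left M
  simp only [Nat.sub_zero, Nat.cast_add, Nat.cast_one] at h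
  exact tsum_of_norm_bounded h (norm_superposition_term_le hα hf hM hz)

/-- The double series over `(n, k)` converges absolutely, with majorant `‖a n * z ^ n‖ * α 0` after
summation over `k`. Summing over `k` first gives `α n`; summing over `n` first gives Cesàro sums. -/
theorem superposition_eq (hα : IsSlowConvex α)
    (hf : ∀ z, ‖z‖ < 1 → HasSum (fun n => a n * z ^ n) (f z)) {z : ℂ} (hz : ‖z‖ < 1) :
    HasSum (fun n => a n * (α n : ℂ) * z ^ n) (cesaroSuperposition α a z) := by
  set F : ℕ × ℕ → ℂ := fun p => a p.1 * z ^ p.1 * (((p.2 + 1 - p.1 : ℕ) : ℝ) * secondDiff α p.2 : ℝ)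
    with hF
  have hrow : ∀ n, HasSum (fun k => F (n, k)) (a n * z ^ n * (α n : ℂ)) := fun n =>
    ((Complex.hasSum_ofReal).mpr (hα.hasSum_secondDiff n)).mul_left (a n * z ^ n)
  have hrown : ∀ n, HasSum (fun k => ‖F (n, k)‖) (‖a n * z ^ n‖ * α n) := by
    intro n
    refine ((hα.hasSum_secondDiff n).mul_left ‖a n * z ^ n‖).congr_fun ?_
    intro k
    simp only [hF]
    rw [norm_mul, Complex.norm_real, Real.norm_of_nonneg
      (mul_nonneg (Nat.cast_nonneg _) (hα.secondDiff_nonneg k))]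
  have hs : Summable F := by
    refine Summable.of_norm ?_
    rw [summable_prod_of_nonneg (fun p => norm_nonneg _)]
    refine ⟨fun n => (hrown n).summable, ?_⟩
    simp only [(hrown _).tsum_eq]
    refine Summable.of_nonneg_of_le (fun n => mul_nonneg (norm_nonneg _) (hα.nonneg n))
      (fun n => mul_le_mul_of_nonneg_left (hα.antitone (Nat.zero_le n)) (norm_nonneg _))
      ((hf z hz).summable.norm.mul_right (α 0))
  have h1 : HasSum (fun n => a n * z ^ n * (α n : ℂ)) (∑' p, F p) := hs.hasSum.prod_fiberwise hrow
  have hcol : ∀ k, HasSum (fun n => F (n, k)) ((secondDiff α k : ℂ) * cesaroSum a (k + 1) z) := by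
    intro k
    have : (secondDiff α k : ℂ) * cesaroSum a (k + 1) z =
        ∑ n ∈ Finset.range (k + 1), F (n, k) := by
      rw [cesaroSum, Finset.mul_sum]
      refine Finset.sum_congr rfl fun n _ => ?_
      simp only [hF]
      push_cast
      ring
    rw [this]
    refine hasSum_sum_of_ne_finset_zero fun n hn => ?_
    simp only [hF]
    rw [Nat.sub_eq_zero_of_le (by simpa using hn)]
    simp
  have h2 : HasSum (fun k => (secondDiff α k : ℂ) * cesaroSum a (k + 1) z) (∑' p, F p) := by
    have := ((Equiv.prodComm ℕ ℕ).hasSum_iff (f := F)).mpr hs.hasSum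
    exact this.prod_fiberwise hcol
  rw [cesaroSuperposition, h2.tsum_eq]
  simpa only [mul_right_comm] using h1

/-- The trivial bound governs Cesàro sums with `N ‖z - w‖` large, Bernstein's bound those with `N ‖z
- w‖` small; the factor `1 / (1 + N ‖z - w‖)` interpolates between them. -/
theorem enorm_superposition_sub_div_le (hα : IsSlowConvex α)
    (hf : ∀ z, ‖z‖ < 1 → HasSum (fun n => a n * z ^ n) (f z))
    (hM : ∀ z, ‖z‖ < 1 → ‖f z‖ ≤ M) {z w : ℂ} (hz : ‖z‖ ≤ 1) (hw : ‖w‖ ≤ 1) :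
    ‖cesaroSuperposition α a z - cesaroSuperposition α a w‖ₑ / ‖z - w‖ₑ ≤
      ∑' k : ℕ, ENNReal.ofReal (3 * M * (k + 1) ^ 2 * secondDiff α k *
        (1 / (1 + (k + 1) * ‖z - w‖))) := by
  -- On the diagonal the quotient is `0 / 0 = 0` in `ℝ≥0∞`.
  rcases eq_or_ne z w with rfl | hne
  · simp
  have hM0 : 0 ≤ M := (norm_nonneg _).trans (hM 0 (by simp))
  have ht : 0 < ‖z - w‖ := norm_pos_iff.mpr (sub_ne_zero.mpr hne)
  set t := ‖z - w‖ with htdef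
  have hnn : ∀ k : ℕ, 0 ≤ 3 * M * (k + 1) ^ 2 * secondDiff α k * (1 / (1 + (k + 1) * t)) :=
    fun k => by have := hα.secondDiff_nonneg k; positivity
  have hterm : ∀ k : ℕ, ‖(secondDiff α k : ℂ) * cesaroSum a (k + 1) z -
      (secondDiff α k : ℂ) * cesaroSum a (k + 1) w‖ ≤
      t * (3 * M * (k + 1) ^ 2 * secondDiff α k * (1 / (1 + (k + 1) * t))) := by
    intro k
    have hw0 := hα.secondDiff_nonneg k
    rw [← mul_sub, norm_mul, Complex.norm_real, Real.norm_of_nonneg hw0]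
    have h1 := norm_cesaroSum_sub_le hf hM (k + 1) hz hw
    have h2 := norm_sub_le (cesaroSum a (k + 1) z) (cesaroSum a (k + 1) w)
    have h3 := norm_cesaroSum_le hf hM (k + 1) hz
    have h4 := norm_cesaroSum_le hf hM (k + 1) hw
    push_cast at h1 h3 h4
    rw [← htdef] at h1
    set N : ℝ := (k : ℝ) + 1 with hN
    have hN0 : 0 < N := by positivity
    -- The constant `3` is `1` from the Bernstein bound `M N² t` plus `2` from the trivial bound `2
    -- M N` multiplied by `N t`.
    have h5 : ‖cesaroSum a (k + 1) z - cesaroSum a (k + 1) w‖ ≤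
        3 * M * N ^ 2 * t * (1 / (1 + N * t)) := by
      rw [mul_one_div, le_div_iff₀ (by positivity), mul_add, mul_one]
      have h6 : ‖cesaroSum a (k + 1) z - cesaroSum a (k + 1) w‖ * (N * t) ≤
          2 * M * N * (N * t) := by
        gcongr; linarith
      nlinarith
    calc _ ≤ secondDiff α k * (3 * M * N ^ 2 * t * (1 / (1 + N * t))) := by gcongr
      _ = _ := by ring
  have hsum : Summable fun k : ℕ =>
      3 * M * (k + 1) ^ 2 * secondDiff α k * (1 / (1 + (k + 1) * t)) := by
    refine Summable.of_nonneg_of_le hnn (fun k => ?_)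
      (hα.summable_mul_secondDiff.mul_left (3 * M / t))
    have hw0 := hα.secondDiff_nonneg k
    set N : ℝ := (k : ℝ) + 1 with hN
    have hN0 : 0 < N := by positivity
    have : 1 / (1 + N * t) ≤ 1 / (N * t) := by gcongr; linarith
    calc _ ≤ 3 * M * N ^ 2 * secondDiff α k * (1 / (N * t)) := by gcongr
      _ = _ := by field_simp
  have hmain : ‖cesaroSuperposition α a z - cesaroSuperposition α a w‖ ≤
      t * ∑' k : ℕ, 3 * M * (k + 1) ^ 2 * secondDiff α k * (1 / (1 + (k + 1) * t)) := by
    rw [cesaroSuperposition, cesaroSuperposition, ← (summable_superposition hα hf hM hz).tsum_sub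
      (summable_superposition hα hf hM hw)]
    exact tsum_of_norm_bounded (hsum.hasSum.mul_left t) hterm
  rw [← ENNReal.ofReal_tsum_of_nonneg hnn hsum, ← ofReal_norm, ← ofReal_norm,
    ← ENNReal.ofReal_div_of_pos ht]
  refine ENNReal.ofReal_le_ofReal ?_
  rw [div_le_iff₀' ht]
  exact hmain

/-- Integrating `N² / (1 + N t)` with `N = k + 1` costs `N log (1 + 4 N)`, so the bound is exactly
the series of `summable_log_mul_secondDiff`, independently of `η`. -/
theorem exists_lintegral_superposition_le (hα : IsSlowConvex α)
    (hf : ∀ z, ‖z‖ < 1 → HasSum (fun n => a n * z ^ n) (f z))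
    (hM : ∀ z, ‖z‖ < 1 → ‖f z‖ ≤ M) :
    ∃ K : ℝ≥0, ∀ η : ℂ, ‖η‖ = 1 →
      ∫⁻ ζ, ‖cesaroSuperposition α a ζ - cesaroSuperposition α a η‖ₑ / ‖ζ - η‖ₑ ∂circleMeasure ≤
        K := by
  have hM0 : 0 ≤ M := (norm_nonneg _).trans (hM 0 (by simp))
  refine ⟨(∑' k : ℕ, 9 * M * ((k + 1) * Real.log (k + 2) * secondDiff α k)).toNNReal,
    fun η hη => ?_⟩
  have hnn : ∀ k : ℕ, 0 ≤ 9 * M * ((k + 1) * Real.log (k + 2) * secondDiff α k) := fun k => by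
    have := hα.secondDiff_nonneg k
    have := Real.log_nonneg (x := (k : ℝ) + 2) (by linarith [k.cast_nonneg (α := ℝ)])
    positivity
  calc _ ≤ ∫⁻ ζ, ∑' k : ℕ, ENNReal.ofReal (3 * M * (k + 1) ^ 2 * secondDiff α k *
        (1 / (1 + (k + 1) * ‖ζ - η‖))) ∂circleMeasure :=
        lintegral_mono_ae (ae_circleMeasure_of_forall fun ζ hζ =>
          enorm_superposition_sub_div_le hα hf hM hζ.le hη.le)
    _ = ∑' k : ℕ, ∫⁻ ζ, ENNReal.ofReal (3 * M * (k + 1) ^ 2 * secondDiff α k *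
        (1 / (1 + (k + 1) * ‖ζ - η‖))) ∂circleMeasure :=
        lintegral_tsum fun k => Measurable.aemeasurable (by fun_prop)
    _ ≤ ∑' k : ℕ, ENNReal.ofReal (9 * M * ((k + 1) * Real.log (k + 2) * secondDiff α k)) := by
        refine ENNReal.tsum_le_tsum fun k => ?_
        have hw0 := hα.secondDiff_nonneg k
        refine (lintegral_one_div_one_add_norm_le (by positivity) (by positivity) hη).trans
          (ENNReal.ofReal_le_ofReal ?_)
        -- Equivalent to `4 k + 5 ≤ (k + 2) ^ 3`.
        have hlog : Real.log (1 + 4 * ((k : ℝ) + 1)) ≤ 3 * Real.log (k + 2) := by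
          have h2 : (0 : ℝ) < k + 2 := by positivity
          rw [← Real.log_rpow h2]
          refine Real.log_le_log (by positivity) ?_
          norm_num
          have := k.cast_nonneg (α := ℝ)
          nlinarith [sq_nonneg (k : ℝ), mul_nonneg this (sq_nonneg (k : ℝ))]
        have h3 : 0 ≤ Real.log ((k : ℝ) + 2) :=
          Real.log_nonneg (by linarith [k.cast_nonneg (α := ℝ)])
        calc 3 * M * (k + 1) ^ 2 * secondDiff α k *
              (Real.log (1 + 4 * ((k : ℝ) + 1)) / (2 * (k + 1)))
            ≤ 3 * M * (k + 1) ^ 2 * secondDiff α k * (3 * Real.log (k + 2) / (2 * (k + 1))) := by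
              gcongr
          _ = (9 * M * ((k + 1) * Real.log (k + 2) * secondDiff α k)) / 2 := by
              field_simp; ring
          _ ≤ _ := half_le_self (hnn k)
    _ = _ := by
        rw [← ENNReal.ofReal_tsum_of_nonneg hnn
          (hα.summable_log_mul_secondDiff.mul_left (9 * M))]
        rfl

end Multiplier

/-! ### Boundary values and almost everywhere statements on the circle -/

theorem boundaryValue_eq_of_continuousOn {g G : ℂ → ℂ}
    (hG : ContinuousOn G (Metric.closedBall 0 1)) (hg : ∀ z, ‖z‖ < 1 → g z = G z) {ζ : ℂ}
    (hζ : ‖ζ‖ = 1) : boundaryValue g ζ = G ζ := by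
  refine Tendsto.limUnder_eq ?_
  have h1 : Tendsto (fun r : ℝ => (r : ℂ) * ζ) (𝓝[<] 1) (𝓝[Metric.closedBall 0 1] ζ) := by
    refine tendsto_nhdsWithin_iff.mpr ⟨?_, ?_⟩
    · have : Tendsto (fun r : ℝ => (r : ℂ) * ζ) (𝓝 1) (𝓝 (((1 : ℝ) : ℂ) * ζ)) :=
        Continuous.tendsto (by fun_prop) 1
      rw [Complex.ofReal_one, one_mul] at this
      exact this.mono_left nhdsWithin_le_nhds
    · filter_upwards [Ioo_mem_nhdsLT (show (0 : ℝ) < 1 by norm_num)] with r hr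
      simp [hζ, abs_of_pos hr.1, hr.2.le]
  refine ((hG ζ (by simp [hζ])).tendsto.comp h1).congr' ?_
  filter_upwards [Ioo_mem_nhdsLT (show (0 : ℝ) < 1 by norm_num)] with r hr
  exact (hg _ (by simp [hζ, abs_of_pos hr.1, hr.2])).symm

theorem map_circleMap_eq :
    (volume.restrict (Ioc 0 (2 * Real.pi))).map (circleMap 0 1) =
      ENNReal.ofReal (2 * Real.pi) • circleMeasure := by
  rw [circleMeasure, smul_smul, ← ENNReal.ofReal_mul (by positivity),
    mul_inv_cancel₀ (by positivity), ENNReal.ofReal_one, one_smul]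

/-- No measurability of `p` is assumed: a measurable null set containing the bad angles has a
measurable image, because `circleMap` is continuous and injective on a period. -/
theorem ae_of_ae_circleMap {p : ℂ → Prop}
    (h : ∀ᵐ θ ∂volume.restrict (Ioc 0 (2 * Real.pi)), p (circleMap 0 1 θ)) :
    ∀ᵐ ζ ∂circleMeasure, p ζ := by
  obtain ⟨N, hN, hNm, hN0⟩ := exists_measurable_superset_of_null (ae_iff.mp h)
  have hinj : InjOn (circleMap 0 1) (Ioc 0 (2 * Real.pi)) := by
    have := injOn_circleMap_of_abs_sub_le (c := 0) (a := 0) (b := 2 * Real.pi) one_ne_zero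
      (by simp [abs_of_pos Real.pi_pos])
    rwa [uIoc_of_le (by positivity)] at this
  have himg : MeasurableSet (circleMap 0 1 '' (N ∩ Ioc 0 (2 * Real.pi))) :=
    (hNm.inter measurableSet_Ioc).image_of_continuousOn_injOn
      (continuous_circleMap 0 1).continuousOn (hinj.mono inter_subset_right)
  have hgood : ∀ᵐ ζ ∂circleMeasure, ζ ∉ circleMap 0 1 '' (N ∩ Ioc 0 (2 * Real.pi)) := by
    rw [ae_circleMeasure_iff himg.compl]
    have h1 : ∀ᵐ θ ∂volume.restrict (Ioc 0 (2 * Real.pi)), θ ∉ N := by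
      rw [ae_iff]; simpa using hN0
    filter_upwards [h1, ae_restrict_mem measurableSet_Ioc] with θ h2 h3
    rintro ⟨τ, hτ, heq⟩
    rw [hinj hτ.2 h3 heq] at hτ
    exact h2 hτ.1
  have hsurj : ∀ ζ : ℂ, ‖ζ‖ = 1 → ∃ θ ∈ Ioc 0 (2 * Real.pi), circleMap 0 1 θ = ζ := by
    intro ζ hζ
    have : ζ ∈ circleMap 0 1 '' Ioc 0 (2 * Real.pi) := by
      rw [image_circleMap_Ioc]; simp [hζ]
    obtain ⟨θ, hθ, h⟩ := this
    exact ⟨θ, hθ, h⟩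
  filter_upwards [hgood, ae_norm_eq_one] with ζ h1 h2
  obtain ⟨θ, hθ, rfl⟩ := hsurj ζ h2
  by_contra hp
  exact h1 ⟨θ, ⟨hN hp, hθ⟩, rfl⟩

/-! ### Parseval's identity and mean square boundary functions -/

theorem continuousOn_powerSeries {c : ℕ → ℂ} (hc : Summable fun n => ‖c n‖) :
    ContinuousOn (fun z => ∑' n, c n * z ^ n) (Metric.closedBall 0 1) := by
  refine continuousOn_tsum (fun n => by fun_prop) hc fun n z hz => ?_
  rw [norm_mul, norm_pow]
  exact mul_le_of_le_one_right (norm_nonneg _) (pow_le_one₀ (norm_nonneg _) (by simpa using hz))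

theorem norm_powerSeries_le {c : ℕ → ℂ} (hc : Summable fun n => ‖c n‖) {z : ℂ} (hz : ‖z‖ ≤ 1) :
    ‖∑' n, c n * z ^ n‖ ≤ ∑' n, ‖c n‖ :=
  tsum_of_norm_bounded hc.hasSum fun n => by
    rw [norm_mul, norm_pow]
    exact mul_le_of_le_one_right (norm_nonneg _) (pow_le_one₀ (norm_nonneg _) hz)

theorem integrable_powerSeries {c : ℕ → ℂ} (hc : Summable fun n => ‖c n‖) :
    Integrable (fun ζ => ∑' n, c n * ζ ^ n) circleMeasure :=
  integrable_of_bounded (aestronglyMeasurable_of_continuousOn (continuousOn_powerSeries hc))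
    fun _ hζ => norm_powerSeries_le hc hζ.le

theorem integral_powerSeries_mul_conj_pow {c : ℕ → ℂ} (hc : Summable fun n => ‖c n‖) (b : ℕ) :
    ∫ ζ, (∑' n, c n * ζ ^ n) * conj ζ ^ b ∂circleMeasure = c b := by
  have h := hasSum_integral_powerSeries_mul hc (φ := fun ζ => conj ζ ^ b)
    (integrable_of_bounded (C := 1) (by fun_prop) fun ζ hζ => by simp [hζ])
  simp only [integral_pow_mul_conj_pow] at h
  rw [← h.tsum_eq, tsum_eq_single b fun n hn => by simp [hn]]
  simp

theorem parseval {c : ℕ → ℂ} (hc : Summable fun n => ‖c n‖) :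
    HasSum (fun n => ‖c n‖ ^ 2) (∫ ζ, ‖∑' n, c n * ζ ^ n‖ ^ 2 ∂circleMeasure) := by
  have hφ : Integrable (fun ζ => conj (∑' n, c n * ζ ^ n)) circleMeasure :=
    Complex.conjCLE.integrable_comp_iff.mpr (integrable_powerSeries hc)
  have h := hasSum_integral_powerSeries_mul hc hφ
  have h1 : ∀ n, ∫ ζ, ζ ^ n * conj (∑' n, c n * ζ ^ n) ∂circleMeasure = conj (c n) := by
    intro n
    rw [← integral_powerSeries_mul_conj_pow hc n, ← integral_conj]
    congr 1; ext ζ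
    simp [mul_comm]
  simp only [h1, mul_conj_eq_norm_sq] at h
  rw [integral_complex_ofReal] at h
  exact Complex.hasSum_ofReal.mp h

theorem memLp_powerSeries {c : ℕ → ℂ} (hc : Summable fun n => ‖c n‖) (p : ℝ≥0∞) :
    MemLp (fun ζ => ∑' n, c n * ζ ^ n) p circleMeasure :=
  MemLp.of_bound (aestronglyMeasurable_of_continuousOn (continuousOn_powerSeries hc)) _
    (ae_circleMeasure_of_forall fun _ hζ => norm_powerSeries_le hc hζ.le)

theorem eLpNorm_two_eq {g : ℂ → ℂ} (hg : MemLp g 2 circleMeasure) :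
    eLpNorm g 2 circleMeasure = ENNReal.ofReal (√(∫ ζ, ‖g ζ‖ ^ 2 ∂circleMeasure)) := by
  rw [hg.eLpNorm_eq_integral_rpow_norm two_ne_zero ENNReal.ofNat_ne_top, Real.sqrt_eq_rpow]
  simp

/-- A sequence of radii increasing to `1`. -/
noncomputable def radius (j : ℕ) : ℝ := 1 - 1 / ((j : ℝ) + 2)

theorem radius_pos (j : ℕ) : 0 < radius j := by
  have : 1 / ((j : ℝ) + 2) < 1 := by
    rw [div_lt_one (by positivity)]; linarith [j.cast_nonneg (α := ℝ)]
  unfold radius; linarith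

theorem radius_lt_one (j : ℕ) : radius j < 1 := by
  have : 0 < 1 / ((j : ℝ) + 2) := by positivity
  unfold radius; linarith

theorem radius_mono : Monotone radius := by
  intro i j hij
  unfold radius
  gcongr

theorem tendsto_radius : Tendsto radius atTop (𝓝 1) := by
  have h : Tendsto (fun j : ℕ => 1 / ((j : ℝ) + 2)) atTop (𝓝 0) := by
    have := (tendsto_one_div_add_atTop_nhds_zero_nat (𝕜 := ℝ)).comp (tendsto_add_atTop_nat 1)
    refine this.congr fun j => ?_
    simp only [Function.comp, Nat.cast_add, Nat.cast_one]
    ring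
  have := h.const_sub 1
  rwa [sub_zero] at this

theorem bounded_of_summable_sq {a : ℕ → ℂ} (ha : Summable fun n => ‖a n‖ ^ 2) :
    ∃ C : ℝ, ∀ n, ‖a n‖ ≤ C := by
  refine ⟨√(∑' n, ‖a n‖ ^ 2), fun n => Real.le_sqrt_of_sq_le ?_⟩
  exact ha.le_tsum n fun _ _ => by positivity

theorem summable_of_bounded {a : ℕ → ℂ} {C : ℝ} (ha : ∀ n, ‖a n‖ ≤ C) {z : ℂ} (hz : ‖z‖ < 1) :
    Summable fun n => ‖a n * z ^ n‖ := by
  refine Summable.of_nonneg_of_le (fun n => norm_nonneg _) (fun n => ?_)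
    ((summable_geometric_of_lt_one (norm_nonneg z) hz).mul_left C)
  rw [norm_mul, norm_pow]
  gcongr
  exact ha n

theorem exists_l2_limit {a : ℕ → ℂ} (ha : Summable fun n => ‖a n‖ ^ 2) :
    ∃ g : ℂ → ℂ, MemLp g 2 circleMeasure ∧
      Tendsto (fun j => eLpNorm (fun ζ => (∑' n, a n * (radius j * ζ) ^ n) - g ζ) 2 circleMeasure)
        atTop (𝓝 0) := by
  obtain ⟨C, hC⟩ := bounded_of_summable_sq ha
  have hs : ∀ j, Summable fun n => ‖a n * (radius j : ℂ) ^ n‖ := fun j =>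
    summable_of_bounded hC (by
      rw [Complex.norm_real, Real.norm_of_nonneg (radius_pos j).le]; exact radius_lt_one j)
  have hrw : ∀ j ζ, (∑' n, a n * ((radius j : ℂ) * ζ) ^ n) =
      ∑' n, (a n * (radius j : ℂ) ^ n) * ζ ^ n := by
    intro j ζ
    simp only [mul_pow, mul_assoc]
  simp only [hrw]
  have hmem := fun j => memLp_powerSeries (hs j) 2
  -- `b N` bounds the squared distance of any two dilations of index at least `N`, since `radius i ^
  -- n` and `radius j ^ n` then both lie in `[radius N ^ n, 1]`.
  set b : ℕ → ℝ := fun j => ∑' n, ‖a n‖ ^ 2 * (1 - radius j ^ n) ^ 2 with hb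
  have hfac : ∀ j n, (1 - radius j ^ n) ^ 2 ≤ 1 := by
    intro j n
    have h1 := pow_nonneg (radius_pos j).le n
    have h2 := pow_le_one₀ (n := n) (radius_pos j).le (radius_lt_one j).le
    nlinarith
  have hbs : ∀ j, Summable fun n => ‖a n‖ ^ 2 * (1 - radius j ^ n) ^ 2 := fun j =>
    Summable.of_nonneg_of_le (fun n => by positivity)
      (fun n => mul_le_of_le_one_right (by positivity) (hfac j n)) ha
  have hb0 : Tendsto b atTop (𝓝 0) := by
    have := tendsto_tsum_of_dominated_convergence (𝓕 := atTop)
      (f := fun j n => ‖a n‖ ^ 2 * (1 - radius j ^ n) ^ 2) (g := fun _ => (0 : ℝ)) ha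
      (fun n => ?_) (Eventually.of_forall fun j n => ?_)
    · simpa using this
    · have := ((tendsto_radius.pow n).const_sub 1).pow 2
      simpa using this.const_mul (‖a n‖ ^ 2)
    · rw [Real.norm_of_nonneg (by positivity)]
      exact mul_le_of_le_one_right (by positivity) (hfac j n)
  have hdist : ∀ N i j, N ≤ i → N ≤ j →
      ∫ ζ, ‖(∑' n, (a n * (radius i : ℂ) ^ n) * ζ ^ n) -
        ∑' n, (a n * (radius j : ℂ) ^ n) * ζ ^ n‖ ^ 2 ∂circleMeasure ≤ b N := by
    intro N i j hi hj
    have hsub : Summable fun n => ‖a n * (radius i : ℂ) ^ n - a n * (radius j : ℂ) ^ n‖ :=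
      Summable.of_nonneg_of_le (fun n => norm_nonneg _) (fun n => norm_sub_le _ _)
        ((hs i).add (hs j))
    have h1 : ∀ᵐ ζ ∂circleMeasure, ‖(∑' n, (a n * (radius i : ℂ) ^ n) * ζ ^ n) -
        ∑' n, (a n * (radius j : ℂ) ^ n) * ζ ^ n‖ ^ 2 =
        ‖∑' n, (a n * (radius i : ℂ) ^ n - a n * (radius j : ℂ) ^ n) * ζ ^ n‖ ^ 2 := by
      refine ae_circleMeasure_of_forall fun ζ hζ => ?_
      have hsz : ∀ j, Summable fun n => (a n * (radius j : ℂ) ^ n) * ζ ^ n := fun j =>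
        Summable.of_norm (by simpa [hζ] using hs j)
      rw [← (hsz i).tsum_sub (hsz j)]
      simp only [sub_mul]
    rw [integral_congr_ae h1, ← (parseval hsub).tsum_eq]
    refine (parseval hsub).summable.tsum_le_tsum (fun n => ?_) (hbs N)
    rw [← mul_sub, norm_mul, mul_pow]
    gcongr
    have e : (radius i : ℂ) ^ n - (radius j : ℂ) ^ n = ((radius i ^ n - radius j ^ n : ℝ) : ℂ) := by
      push_cast; ring
    rw [e, Complex.norm_real, Real.norm_eq_abs, abs_le]
    have h2 := pow_le_pow_left₀ (radius_pos N).le (radius_mono hi) n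
    have h3 := pow_le_pow_left₀ (radius_pos N).le (radius_mono hj) n
    have h4 := pow_le_one₀ (n := n) (radius_pos i).le (radius_lt_one i).le
    have h5 := pow_le_one₀ (n := n) (radius_pos j).le (radius_lt_one j).le
    constructor <;> linarith
  have hcauchy : CauchySeq fun j => (hmem j).toLp := by
    refine cauchySeq_of_le_tendsto_0 (fun j => √(b j)) (fun i j N hi hj => ?_) ?_
    · rw [dist_eq_norm, ← MemLp.toLp_sub, Lp.norm_toLp,
        eLpNorm_two_eq ((hmem i).sub (hmem j)), ENNReal.toReal_ofReal (Real.sqrt_nonneg _)]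
      exact Real.sqrt_le_sqrt (hdist N i j hi hj)
    · simpa using hb0.sqrt
  obtain ⟨g, hg⟩ := cauchySeq_tendsto_of_complete hcauchy
  refine ⟨g, Lp.memLp g, ?_⟩
  have := (Lp.tendsto_Lp_iff_tendsto_eLpNorm' _ g).mp hg
  refine this.congr fun j => eLpNorm_congr_ae ?_
  filter_upwards [(hmem j).coeFn_toLp] with ζ hζ
  simp [hζ]

/-! ### Radial limits of the derivative by a cancelling kernel -/

theorem hasSum_succ_mul_pow {w : ℂ} (hw : ‖w‖ < 1) :
    HasSum (fun m : ℕ => ((m : ℂ) + 1) * w ^ m) (1 / (1 - w) ^ 2) := by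
  have := hasSum_choose_mul_geometric_of_norm_lt_one 1 hw
  simpa using this

theorem norm_one_sub_mul_pos {w ζ : ℂ} (hw : ‖w‖ < 1) (hζ : ‖ζ‖ ≤ 1) : 0 < ‖1 - w * ζ‖ := by
  have h1 : ‖w * ζ‖ < 1 := by
    rw [norm_mul]
    exact (mul_le_of_le_one_right (norm_nonneg _) hζ).trans_lt hw
  rw [norm_pos_iff, sub_ne_zero]
  rintro h
  rw [← h] at h1
  simp at h1

theorem integral_div_sq_mul {w : ℂ} (hw : ‖w‖ < 1) {φ : ℂ → ℂ} (hφ : Integrable φ circleMeasure) :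
    HasSum (fun m : ℕ => (((m : ℂ) + 1) * w ^ m) * ∫ ζ, ζ ^ m * φ ζ ∂circleMeasure)
      (∫ ζ, 1 / (1 - w * ζ) ^ 2 * φ ζ ∂circleMeasure) := by
  have h := hasSum_integral_powerSeries_mul (hasSum_succ_mul_pow hw).summable.norm hφ
  convert h using 1
  refine integral_congr_ae (ae_circleMeasure_of_forall fun ζ hζ => ?_)
  have := (hasSum_succ_mul_pow (w := w * ζ) (by simpa [hζ] using hw)).tsum_eq
  simp only [← this, mul_pow, mul_assoc]

/-- Only strictly positive frequencies occur, so any multiple of this kernel may be subtracted in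
`deriv_eq_integral_kernel` at no cost. -/
theorem integral_pow_mul_kernel {w : ℂ} (hw : ‖w‖ < 1) (n : ℕ) :
    ∫ ζ, ζ ^ n * (ζ / (1 - w * ζ) ^ 2) ∂circleMeasure = 0 := by
  have h := integral_div_sq_mul hw (φ := fun ζ => ζ ^ (n + 1) * conj ζ ^ 0)
    (integrable_of_bounded (C := 1) (by fun_prop) fun ζ hζ => by simp [hζ])
  simp only [← mul_assoc, ← pow_add, integral_pow_mul_conj_pow] at h
  have h0 : ∀ m, m + (n + 1) ≠ 0 := fun m => by omega
  simp only [h0, if_false, mul_zero] at h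
  rw [← h.unique hasSum_zero]
  congr 1; ext ζ
  simp only [pow_zero, mul_one]
  ring

theorem integral_pow_mul_conj_kernel {z : ℂ} (hz : ‖z‖ < 1) (n : ℕ) :
    ∫ ζ, ζ ^ n * conj (ζ / (1 - conj z * ζ) ^ 2) ∂circleMeasure = n * z ^ (n - 1) := by
  have hw : ‖conj z‖ < 1 := by simpa using hz
  have h := integral_div_sq_mul hw (φ := fun ζ => ζ ^ 1 * conj ζ ^ n)
    (integrable_of_bounded (C := 1) (by fun_prop) fun ζ hζ => by simp [hζ])
  simp only [← mul_assoc, ← pow_add, integral_pow_mul_conj_pow] at h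
  have h2 : ∫ ζ, 1 / (1 - conj z * ζ) ^ 2 * ζ ^ 1 * conj ζ ^ n ∂circleMeasure =
      n * conj z ^ (n - 1) := by
    rw [← h.tsum_eq, tsum_eq_single (n - 1)]
    · rcases n with _ | n
      · simp
      · simp
    · intro m hm
      rw [if_neg (by omega), mul_zero]
  have h3 : ∫ ζ, ζ ^ n * conj (ζ / (1 - conj z * ζ) ^ 2) ∂circleMeasure =
      conj (∫ ζ, 1 / (1 - conj z * ζ) ^ 2 * ζ ^ 1 * conj ζ ^ n ∂circleMeasure) := by
    rw [← integral_conj]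
    congr 1; ext ζ
    simp only [map_mul, map_div₀, map_pow, map_sub, map_one, Complex.conj_conj]
    ring
  rw [h3, h2]
  simp

theorem measurable_kernel (w : ℂ) : Measurable fun ζ : ℂ => ζ / (1 - w * ζ) ^ 2 := by fun_prop

theorem norm_kernel_le {w : ℂ} (hw : ‖w‖ < 1) {ζ : ℂ} (hζ : ‖ζ‖ = 1) :
    ‖ζ / (1 - w * ζ) ^ 2‖ ≤ 1 / (1 - ‖w‖) ^ 2 := by
  rw [norm_div, hζ, norm_pow]
  have h1 : 1 - ‖w‖ ≤ ‖1 - w * ζ‖ := by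
    have := norm_sub_norm_le (1 : ℂ) (w * ζ)
    simpa [hζ] using this
  have h2 : 0 < 1 - ‖w‖ := by linarith
  gcongr

/-- The derivative of a function in the disk algebra, reproduced by a kernel with second order
cancellation at the boundary. -/
theorem deriv_eq_integral_kernel {p : ℕ → ℂ} (hp : Summable fun n => ‖p n‖) {z : ℂ} (hz : ‖z‖ < 1)
    (κ : ℂ) :
    HasSum (fun n => p n * (n * z ^ (n - 1)))
      (∫ ζ, (∑' n, p n * ζ ^ n) * (conj (ζ / (1 - conj z * ζ) ^ 2) -
        κ * (ζ / (1 - conj z * ζ) ^ 2)) ∂circleMeasure) := by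
  have hw : ‖conj z‖ < 1 := by simpa using hz
  have hi1 : Integrable (fun ζ => ζ / (1 - conj z * ζ) ^ 2) circleMeasure :=
    integrable_of_bounded (measurable_kernel _).aestronglyMeasurable fun ζ hζ => norm_kernel_le hw hζ
  have hi2 : Integrable (fun ζ => conj (ζ / (1 - conj z * ζ) ^ 2)) circleMeasure :=
    Complex.conjCLE.integrable_comp_iff.mpr hi1
  have h := hasSum_integral_powerSeries_mul hp (hi2.sub (hi1.const_mul κ))
  refine h.congr_fun fun n => ?_
  congr 1
  rw [← integral_pow_mul_conj_kernel hz n]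
  have hpow : ∀ φ : ℂ → ℂ, Integrable φ circleMeasure →
      Integrable (fun ζ => ζ ^ n * φ ζ) circleMeasure := fun φ hφ =>
    hφ.bdd_mul (c := 1) (by fun_prop) (ae_circleMeasure_of_forall fun ζ hζ => by simp [hζ])
  have h1 : ∀ ζ : ℂ, ζ ^ n * (conj (ζ / (1 - conj z * ζ) ^ 2) -
        κ * (ζ / (1 - conj z * ζ) ^ 2)) = ζ ^ n * conj (ζ / (1 - conj z * ζ) ^ 2) -
        κ * (ζ ^ n * (ζ / (1 - conj z * ζ) ^ 2)) := fun ζ => by ring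
  simp only [Pi.sub_apply, h1]
  rw [integral_sub (hpow _ hi2) ((hpow _ hi1).const_mul κ), integral_const_mul,
    integral_pow_mul_kernel hw, mul_zero, sub_zero]

theorem norm_sub_one_le_two_mul {r : ℝ} (hr : r ∈ Ioo (0 : ℝ) 1) {u : ℂ} (hu : ‖u‖ = 1) :
    ‖u - 1‖ ≤ 2 * ‖1 - r * u‖ := by
  have h1 : ‖u - 1‖ ≤ ‖u - r * u‖ + ‖(r : ℂ) * u - 1‖ := by
    have := norm_add_le (u - r * u) ((r : ℂ) * u - 1)
    rwa [sub_add_sub_cancel] at this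
  have h2 : ‖u - r * u‖ = 1 - r := by
    rw [show u - r * u = ((1 - r : ℝ) : ℂ) * u by push_cast; ring, norm_mul, hu, Complex.norm_real,
      Real.norm_of_nonneg (by linarith [hr.2]), mul_one]
  have h3 : 1 - r ≤ ‖1 - r * u‖ := by
    have := norm_sub_norm_le (1 : ℂ) (r * u)
    simpa [hu, abs_of_pos hr.1] using this
  rw [norm_sub_rev ((r : ℂ) * u) 1] at h1
  linarith

/-- With `u = conj η * ζ`, the choice `κ = conj η ^ 2` makes the difference, up to a unimodular
factor, `conj k - k` for `k = u / (1 - r u) ^ 2`. This equals `(1 - r ^ 2) (conj u - u) / |1 - r u|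
^ 4`: the kernel gains the factors `1 - r ^ 2` and `Im u`. -/
theorem norm_cancelling_kernel {r : ℝ} (hr : r ∈ Ioo (0 : ℝ) 1) {η ζ : ℂ} (hη : ‖η‖ = 1)
    (hζ : ‖ζ‖ = 1) :
    ‖conj (ζ / (1 - conj ((r : ℂ) * η) * ζ) ^ 2) -
      conj η ^ 2 * (ζ / (1 - conj ((r : ℂ) * η) * ζ) ^ 2)‖ =
      2 * (1 - r ^ 2) * |(conj η * ζ).im| / ‖1 - r * (conj η * ζ)‖ ^ 4 := by
  set u := conj η * ζ with hu
  have hu1 : ‖u‖ = 1 := by simp [hu, hη, hζ]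
  have hηη : conj η * η = 1 := by
    rw [mul_comm, mul_conj_eq_norm_sq, hη]; simp
  have huu : u * conj u = 1 := by rw [mul_conj_eq_norm_sq, hu1]; simp
  have hζu : ζ = η * u := by rw [hu, ← mul_assoc, mul_comm η, hηη, one_mul]
  have hden : conj ((r : ℂ) * η) * ζ = r * u := by simp [hu, mul_assoc]
  have hpos : 0 < ‖1 - (r : ℂ) * u‖ := by
    have := norm_one_sub_mul_pos (w := (r : ℂ)) (ζ := u) (by simp [abs_of_pos hr.1, hr.2]) hu1.le
    exact this
  have hne : (1 - (r : ℂ) * u) ≠ 0 := norm_pos_iff.mp hpos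
  have hne' : (1 - (r : ℂ) * conj u) ≠ 0 := by
    have := (map_ne_zero (starRingEnd ℂ)).mpr hne
    simpa only [map_sub, map_one, map_mul, Complex.conj_ofReal] using this
  rw [hden]
  have h1 : conj (ζ / (1 - r * u) ^ 2) - conj η ^ 2 * (ζ / (1 - r * u) ^ 2) =
      conj η * (conj u / (1 - r * conj u) ^ 2 - u / (1 - r * u) ^ 2) := by
    conv_lhs => rw [hζu]
    simp only [map_div₀, map_mul, map_pow, map_sub, map_one, Complex.conj_ofReal]
    linear_combination (-conj η * u / (1 - r * u) ^ 2) * hηη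
  have h2 : conj u / (1 - r * conj u) ^ 2 - u / (1 - r * u) ^ 2 =
      ((1 - r ^ 2 : ℝ) : ℂ) * (conj u - u) / ((1 - r * u) * (1 - r * conj u)) ^ 2 := by
    rw [div_sub_div _ _ (pow_ne_zero 2 hne') (pow_ne_zero 2 hne),
      div_eq_div_iff (by positivity) (by positivity)]
    push_cast
    linear_combination (r ^ 2 * (u - conj u)) * ((1 - r * u) * (1 - r * conj u)) ^ 2 * huu
  have h3 : conj u - u = -((2 * u.im : ℝ) : ℂ) * Complex.I := by
    apply Complex.ext <;> simp; ring
  have h4 : ‖(1 - (r : ℂ) * conj u)‖ = ‖1 - (r : ℂ) * u‖ := by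
    rw [← RCLike.norm_conj (1 - (r : ℂ) * u)]; simp
  have hr2 : 0 ≤ 1 - r ^ 2 := by nlinarith [hr.1, hr.2]
  rw [h1, h2, h3, norm_mul, RCLike.norm_conj, hη, one_mul, norm_div, norm_mul, norm_pow,
    norm_mul (1 - (r : ℂ) * u), h4, Complex.norm_real, Real.norm_of_nonneg hr2, norm_mul, norm_neg, Complex.norm_real,
    Complex.norm_I, Real.norm_eq_abs, abs_mul, abs_two]
  ring

theorem integral_poisson {r : ℝ} (hr : r ∈ Ioo (0 : ℝ) 1) {η : ℂ} (hη : ‖η‖ = 1) :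
    Integrable (fun ζ => (1 - r ^ 2) / ‖1 - r * (conj η * ζ)‖ ^ 2) circleMeasure ∧
    ∫ ζ, (1 - r ^ 2) / ‖1 - r * (conj η * ζ)‖ ^ 2 ∂circleMeasure = 1 := by
  have hr2 : 0 < 1 - r ^ 2 := by nlinarith [hr.1, hr.2]
  have hw : ‖(r : ℂ) * conj η‖ < 1 := by simp [hη, abs_of_pos hr.1, hr.2]
  have hc : Summable fun n => ‖((r : ℂ) * conj η) ^ n‖ := by
    simpa using summable_geometric_of_lt_one (norm_nonneg _) hw
  have h := parseval hc
  have h1 : ∀ᵐ ζ ∂circleMeasure, (1 - r ^ 2) * ‖∑' n, ((r : ℂ) * conj η) ^ n * ζ ^ n‖ ^ 2 =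
      (1 - r ^ 2) / ‖1 - r * (conj η * ζ)‖ ^ 2 := by
    refine ae_circleMeasure_of_forall fun ζ hζ => ?_
    simp only [← mul_pow]
    rw [tsum_geometric_of_norm_lt_one (by simpa [hζ] using hw), norm_inv, mul_assoc, inv_pow]
    rfl
  have h2 : ∀ n, ‖((r : ℂ) * conj η) ^ n‖ ^ 2 = (r ^ 2) ^ n := by
    intro n
    simp [hη, abs_of_pos hr.1, ← pow_mul, mul_comm]
  simp only [h2] at h
  have h3 := h.unique (hasSum_geometric_of_lt_one (by positivity) (by linarith))
  constructor
  · refine Integrable.congr ?_ h1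
    exact ((memLp_powerSeries hc 2).integrable_norm_pow (by norm_num)).const_mul _
  · rw [← integral_congr_ae h1, integral_const_mul, h3, mul_inv_cancel₀ hr2.ne']

/-- Near `η`, the smallness `o(‖ζ - η‖)` and the factor `|Im u| ≤ ‖u - 1‖` absorb two powers of `‖1
- r u‖`, leaving a small multiple of the Poisson kernel, of mass one. Away from `η` the kernel is
`O(1 - r ^ 2)`. -/
theorem tendsto_deriv_of_littleO {p : ℕ → ℂ} (hp : Summable fun n => ‖p n‖) {η : ℂ} (hη : ‖η‖ = 1)
    (ho : ∀ ε > 0, ∃ δ > 0, ∀ ζ : ℂ, ‖ζ‖ = 1 → ‖ζ - η‖ < δ → ‖∑' n, p n * ζ ^ n‖ ≤ ε * ‖ζ - η‖) :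
    Tendsto (fun r : ℝ => ∑' n : ℕ, p n * (n * ((r : ℂ) * η) ^ (n - 1))) (𝓝[<] 1) (𝓝 0) := by
  rw [Metric.tendsto_nhds]
  intro ε hε
  -- `16 = 2 * 2 * 4`: the kernel contributes `2`, the inequality `‖u - 1‖ ^ 2 ≤ (2 D) ^ 2`
  -- contributes `4`, and `ε / 2` is the target.
  obtain ⟨δ, hδ, hδE⟩ := ho (ε / 16) (by positivity)
  set C := ∑' n, ‖p n‖ with hC
  have hC0 : 0 ≤ C := tsum_nonneg fun n => norm_nonneg _
  have hlim : Tendsto (fun r : ℝ => C * (2 * (1 - r ^ 2) / (δ / 2) ^ 4)) (𝓝[<] 1) (𝓝 0) := by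
    have : Tendsto (fun r : ℝ => C * (2 * (1 - r ^ 2) / (δ / 2) ^ 4)) (𝓝 1)
        (𝓝 (C * (2 * (1 - 1 ^ 2) / (δ / 2) ^ 4))) :=
      Continuous.tendsto (by fun_prop) 1
    simp only [one_pow, sub_self, mul_zero, zero_div] at this
    exact this.mono_left nhdsWithin_le_nhds
  filter_upwards [Ioo_mem_nhdsLT (show (0 : ℝ) < 1 by norm_num),
    hlim.eventually_lt_const (show (0 : ℝ) < ε / 2 by positivity)] with r hr hr2
  have hr20 : 0 < 1 - r ^ 2 := by nlinarith [hr.1, hr.2]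
  have hz : ‖(r : ℂ) * η‖ < 1 := by simp [hη, abs_of_pos hr.1, hr.2]
  obtain ⟨hPi, hP⟩ := integral_poisson hr hη
  rw [dist_zero_right, (deriv_eq_integral_kernel hp hz (conj η ^ 2)).tsum_eq]
  have hbound : ∀ ζ : ℂ, ‖ζ‖ = 1 → ‖(∑' n, p n * ζ ^ n) *
      (conj (ζ / (1 - conj ((r : ℂ) * η) * ζ) ^ 2) -
        conj η ^ 2 * (ζ / (1 - conj ((r : ℂ) * η) * ζ) ^ 2))‖ ≤
      ε / 2 * ((1 - r ^ 2) / ‖1 - r * (conj η * ζ)‖ ^ 2) +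
        C * (2 * (1 - r ^ 2) / (δ / 2) ^ 4) := by
    intro ζ hζ
    rw [norm_mul, norm_cancelling_kernel hr hη hζ]
    set u := conj η * ζ with hu
    have hu1 : ‖u‖ = 1 := by simp [hu, hη, hζ]
    have hηη : conj η * η = 1 := by rw [mul_comm, mul_conj_eq_norm_sq, hη]; simp
    have hsub : ‖ζ - η‖ = ‖u - 1‖ := by
      rw [show u - 1 = conj η * (ζ - η) by rw [hu, mul_sub, hηη], norm_mul, RCLike.norm_conj, hη,
        one_mul]
    have him : |u.im| ≤ ‖u - 1‖ := by simpa using Complex.abs_im_le_norm (u - 1)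
    have him1 : |u.im| ≤ 1 := hu1 ▸ Complex.abs_im_le_norm u
    have h2 := norm_sub_one_le_two_mul hr hu1
    set D := ‖1 - (r : ℂ) * u‖ with hD
    have hD0 : 0 < D := norm_one_sub_mul_pos (by simp [abs_of_pos hr.1, hr.2]) hu1.le
    rcases lt_or_ge ‖ζ - η‖ δ with hlt | hge
    · have hE := hδE ζ hζ hlt
      rw [hsub] at hE
      have : ‖∑' n, p n * ζ ^ n‖ * (2 * (1 - r ^ 2) * |u.im| / D ^ 4) ≤
          ε / 2 * ((1 - r ^ 2) / D ^ 2) := by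
        calc _ ≤ (ε / 16 * ‖u - 1‖) * (2 * (1 - r ^ 2) * ‖u - 1‖ / D ^ 4) := by gcongr
          _ = ε / 8 * (1 - r ^ 2) * ‖u - 1‖ ^ 2 / D ^ 4 := by ring
          _ ≤ ε / 8 * (1 - r ^ 2) * (2 * D) ^ 2 / D ^ 4 := by gcongr
          _ = _ := by field_simp; ring
      have h3 : 0 ≤ C * (2 * (1 - r ^ 2) / (δ / 2) ^ 4) := by positivity
      linarith
    · have hDδ : δ / 2 ≤ D := by rw [hsub] at hge; linarith
      have : ‖∑' n, p n * ζ ^ n‖ * (2 * (1 - r ^ 2) * |u.im| / D ^ 4) ≤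
          C * (2 * (1 - r ^ 2) / (δ / 2) ^ 4) := by
        calc _ ≤ C * (2 * (1 - r ^ 2) * 1 / (δ / 2) ^ 4) := by
              gcongr
              exact norm_powerSeries_le hp hζ.le
          _ = _ := by ring
      have h3 : 0 ≤ ε / 2 * ((1 - r ^ 2) / D ^ 2) := by positivity
      linarith
  refine (norm_integral_le_of_norm_le ((hPi.const_mul (ε / 2)).add (integrable_const _))
    (ae_circleMeasure_of_forall hbound)).trans_lt ?_
  have : ∫ ζ, (ε / 2 * ((1 - r ^ 2) / ‖1 - r * (conj η * ζ)‖ ^ 2) +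
        C * (2 * (1 - r ^ 2) / (δ / 2) ^ 4)) ∂circleMeasure =
        ε / 2 + C * (2 * (1 - r ^ 2) / (δ / 2) ^ 4) := by
    rw [integral_add (hPi.const_mul (ε / 2)) (integrable_const _), integral_const_mul, hP]
    simp
  simp only [Pi.add_apply]
  rw [this]
  linarith

/-- Subtracting the tangent polynomial `d + c ζ` reduces to the case of vanishing first order part.
-/
theorem tendsto_deriv_of_isLittleO {p : ℕ → ℂ} (hp : Summable fun n => ‖p n‖) {η c : ℂ}
    (hη : ‖η‖ = 1)
    (ho : (fun ζ => (∑' n, p n * ζ ^ n) - (∑' n, p n * η ^ n) - c * (ζ - η))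
      =o[𝓝[Metric.sphere 0 1] η] fun ζ => ζ - η) :
    Tendsto (fun r : ℝ => ∑' n : ℕ, p n * (n * ((r : ℂ) * η) ^ (n - 1))) (𝓝[<] 1) (𝓝 c) := by
  set d : ℂ := (∑' n, p n * η ^ n) - c * η with hd
  set q : ℕ → ℂ := fun n => if n = 0 then d else if n = 1 then c else 0 with hq
  have hq0 : ∀ n ∉ Finset.range 2, q n = 0 := by
    intro n hn
    have : 2 ≤ n := by simpa [Nat.succ_le_iff] using hn
    simp only [hq]
    rw [if_neg (by omega), if_neg (by omega)]
  have hqs : Summable fun n => ‖q n‖ :=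
    summable_of_ne_finset_zero (s := Finset.range 2) fun n hn => by rw [hq0 n hn, norm_zero]
  have hps : Summable fun n => ‖p n - q n‖ :=
    Summable.of_nonneg_of_le (fun n => norm_nonneg _) (fun n => norm_sub_le _ _) (hp.add hqs)
  have hE : ∀ ζ : ℂ, ‖ζ‖ = 1 → ∑' n, (p n - q n) * ζ ^ n =
      (∑' n, p n * ζ ^ n) - (∑' n, p n * η ^ n) - c * (ζ - η) := by
    intro ζ hζ
    have h1 : Summable fun n => p n * ζ ^ n := Summable.of_norm (by simpa [hζ] using hp)
    have h2 : HasSum (fun n => q n * ζ ^ n) (d + c * ζ) := by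
      have : HasSum (fun n => q n * ζ ^ n) (∑ n ∈ Finset.range 2, q n * ζ ^ n) :=
        hasSum_sum_of_ne_finset_zero fun n hn => by rw [hq0 n hn, zero_mul]
      simpa [Finset.sum_range_succ, hq] using this
    simp only [sub_mul]
    rw [(h1.hasSum.sub h2).tsum_eq, hd]
    ring
  have hmain := tendsto_deriv_of_littleO hps hη fun ε hε => by
    have h1 := ho.def hε
    rw [eventually_nhdsWithin_iff, Metric.eventually_nhds_iff] at h1
    obtain ⟨δ, hδ, h1⟩ := h1
    refine ⟨δ, hδ, fun ζ hζ hlt => ?_⟩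
    rw [hE ζ hζ]
    exact h1 (by rwa [dist_eq_norm]) (by simpa using hζ)
  have hadd : ∀ᶠ r : ℝ in 𝓝[<] 1, (∑' n : ℕ, (p n - q n) * (n * ((r : ℂ) * η) ^ (n - 1))) + c =
      ∑' n : ℕ, p n * (n * ((r : ℂ) * η) ^ (n - 1)) := by
    filter_upwards [Ioo_mem_nhdsLT (show (0 : ℝ) < 1 by norm_num)] with r hr
    have hz : ‖(r : ℂ) * η‖ < 1 := by simp [hη, abs_of_pos hr.1, hr.2]
    have h1 := (deriv_eq_integral_kernel hp hz 0).summable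
    have h2 : HasSum (fun n : ℕ => q n * (n * ((r : ℂ) * η) ^ (n - 1))) c := by
      have : HasSum (fun n : ℕ => q n * (n * ((r : ℂ) * η) ^ (n - 1)))
          (∑ n ∈ Finset.range 2, q n * ((n : ℕ) * ((r : ℂ) * η) ^ (n - 1))) :=
        hasSum_sum_of_ne_finset_zero fun n hn => by rw [hq0 n hn, zero_mul]
      simpa [Finset.sum_range_succ, hq] using this
    simp only [sub_mul]
    rw [(h1.hasSum.sub h2).tsum_eq]
    ring
  have := (hmain.add_const c).congr' hadd
  rwa [zero_add] at this

/-- Differentiability in the angle is transported to the circle by the local inverse `ζ ↦ θ + arg (ζ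
/ η)`, which is Lipschitz at `η` because `circleMap` has nonzero speed. -/
theorem isLittleO_of_hasDerivAt_circleMap {P : ℂ → ℂ} {c : ℂ} {θ : ℝ}
    (h : HasDerivAt (fun t => P (circleMap 0 1 t)) (c * (circleMap 0 1 θ * Complex.I)) θ) :
    (fun ζ => P ζ - P (circleMap 0 1 θ) - c * (ζ - circleMap 0 1 θ))
      =o[𝓝[Metric.sphere 0 1] (circleMap 0 1 θ)] fun ζ => ζ - circleMap 0 1 θ := by
  set η := circleMap 0 1 θ with hη
  have hη1 : ‖η‖ = 1 := by simp [hη]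
  have hη0 : η ≠ 0 := by rw [← norm_pos_iff, hη1]; norm_num
  set s : ℂ → ℝ := fun ζ => θ + (ζ / η).arg with hs
  have hsη : s η = θ := by simp [hs, div_self hη0]
  have hst : Tendsto s (𝓝[Metric.sphere 0 1] η) (𝓝 θ) := by
    have h1 : ContinuousAt s η := by
      refine continuousAt_const.add ?_
      refine ContinuousAt.comp (g := Complex.arg) (f := fun ζ => ζ / η) ?_ (by fun_prop)
      rw [div_self hη0]
      exact Complex.continuousAt_arg (by simp)
    have := h1.tendsto
    rw [hsη] at this
    exact this.mono_left nhdsWithin_le_nhds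
  have hcs : ∀ ζ ∈ Metric.sphere (0 : ℂ) 1, circleMap 0 1 (s ζ) = ζ := by
    intro ζ hζ
    have hζ1 : ‖ζ‖ = 1 := by simpa using hζ
    have h1 := Complex.norm_mul_exp_arg_mul_I (ζ / η)
    rw [norm_div, hζ1, hη1, div_one, Complex.ofReal_one, one_mul] at h1
    have h2 : circleMap 0 1 (s ζ) = η * Complex.exp ((ζ / η).arg * Complex.I) := by
      have h3 : ∀ t : ℝ, circleMap 0 1 (θ + t) = circleMap 0 1 θ * Complex.exp (t * Complex.I) := by
        intro t
        simp only [circleMap, Complex.ofReal_one, one_mul, zero_add]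
        rw [← Complex.exp_add, ← add_mul, Complex.ofReal_add]
      exact h3 _
    rw [h2, h1, mul_div_cancel₀ _ hη0]
  have hγ := hasDerivAt_circleMap 0 1 θ
  have hbig := (HasDerivAtFilter.isTheta_sub hγ
    (mul_ne_zero hη0 Complex.I_ne_zero)).isBigO_symm.comp_tendsto
      (hst.prodMk (tendsto_pure.mpr (Eventually.of_forall fun _ => rfl)))
  have hQ : HasDerivAt (fun t => P (circleMap 0 1 t) - c * circleMap 0 1 t) 0 θ := by
    have := h.sub (hγ.const_mul c)
    rwa [sub_self] at this
  have hlit := (hasDerivAt_iff_isLittleO.mp hQ).comp_tendsto hst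
  refine (hlit.trans_isBigO hbig).congr' ?_ ?_
  · filter_upwards [self_mem_nhdsWithin] with ζ hζ
    simp only [Function.comp, smul_zero, sub_zero, hcs ζ hζ, ← hη]
    ring
  · filter_upwards [self_mem_nhdsWithin] with ζ hζ
    simp only [Function.comp, hcs ζ hζ, ← hη]

/-! ### Fatou's theorem in `H²` through the primitive -/

section Primitive

variable {a : ℕ → ℂ}

/-- From `x y ≤ x² + y²` with `x = ‖a (n - 1)‖`, `y = 1 / n`. The term `n = 0` is zero because
division by zero is. -/
theorem summable_primitive (ha : Summable fun n => ‖a n‖ ^ 2) :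
    Summable fun n : ℕ => ‖a (n - 1) / n‖ := by
  have h1 : Summable fun n : ℕ => ‖a (n - 1)‖ ^ 2 :=
    (summable_nat_add_iff 1).mp (by simpa using ha)
  have h2 : Summable fun n : ℕ => 1 / (n : ℝ) ^ 2 := Real.summable_one_div_nat_pow.mpr (by norm_num)
  refine Summable.of_nonneg_of_le (fun n => norm_nonneg _) (fun n => ?_) (h1.add h2)
  rw [norm_div, Complex.norm_natCast, div_eq_mul_one_div, ← one_div_pow]
  nlinarith [sq_nonneg (‖a (n - 1)‖ - 1 / (n : ℝ)), sq_nonneg ‖a (n - 1)‖, sq_nonneg (1 / (n : ℝ))]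

theorem tsum_deriv_primitive (a : ℕ → ℂ) {z : ℂ} (hs : Summable fun n => a n * z ^ n) :
    ∑' n : ℕ, a (n - 1) / n * (n * z ^ (n - 1)) = ∑' n, a n * z ^ n := by
  have h : ∀ n : ℕ, a (n + 1 - 1) / ((n + 1 : ℕ) : ℂ) * (((n + 1 : ℕ) : ℂ) * z ^ (n + 1 - 1)) =
      a n * z ^ n := by
    intro n
    have : ((n + 1 : ℕ) : ℂ) ≠ 0 := by exact_mod_cast n.succ_ne_zero
    rw [← mul_assoc, div_mul_cancel₀ _ this, Nat.add_sub_cancel]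
  have h0 : HasSum (fun n : ℕ => a (n - 1) / n * (n * z ^ (n - 1))) (∑' n, a n * z ^ n) := by
    rw [← hasSum_nat_add_iff' 1]
    simp only [h]
    simpa using hs.hasSum
  exact h0.tsum_eq

theorem hasDerivAt_powerSeries {p : ℕ → ℂ} {C : ℝ} (hp : ∀ n, ‖p n‖ ≤ C) {z : ℂ} (hz : ‖z‖ < 1) :
    HasDerivAt (fun z => ∑' n, p n * z ^ n) (∑' n : ℕ, p n * (n * z ^ (n - 1))) z := by
  obtain ⟨ρ, h1, h2⟩ := exists_between hz
  have hρ : 0 < ρ := (norm_nonneg z).trans_lt h1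
  have hC : 0 ≤ C := (norm_nonneg _).trans (hp 0)
  have hρ1 : ‖ρ‖ < 1 := by rwa [Real.norm_of_nonneg hρ.le]
  have hu : Summable fun n : ℕ => C / ρ * ((n : ℝ) ^ 1 * ρ ^ n) :=
    (summable_pow_mul_geometric_of_norm_lt_one 1 hρ1).mul_left _
  have hb : ∀ (n : ℕ) (y : ℂ), y ∈ Metric.ball (0 : ℂ) ρ →
      ‖p n * ((n : ℂ) * y ^ (n - 1))‖ ≤ C / ρ * ((n : ℝ) ^ 1 * ρ ^ n) := by
    intro n y hy
    have hy' : ‖y‖ ≤ ρ := by simpa using (Metric.mem_ball.mp hy).le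
    rw [norm_mul, norm_mul, norm_pow, Complex.norm_natCast]
    rcases n with _ | n
    · simp
    · calc ‖p (n + 1)‖ * (((n + 1 : ℕ) : ℝ) * ‖y‖ ^ (n + 1 - 1))
          ≤ C * (((n + 1 : ℕ) : ℝ) * ρ ^ n) := by
            rw [Nat.add_sub_cancel]
            gcongr
            exact hp _
        _ = C / ρ * (((n + 1 : ℕ) : ℝ) ^ 1 * ρ ^ (n + 1)) := by
            rw [pow_one, pow_succ]; field_simp
  have h0 : Summable fun n => p n * (0 : ℂ) ^ n := Summable.of_norm (summable_of_bounded hp (by simp))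
  exact hasDerivAt_tsum_of_isPreconnected (g := fun n z => p n * z ^ n) hu Metric.isOpen_ball
    (convex_ball (0 : ℂ) ρ).isPreconnected (fun n y _ => (hasDerivAt_pow n y).const_mul (p n))
    hb (Metric.mem_ball_self hρ) h0 (by simpa using h1)

end Primitive

/-- **Fatou's theorem** for the Hardy space `H²`. -/
theorem exists_boundary_h2 {a : ℕ → ℂ} (ha : Summable fun n => ‖a n‖ ^ 2) :
    ∃ g : ℂ → ℂ, MemLp g 2 circleMeasure ∧
      Tendsto (fun j => eLpNorm (fun ζ => (∑' n, a n * (radius j * ζ) ^ n) - g ζ) 2 circleMeasure)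
        atTop (𝓝 0) ∧
      ∀ᵐ ζ ∂circleMeasure, Tendsto (fun r : ℝ => ∑' n, a n * ((r : ℂ) * ζ) ^ n) (𝓝[<] 1)
        (𝓝 (g ζ)) := by
  obtain ⟨g, hg, hlim⟩ := exists_l2_limit ha
  refine ⟨g, hg, hlim, ?_⟩
  obtain ⟨C, hC⟩ := bounded_of_summable_sq ha
  set p : ℕ → ℂ := fun n => a (n - 1) / n with hp
  have hps : Summable fun n => ‖p n‖ := summable_primitive ha
  set P : ℂ → ℂ := fun z => ∑' n, p n * z ^ n with hP
  set A : ℂ → ℂ := fun z => ∑' n, a n * z ^ n with hA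
  have hPd : ∀ z, ‖z‖ < 1 → HasDerivAt P (A z) z := by
    intro z hz
    have h1 := hasDerivAt_powerSeries (fun n => hps.le_tsum n fun _ _ => norm_nonneg _) hz
    rwa [hp, tsum_deriv_primitive a (Summable.of_norm (summable_of_bounded hC hz))] at h1
  have hAd : ∀ z, ‖z‖ < 1 → ContinuousAt A z := fun z hz =>
    (hasDerivAt_powerSeries hC hz).continuousAt
  have hnorm : ∀ j θ, ‖(radius j : ℂ) * circleMap 0 1 θ‖ < 1 := by
    intro j θ
    simp [abs_of_pos (radius_pos j), radius_lt_one j]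
  set ν := volume.restrict (Ioc 0 (2 * Real.pi)) with hν
  have hmap : ν.map (circleMap 0 1) = ENNReal.ofReal (2 * Real.pi) • circleMeasure :=
    map_circleMap_eq
  have hgi : Integrable (fun θ => Complex.I * circleMap 0 1 θ * g (circleMap 0 1 θ)) ν := by
    have h1 : Integrable g (ν.map (circleMap 0 1)) := by
      rw [hmap]
      exact (hg.integrable (by norm_num)).smul_measure ENNReal.ofReal_ne_top
    exact (h1.comp_measurable (by fun_prop)).bdd_mul (c := 1) (by fun_prop)
      (Eventually.of_forall fun θ => by simp)
  have hAc : ∀ j, Continuous fun θ => Complex.I * circleMap 0 1 θ * A (radius j * circleMap 0 1 θ) := by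
    intro j
    refine Continuous.mul (by fun_prop) (continuous_iff_continuousAt.mpr fun θ => ?_)
    exact ContinuousAt.comp (g := A) (hAd _ (hnorm j θ)) (by fun_prop)
  have hL1 : Tendsto (fun j => ∫⁻ θ, ‖Complex.I * circleMap 0 1 θ * A (radius j * circleMap 0 1 θ) -
      Complex.I * circleMap 0 1 θ * g (circleMap 0 1 θ)‖ₑ ∂ν) atTop (𝓝 0) := by
    have h1 : ∀ j, AEStronglyMeasurable (fun ζ => A (radius j * ζ) - g ζ) circleMeasure := by
      intro j
      refine AEStronglyMeasurable.sub (aestronglyMeasurable_of_continuousOn fun ζ hζ => ?_) hg.1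
      refine (ContinuousAt.comp (g := A) (hAd _ ?_) (by fun_prop)).continuousWithinAt
      have hζ1 : ‖ζ‖ ≤ 1 := by simpa using hζ
      rw [norm_mul, Complex.norm_real, Real.norm_of_nonneg (radius_pos j).le]
      exact (mul_le_of_le_one_right (radius_pos j).le hζ1).trans_lt (radius_lt_one j)
    have h2 : ∀ j, ∫⁻ θ, ‖Complex.I * circleMap 0 1 θ * A (radius j * circleMap 0 1 θ) -
        Complex.I * circleMap 0 1 θ * g (circleMap 0 1 θ)‖ₑ ∂ν ≤
        ENNReal.ofReal (2 * Real.pi) *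
          eLpNorm (fun ζ => A (radius j * ζ) - g ζ) 2 circleMeasure := by
      intro j
      have h3 : ∀ θ, ‖Complex.I * circleMap 0 1 θ * A (radius j * circleMap 0 1 θ) -
          Complex.I * circleMap 0 1 θ * g (circleMap 0 1 θ)‖ₑ =
          (fun ζ => ‖A (radius j * ζ) - g ζ‖ₑ) (circleMap 0 1 θ) := by
        intro θ
        rw [← mul_sub, enorm_mul, enorm_mul]
        simp [← ofReal_norm]
      simp only [h3]
      rw [← lintegral_map' (f := fun ζ => ‖A (radius j * ζ) - g ζ‖ₑ)
        (by rw [hmap]; exact ((h1 j).smul_measure _).enorm) (by fun_prop), hmap,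
        lintegral_smul_measure, smul_eq_mul, ← eLpNorm_one_eq_lintegral_enorm]
      gcongr
      exact eLpNorm_le_eLpNorm_of_exponent_le (by norm_num) (h1 j)
    refine tendsto_of_tendsto_of_tendsto_of_le_of_le tendsto_const_nhds ?_ (fun _ => zero_le) h2
    have := ENNReal.Tendsto.const_mul (a := ENNReal.ofReal (2 * Real.pi)) hlim
      (Or.inr ENNReal.ofReal_ne_top)
    rwa [mul_zero] at this
  -- On the circle of radius `radius j` this is the fundamental theorem of calculus; mean
  -- convergence of the dilations and continuity of `P` on the closed disk carry it to the unit
  -- circle.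
  have hFTC : ∀ θ ∈ Icc 0 (2 * Real.pi), P (circleMap 0 1 θ) =
      P 1 + ∫ s in (0 : ℝ)..θ, Complex.I * circleMap 0 1 s * g (circleMap 0 1 s) := by
    intro θ hθ
    have h1 : ∀ j, (radius j : ℂ) * ∫ s in (0 : ℝ)..θ,
        Complex.I * circleMap 0 1 s * A (radius j * circleMap 0 1 s) =
        P (radius j * circleMap 0 1 θ) - P (radius j) := by
      intro j
      have h2 : ∀ s : ℝ, HasDerivAt (fun s : ℝ => P (radius j * circleMap 0 1 s))
          ((radius j : ℂ) * (Complex.I * circleMap 0 1 s * A (radius j * circleMap 0 1 s))) s := by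
        intro s
        have := (hPd _ (hnorm j s)).scomp s ((hasDerivAt_circleMap 0 1 s).const_mul (radius j : ℂ))
        simp only [smul_eq_mul] at this
        exact this.congr_deriv (by ring)
      rw [← intervalIntegral.integral_const_mul]
      rw [intervalIntegral.integral_eq_sub_of_hasDerivAt (fun s _ => h2 s)
        ((continuous_const.mul (hAc j)).intervalIntegrable _ _)]
      simp [circleMap]
    have h3 := tendsto_setIntegral_of_L1 _ hgi.aestronglyMeasurable
      (Eventually.of_forall fun j => ((hAc j).integrableOn_Icc.mono_set Ioc_subset_Icc_self))
      hL1 (Ioc 0 θ)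
    have h4 : ν.restrict (Ioc 0 θ) = volume.restrict (Ioc 0 θ) := by
      rw [hν, Measure.restrict_restrict measurableSet_Ioc,
        inter_eq_left.mpr (Ioc_subset_Ioc_right hθ.2)]
    rw [h4] at h3
    have hr : Tendsto (fun j => (radius j : ℂ)) atTop (𝓝 1) := by
      have := (Complex.continuous_ofReal.tendsto 1).comp tendsto_radius
      rwa [Complex.ofReal_one] at this
    have h5 := hr.mul h3
    simp only [← intervalIntegral.integral_of_le hθ.1] at h5
    simp only [h1, one_mul] at h5
    have hcont := continuousOn_powerSeries hps
    have h6 : ∀ ζ : ℂ, ‖ζ‖ = 1 → Tendsto (fun j => P (radius j * ζ)) atTop (𝓝 (P ζ)) := by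
      intro ζ hζ
      refine (hcont ζ (by simp [hζ])).tendsto.comp (tendsto_nhdsWithin_iff.mpr ⟨?_, ?_⟩)
      · simpa using hr.mul_const ζ
      · refine Eventually.of_forall fun j => ?_
        simp [hζ, abs_of_pos (radius_pos j), (radius_lt_one j).le]
    have h7 := (h6 (circleMap 0 1 θ) (by simp)).sub (h6 1 (by simp))
    simp only [mul_one] at h7
    rw [← tendsto_nhds_unique h7 h5]
    ring
  -- Lebesgue differentiation makes `θ ↦ P (circleMap 0 1 θ)` differentiable almost everywhere, with
  -- derivative `i ζ g ζ`; the radial limit of `P'`, whose series is the given one, is then `g ζ`.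
  have hdiff := IntervalIntegrable.ae_hasDerivAt_integral
    ((intervalIntegrable_iff_integrableOn_Ioc_of_le (by positivity)).mpr hgi)
  refine ae_of_ae_circleMap ?_
  have hne : ∀ᵐ θ ∂ν, θ ≠ 2 * Real.pi := by
    refine ae_restrict_of_ae ?_
    simp [ae_iff, measure_singleton]
  filter_upwards [ae_restrict_of_ae hdiff, ae_restrict_mem measurableSet_Ioc, hne] with θ h1 h2 h3
  have hθ : θ ∈ Ioo 0 (2 * Real.pi) := ⟨h2.1, lt_of_le_of_ne h2.2 h3⟩
  have h4 := h1 (by rw [uIcc_of_le (by positivity)]; exact ⟨hθ.1.le, hθ.2.le⟩) 0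
    (by rw [uIcc_of_le (by positivity)]; exact ⟨le_rfl, by positivity⟩)
  have h5 : HasDerivAt (fun t => P (circleMap 0 1 t))
      (g (circleMap 0 1 θ) * (circleMap 0 1 θ * Complex.I)) θ := by
    have h6 := (h4.const_add (P 1)).congr_of_eventuallyEq (f₁ := fun t => P (circleMap 0 1 t)) (by
      filter_upwards [Ioo_mem_nhds hθ.1 hθ.2] with t ht
      exact hFTC t ⟨ht.1.le, ht.2.le⟩)
    exact h6.congr_deriv (by ring)
  have h7 := tendsto_deriv_of_isLittleO hps (by simp) (isLittleO_of_hasDerivAt_circleMap h5)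
  refine h7.congr' ?_
  filter_upwards [Ioo_mem_nhdsLT (show (0 : ℝ) < 1 by norm_num)] with r hr
  exact tsum_deriv_primitive a (Summable.of_norm (summable_of_bounded hC
    (by simp [abs_of_pos hr.1, hr.2])))

/-! ### Factorization of polynomials and of `H¹` functions -/

theorem hasSum_taylorCoeff {f : ℂ → ℂ} (hf : DifferentiableOn ℂ f (Metric.ball 0 1)) (z : ℂ)
    (hz : ‖z‖ < 1) : HasSum (fun n => taylorCoeff f n * z ^ n) (f z) := by
  have h := Complex.hasSum_taylorSeries_on_ball (c := 0) (r := 1) (by simpa using hf)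
    (z := z) (by simpa using hz)
  refine h.congr_fun fun n => ?_
  simp only [taylorCoeff, sub_zero, smul_eq_mul]
  ring

/-- A factorization of `p` on the unit disk into two analytic functions whose squared moduli are
controlled by a continuous function with boundary modulus `‖p‖`. -/
def HasSquareFactorization (p : ℂ → ℂ) : Prop :=
  ∃ A G F : ℂ → ℂ, DifferentiableOn ℂ A (Metric.ball 0 1) ∧ DifferentiableOn ℂ G (Metric.ball 0 1) ∧
    Continuous F ∧ (∀ z, ‖z‖ < 1 → p z = A z * G z) ∧ (∀ z, ‖z‖ < 1 → ‖A z‖ ^ 2 ≤ ‖F z‖) ∧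
    (∀ z, ‖z‖ < 1 → ‖G z‖ ^ 2 ≤ ‖F z‖) ∧ ∀ z, ‖z‖ = 1 → ‖F z‖ = ‖p z‖

namespace HasSquareFactorization

theorem mul {p q : ℂ → ℂ} (hp : HasSquareFactorization p) (hq : HasSquareFactorization q) :
    HasSquareFactorization fun z => p z * q z := by
  obtain ⟨A, G, F, h1, h2, h3, h4, h5, h6, h7⟩ := hp
  obtain ⟨A', G', F', h1', h2', h3', h4', h5', h6', h7'⟩ := hq
  refine ⟨fun z => A z * A' z, fun z => G z * G' z, fun z => F z * F' z, h1.mul h1', h2.mul h2',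
    h3.mul h3', fun z hz => ?_, fun z hz => ?_, fun z hz => ?_, fun z hz => ?_⟩
  · dsimp only; rw [h4 z hz, h4' z hz]; ring
  · rw [norm_mul, norm_mul, mul_pow]
    exact mul_le_mul (h5 z hz) (h5' z hz) (by positivity) (by positivity)
  · rw [norm_mul, norm_mul, mul_pow]
    exact mul_le_mul (h6 z hz) (h6' z hz) (by positivity) (by positivity)
  · rw [norm_mul, norm_mul, h7 z hz, h7' z hz]

theorem const (c : ℂ) : HasSquareFactorization fun _ => c := by
  obtain ⟨s, hs⟩ := IsAlgClosed.exists_pow_nat_eq c (n := 2) (by norm_num)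
  have hn : ‖s‖ ^ 2 ≤ ‖c‖ := by rw [← hs, norm_pow]
  exact ⟨fun _ => s, fun _ => s, fun _ => c, by fun_prop, by fun_prop, by fun_prop,
    fun z _ => by rw [← hs, sq], fun _ _ => hn, fun _ _ => hn, fun _ _ => rfl⟩

/-- `1 - w z` lies in the right half plane, where the principal square root is analytic. -/
theorem exists_sqrt {w : ℂ} (hw : ‖w‖ ≤ 1) : ∃ G : ℂ → ℂ, DifferentiableOn ℂ G (Metric.ball 0 1) ∧
    ∀ z, ‖z‖ < 1 → G z * G z = 1 - w * z := by
  have hre : ∀ z : ℂ, ‖z‖ < 1 → 0 < (1 - w * z).re := by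
    intro z hz
    have h1 : ‖w * z‖ < 1 := by
      rw [norm_mul]; exact (mul_le_of_le_one_left (norm_nonneg _) hw).trans_lt hz
    have h2 := (Complex.re_le_norm (w * z)).trans_lt h1
    simp only [Complex.sub_re, Complex.one_re]
    linarith
  refine ⟨fun z => (1 - w * z) ^ (1 / 2 : ℂ), fun z hz => ?_, fun z hz => ?_⟩
  · refine DifferentiableAt.differentiableWithinAt (DifferentiableAt.cpow (by fun_prop) (by fun_prop) ?_)
    exact Or.inl (hre z (by simpa using hz))
  · have hne : 1 - w * z ≠ 0 := fun h => by have := hre z hz; rw [h] at this; simp at this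
    rw [← Complex.cpow_add _ _ hne]
    norm_num

/-- A root outside the open disk leaves `z - u` zero free there, so both factors are its square
root. For `|u| < 1`, `z - u` is a Blaschke factor times `1 - conj u z`: the zero-free part is split
by a square root and the Blaschke factor is given to one side. Then `F = 1 - conj u z` has modulus
`|z - u|` on the circle. -/
theorem sub_const (u : ℂ) : HasSquareFactorization fun z => z - u := by
  rcases lt_or_ge ‖u‖ 1 with hu | hu
  · obtain ⟨G, hG, hGG⟩ := exists_sqrt (w := conj u) (by simpa using hu.le)
    have hpos : ∀ z : ℂ, ‖z‖ ≤ 1 → 0 < ‖1 - conj u * z‖ := fun z hz =>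
      norm_one_sub_mul_pos (by simpa using hu) hz
    have hsq : ∀ z : ℂ, ‖1 - conj u * z‖ ^ 2 - ‖z - u‖ ^ 2 = (1 - ‖u‖ ^ 2) * (1 - ‖z‖ ^ 2) := by
      intro z
      simp only [← Complex.normSq_eq_norm_sq, Complex.normSq_apply, Complex.sub_re, Complex.sub_im,
        Complex.one_re, Complex.one_im, Complex.mul_re, Complex.mul_im, Complex.conj_re,
        Complex.conj_im]
      ring
    have hGn : ∀ z, ‖z‖ < 1 → ‖G z‖ ^ 2 = ‖1 - conj u * z‖ := fun z hz => by
      rw [← hGG z hz, norm_mul, sq]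
    refine ⟨fun z => (z - u) / (1 - conj u * z) * G z, G, fun z => 1 - conj u * z, ?_, hG,
      by fun_prop, fun z hz => ?_, fun z hz => ?_, fun z hz => (hGn z hz).le, fun z hz => ?_⟩
    · refine DifferentiableOn.mul (DifferentiableOn.div (by fun_prop) (by fun_prop) fun z hz => ?_) hG
      exact norm_pos_iff.mp (hpos z (by simpa using (Metric.mem_ball.mp hz).le))
    · rw [mul_assoc, hGG z hz, div_mul_cancel₀ _ (norm_pos_iff.mp (hpos z hz.le))]
    · rw [norm_mul, mul_pow, hGn z hz, norm_div, div_pow]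
      refine mul_le_of_le_one_left (norm_nonneg _) ?_
      rw [div_le_one (by have := hpos z hz.le; positivity)]
      have h1 : 0 ≤ 1 - ‖u‖ ^ 2 := by nlinarith [norm_nonneg u]
      have h2 : 0 ≤ 1 - ‖z‖ ^ 2 := by nlinarith [norm_nonneg z]
      nlinarith [hsq z, mul_nonneg h1 h2]
    · have h1 := hsq z
      rw [hz] at h1
      have h2 : ‖1 - conj u * z‖ ^ 2 = ‖z - u‖ ^ 2 := by linarith
      exact (pow_left_inj₀ (norm_nonneg _) (norm_nonneg _) two_ne_zero).mp h2
  · have hu0 : u ≠ 0 := by rw [← norm_pos_iff]; linarith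
    obtain ⟨G, hG, hGG⟩ := exists_sqrt (w := u⁻¹) (by rw [norm_inv]; exact inv_le_one_of_one_le₀ hu)
    obtain ⟨s, hs⟩ := IsAlgClosed.exists_pow_nat_eq (-u) (n := 2) (by norm_num)
    have hfac : ∀ z, ‖z‖ < 1 → z - u = s * G z * (s * G z) := by
      intro z hz
      have : s * G z * (s * G z) = s ^ 2 * (G z * G z) := by ring
      rw [this, hs, hGG z hz]
      field_simp
      ring
    have hn : ∀ z, ‖z‖ < 1 → ‖s * G z‖ ^ 2 ≤ ‖z - u‖ := fun z hz => by
      rw [hfac z hz, norm_mul (s * G z), sq]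
    exact ⟨fun z => s * G z, fun z => s * G z, fun z => z - u, hG.const_mul s, hG.const_mul s,
      by fun_prop, hfac, hn, hn, fun _ _ => rfl⟩

theorem polynomial (p : Polynomial ℂ) : HasSquareFactorization fun z => p.eval z := by
  have h := (IsAlgClosed.splits p).eq_prod_roots
  have key : ∀ s : Multiset ℂ, HasSquareFactorization fun z =>
      (s.map fun a => Polynomial.X - Polynomial.C a).prod.eval z := by
    intro s
    induction s using Multiset.induction_on with
    | empty => simpa using const 1
    | cons a s ih =>
      have := (sub_const a).mul ih
      simpa [Polynomial.eval_mul] using this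
  have h2 := (const p.leadingCoeff).mul (key p.roots)
  rw [h]
  simpa [Polynomial.eval_mul] using h2

end HasSquareFactorization

/-- Parseval on the circles of radius `radius j`; continuity of `F` up to the boundary allows the
limit, although `f` itself is only controlled inside the disk. -/
theorem sum_norm_sq_coeff_le {f F : ℂ → ℂ} {c : ℕ → ℂ}
    (hf : ∀ z, ‖z‖ < 1 → HasSum (fun n => c n * z ^ n) (f z)) (hF : Continuous F)
    (hfF : ∀ z, ‖z‖ < 1 → ‖f z‖ ^ 2 ≤ ‖F z‖) (N : ℕ) :
    ∑ n ∈ Finset.range N, ‖c n‖ ^ 2 ≤ ∫ ζ, ‖F ζ‖ ∂circleMeasure := by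
  obtain ⟨K, hK⟩ := (isCompact_closedBall (0 : ℂ) 1).exists_bound_of_continuousOn hF.continuousOn
  have hnorm : ∀ j, ∀ ζ : ℂ, ‖ζ‖ = 1 → ‖(radius j : ℂ) * ζ‖ < 1 := by
    intro j ζ hζ
    simp [hζ, abs_of_pos (radius_pos j), radius_lt_one j]
  have hbd : ∀ j, ∀ ζ : ℂ, ‖ζ‖ = 1 → ‖F (radius j * ζ)‖ ≤ K := fun j ζ hζ =>
    hK _ (by simpa using (hnorm j ζ hζ).le)
  have hle : ∀ j, ∑ n ∈ Finset.range N, ‖c n‖ ^ 2 * (radius j ^ n) ^ 2 ≤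
      ∫ ζ, ‖F (radius j * ζ)‖ ∂circleMeasure := by
    intro j
    have hs : Summable fun n => ‖c n * (radius j : ℂ) ^ n‖ :=
      (hf (radius j) (by simpa using hnorm j 1 (by simp))).summable.norm
    have h1 := parseval hs
    have h2 : ∀ n, ‖c n * (radius j : ℂ) ^ n‖ ^ 2 = ‖c n‖ ^ 2 * (radius j ^ n) ^ 2 := by
      intro n
      rw [norm_mul, mul_pow, norm_pow, Complex.norm_real, Real.norm_of_nonneg (radius_pos j).le]
    simp only [h2] at h1
    refine (sum_le_hasSum _ (fun n _ => by positivity) h1).trans ?_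
    refine integral_mono_ae ((memLp_powerSeries hs 2).integrable_norm_pow (by norm_num)) ?_ ?_
    · exact (integrable_of_bounded (by fun_prop) (hbd j)).norm
    · refine ae_circleMeasure_of_forall fun ζ hζ => ?_
      have h3 := (hf _ (hnorm j ζ hζ)).tsum_eq
      simp only [mul_pow, ← mul_assoc] at h3
      simp only [h3]
      exact hfF _ (hnorm j ζ hζ)
  have hl : Tendsto (fun j => ∑ n ∈ Finset.range N, ‖c n‖ ^ 2 * (radius j ^ n) ^ 2) atTop
      (𝓝 (∑ n ∈ Finset.range N, ‖c n‖ ^ 2)) := by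
    refine tendsto_finsetSum _ fun n _ => ?_
    have := ((tendsto_radius.pow n).pow 2).const_mul (‖c n‖ ^ 2)
    simpa using this
  have hr : Tendsto (fun j => ∫ ζ, ‖F (radius j * ζ)‖ ∂circleMeasure) atTop
      (𝓝 (∫ ζ, ‖F ζ‖ ∂circleMeasure)) := by
    refine tendsto_integral_of_dominated_convergence (fun _ => K)
      (fun j => (Continuous.aestronglyMeasurable (by fun_prop))) (integrable_const K)
      (fun j => ae_circleMeasure_of_forall fun ζ hζ => by simpa using hbd j ζ hζ)
      (Eventually.of_forall fun ζ => ?_)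
    have h1 : Tendsto (fun j => (radius j : ℂ) * ζ) atTop (𝓝 ζ) := by
      have := ((Complex.continuous_ofReal.tendsto 1).comp tendsto_radius).mul_const ζ
      rwa [Complex.ofReal_one, one_mul] at this
    exact ((hF.tendsto ζ).comp h1).norm
  exact le_of_tendsto_of_tendsto' hl hr hle

/-- The sequences whose squared partial sums are bounded by `B`. -/
def squareBounded (B : ℝ) : Set (ℕ → ℂ) :=
  {c | ∀ N, ∑ n ∈ Finset.range N, ‖c n‖ ^ 2 ≤ B}

theorem norm_le_of_mem_squareBounded {B : ℝ} {c : ℕ → ℂ} (hc : c ∈ squareBounded B) (n : ℕ) :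
    ‖c n‖ ≤ √B := by
  refine Real.le_sqrt_of_sq_le ((Finset.single_le_sum (f := fun n => ‖c n‖ ^ 2)
    (fun i _ => by positivity) (Finset.self_mem_range_succ n)).trans (hc (n + 1)))

theorem summable_of_mem_squareBounded {B : ℝ} {c : ℕ → ℂ} (hc : c ∈ squareBounded B) :
    Summable fun n => ‖c n‖ ^ 2 :=
  summable_of_sum_range_le (fun n => by positivity) hc

/-- Compactness is for coordinatewise convergence, by Tychonoff: each defining condition involves
finitely many coordinates and is closed. -/
theorem isCompact_squareBounded (B : ℝ) : IsCompact (squareBounded B) := by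
  refine IsCompact.of_isClosed_subset
    (isCompact_univ_pi fun _ : ℕ => isCompact_closedBall (0 : ℂ) (√B)) ?_ fun c hc n _ => ?_
  · rw [squareBounded, ofPred_forall]
    exact isClosed_iInter fun N => isClosed_le (by fun_prop) continuous_const
  · simpa using norm_le_of_mem_squareBounded hc n

theorem exists_factor_polynomial (p : Polynomial ℂ) {B : ℝ}
    (hB : ∫ ζ, ‖p.eval ζ‖ ∂circleMeasure ≤ B) :
    ∃ a ∈ squareBounded B, ∃ g ∈ squareBounded B, ∀ z, ‖z‖ < 1 →
      p.eval z = (∑' n, a n * z ^ n) * ∑' n, g n * z ^ n := by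
  obtain ⟨A, G, F, hA, hG, hF, hAG, hAF, hGF, hFp⟩ := HasSquareFactorization.polynomial p
  have hFB : ∫ ζ, ‖F ζ‖ ∂circleMeasure ≤ B := by
    rw [integral_congr_ae (ae_circleMeasure_of_forall hFp)]
    exact hB
  refine ⟨taylorCoeff A, fun N => ?_, taylorCoeff G, fun N => ?_, fun z hz => ?_⟩
  · exact (sum_norm_sq_coeff_le (hasSum_taylorCoeff hA) hF hAF N).trans hFB
  · exact (sum_norm_sq_coeff_le (hasSum_taylorCoeff hG) hF hGF N).trans hFB
  · rw [(hasSum_taylorCoeff hA z hz).tsum_eq, (hasSum_taylorCoeff hG z hz).tsum_eq]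
    exact hAG z hz

/-! ### Hardy norms and Cesàro means in `H¹` -/

theorem hardyNorm_one (h : ℂ → ℂ) :
    hardyNorm 1 h = ⨆ r ∈ Ioo (0 : ℝ) 1, ∫⁻ ζ, ‖h (r * ζ)‖ₑ ∂circleMeasure := by
  simp [hardyNorm]

theorem hardyNorm_top (h : ℂ → ℂ) : hardyNorm ∞ h = ⨆ z ∈ Metric.ball (0 : ℂ) 1, ‖h z‖ₑ := by
  simp [hardyNorm]

theorem lintegral_le_hardyNorm_one (h : ℂ → ℂ) {r : ℝ} (hr : r ∈ Ioo (0 : ℝ) 1) :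
    ∫⁻ ζ, ‖h (r * ζ)‖ₑ ∂circleMeasure ≤ hardyNorm 1 h := by
  rw [hardyNorm_one]
  exact le_iSup₂ (f := fun (r : ℝ) (_ : r ∈ Ioo (0 : ℝ) 1) =>
    ∫⁻ ζ, ‖h (r * ζ)‖ₑ ∂circleMeasure) r hr

theorem enorm_le_hardyNorm_top (h : ℂ → ℂ) {z : ℂ} (hz : ‖z‖ < 1) : ‖h z‖ₑ ≤ hardyNorm ∞ h := by
  rw [hardyNorm_top]
  exact le_iSup₂ (f := fun (z : ℂ) (_ : z ∈ Metric.ball (0 : ℂ) 1) => ‖h z‖ₑ) z (by simpa using hz)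

theorem norm_mul_lt_one {r : ℝ} (hr : r ∈ Ioo (0 : ℝ) 1) {ζ : ℂ} (hζ : ‖ζ‖ ≤ 1) :
    ‖(r : ℂ) * ζ‖ < 1 := by
  rw [norm_mul, Complex.norm_real, Real.norm_of_nonneg hr.1.le]
  exact (mul_le_of_le_one_right hr.1.le hζ).trans_lt hr.2

theorem radius_mem (j : ℕ) : radius j ∈ Ioo (0 : ℝ) 1 := ⟨radius_pos j, radius_lt_one j⟩

/-- The dilation `z ↦ f (r * z)`, cut off outside the closed unit disk. -/
noncomputable def cutDilation (f : ℂ → ℂ) (r : ℝ) : ℂ → ℂ :=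
  (Metric.closedBall (0 : ℂ) 1).indicator fun z => f (r * z)

theorem cutDilation_eq (f : ℂ → ℂ) (r : ℝ) {z : ℂ} (hz : ‖z‖ ≤ 1) :
    cutDilation f r z = f (r * z) := indicator_of_mem (by simpa using hz) _

theorem continuousOn_dilation {f : ℂ → ℂ} (hf : ContinuousOn f (Metric.ball 0 1)) {r : ℝ}
    (hr : r ∈ Ioo (0 : ℝ) 1) : ContinuousOn (fun z => f (r * z)) (Metric.closedBall 0 1) :=
  hf.comp (by fun_prop) fun z hz => by
    simpa using norm_mul_lt_one hr (show ‖z‖ ≤ 1 by simpa using hz)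

theorem measurable_cutDilation {f : ℂ → ℂ} (hf : ContinuousOn f (Metric.ball 0 1)) {r : ℝ}
    (hr : r ∈ Ioo (0 : ℝ) 1) : Measurable (cutDilation f r) := by
  classical
  rw [cutDilation, ← piecewise_eq_indicator]
  exact (continuousOn_dilation hf hr).measurable_piecewise continuousOn_const
    Metric.isClosed_closedBall.measurableSet

@[fun_prop]
theorem measurable_dirichletSum (N : ℕ) : Measurable (dirichletSum N) :=
  (continuous_dirichletSum N).measurable

@[fun_prop]
theorem measurable_cesaroSum (a : ℕ → ℂ) (N : ℕ) : Measurable (cesaroSum a N) :=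
  (continuous_cesaroSum a N).measurable

theorem lintegral_enorm_dirichletSum_sq (N : ℕ) :
    ∫⁻ ζ, ‖dirichletSum N ζ‖ₑ ^ 2 ∂circleMeasure = N := by
  have h := ofReal_integral_eq_lintegral_ofReal (integrable_norm_dirichletSum_sq N)
    (Eventually.of_forall fun ζ => by positivity)
  rw [integral_norm_dirichletSum_sq, ENNReal.ofReal_natCast] at h
  rw [h]
  congr 1; ext ζ
  rw [ENNReal.ofReal_pow (norm_nonneg _), ofReal_norm]

/-- Convolution with `|D_N|²`, of mass `N`: Tonelli and rotation invariance give the bound on each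
circle of radius `r < 1`, and Fatou's lemma passes to `r = 1`. -/
theorem lintegral_enorm_cesaroSum_le {f : ℂ → ℂ} {a : ℕ → ℂ}
    (hf : ∀ z, ‖z‖ < 1 → HasSum (fun n => a n * z ^ n) (f z))
    (hfc : ContinuousOn f (Metric.ball 0 1)) (N : ℕ) :
    ∫⁻ ζ, ‖cesaroSum a N ζ‖ₑ ∂circleMeasure ≤ N * hardyNorm 1 f := by
  have hr : ∀ r ∈ Ioo (0 : ℝ) 1, ∫⁻ η, ‖cesaroSum a N (r * η)‖ₑ ∂circleMeasure ≤
      N * hardyNorm 1 f := by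
    intro r hr
    have hm := measurable_cutDilation hfc hr
    calc ∫⁻ η, ‖cesaroSum a N (r * η)‖ₑ ∂circleMeasure
        ≤ ∫⁻ η, ∫⁻ ζ, ‖cutDilation f r (η * ζ)‖ₑ * ‖dirichletSum N ζ‖ₑ ^ 2 ∂circleMeasure
            ∂circleMeasure := by
          refine lintegral_mono_ae (ae_circleMeasure_of_forall fun η hη => ?_)
          rw [cesaroSum_eq_integral hf N (norm_mul_lt_one hr hη.le)]
          refine (enorm_integral_le_lintegral_enorm _).trans_eq (lintegral_congr_ae ?_)
          refine ae_circleMeasure_of_forall fun ζ hζ => ?_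
          dsimp only
          rw [cutDilation_eq f r (z := η * ζ) (by simp [hη, hζ]), enorm_mul, enorm_mul, mul_assoc, sq]
          congr 2
          rw [← ofReal_norm, RCLike.norm_conj, ofReal_norm]
      _ = ∫⁻ ζ, ∫⁻ η, ‖cutDilation f r (η * ζ)‖ₑ * ‖dirichletSum N ζ‖ₑ ^ 2 ∂circleMeasure
            ∂circleMeasure := lintegral_lintegral_swap (Measurable.aemeasurable (by fun_prop))
      _ ≤ ∫⁻ ζ, hardyNorm 1 f * ‖dirichletSum N ζ‖ₑ ^ 2 ∂circleMeasure := by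
          refine lintegral_mono_ae (ae_circleMeasure_of_forall fun ζ hζ => ?_)
          rw [lintegral_mul_const _ (by fun_prop)]
          gcongr
          simp only [mul_comm _ ζ]
          rw [lintegral_rotate (g := fun z => ‖cutDilation f r z‖ₑ) (by fun_prop) hζ]
          refine le_trans (lintegral_mono_ae ?_) (lintegral_le_hardyNorm_one f hr)
          exact ae_circleMeasure_of_forall fun η hη => by rw [cutDilation_eq f r hη.le]
      _ = N * hardyNorm 1 f := by
          rw [lintegral_const_mul _ (by fun_prop), lintegral_enorm_dirichletSum_sq, mul_comm]
  refine (lintegral_mono_ae (g := fun η => liminf (fun j => ‖cesaroSum a N (radius j * η)‖ₑ) atTop)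
    (Eventually.of_forall fun η => ?_)).trans ((lintegral_liminf_le fun j => by fun_prop).trans
      (liminf_le_of_le (by isBoundedDefault) fun b hb => ?_))
  · have h1 : Tendsto (fun j => (radius j : ℂ) * η) atTop (𝓝 η) := by
      have := ((Complex.continuous_ofReal.tendsto 1).comp tendsto_radius).mul_const η
      rwa [Complex.ofReal_one, one_mul] at this
    have h2 : Continuous fun z => ‖cesaroSum a N z‖ₑ := by fun_prop
    exact ((h2.tendsto η).comp h1).liminf_eq.ge
  · obtain ⟨j, hj⟩ := hb.exists
    exact hj.trans (hr _ (radius_mem j))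

/-- The Cesàro means of a power series as polynomials. -/
noncomputable def cesaroPolynomial (a : ℕ → ℂ) (N : ℕ) : Polynomial ℂ :=
  Polynomial.C (N : ℂ)⁻¹ * ∑ n ∈ Finset.range N, Polynomial.C (((N - n : ℕ) : ℂ) * a n) *
    Polynomial.X ^ n

theorem eval_cesaroPolynomial (a : ℕ → ℂ) (N : ℕ) (z : ℂ) :
    (cesaroPolynomial a N).eval z = (N : ℂ)⁻¹ * cesaroSum a N z := by
  simp [cesaroPolynomial, cesaroSum, Polynomial.eval_finsetSum]

theorem cesaroSum_eq_sum (a : ℕ → ℂ) (N : ℕ) (z : ℂ) :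
    cesaroSum a N z = ∑ m ∈ Finset.range N, ∑ n ∈ Finset.range (m + 1), a n * z ^ n := by
  induction N with
  | zero => simp [cesaroSum]
  | succ N ih =>
    rw [Finset.sum_range_succ, ← ih, cesaroSum, cesaroSum, Finset.sum_range_succ,
      Finset.sum_range_succ, ← add_assoc, ← Finset.sum_add_distrib]
    congr 1
    · refine Finset.sum_congr rfl fun n hn => ?_
      rw [Nat.succ_sub (Finset.mem_range.mp hn).le]
      push_cast
      ring
    · simp

theorem tendsto_eval_cesaroPolynomial {a : ℕ → ℂ} {z w : ℂ} (h : HasSum (fun n => a n * z ^ n) w) :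
    Tendsto (fun N => (cesaroPolynomial a N).eval z) atTop (𝓝 w) := by
  simp only [eval_cesaroPolynomial, cesaroSum_eq_sum]
  have h1 := (h.tendsto_sum_nat.comp (tendsto_add_atTop_nat 1)).cesaro_smul
  refine h1.congr fun N => ?_
  simp [Function.comp, Complex.real_smul]

theorem integral_cesaroPolynomial_le {f : ℂ → ℂ} {a : ℕ → ℂ}
    (hf : ∀ z, ‖z‖ < 1 → HasSum (fun n => a n * z ^ n) (f z))
    (hfc : ContinuousOn f (Metric.ball 0 1)) (hfin : hardyNorm 1 f < ∞) (N : ℕ) :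
    ∫ ζ, ‖(cesaroPolynomial a N).eval ζ‖ ∂circleMeasure ≤ (hardyNorm 1 f).toReal := by
  rw [integral_norm_eq_lintegral_enorm (Continuous.aestronglyMeasurable (by fun_prop))]
  refine ENNReal.toReal_mono hfin.ne ?_
  simp only [eval_cesaroPolynomial, enorm_mul]
  rw [lintegral_const_mul _ (by fun_prop)]
  rcases Nat.eq_zero_or_pos N with rfl | hN
  · simp
  · refine (mul_le_mul_right (lintegral_enorm_cesaroSum_le hf hfc N) _).trans_eq ?_
    rw [← mul_assoc]
    have : ‖(N : ℂ)⁻¹‖ₑ * (N : ℝ≥0∞) = 1 := by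
      rw [enorm_inv (by exact_mod_cast hN.ne'), ← ofReal_norm, Complex.norm_natCast,
        ENNReal.ofReal_natCast]
      exact ENNReal.inv_mul_cancel (by exact_mod_cast hN.ne') (ENNReal.natCast_ne_top N)
    rw [this, one_mul]

theorem tendsto_powerSeries_of_bounded {c : ℕ → ℕ → ℂ} {d : ℕ → ℂ} {C : ℝ}
    (hc : ∀ k n, ‖c k n‖ ≤ C) (hcd : Tendsto c atTop (𝓝 d)) {z : ℂ} (hz : ‖z‖ < 1) :
    Tendsto (fun k => ∑' n, c k n * z ^ n) atTop (𝓝 (∑' n, d n * z ^ n)) := by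
  refine tendsto_tsum_of_dominated_convergence (bound := fun n => C * ‖z‖ ^ n)
    ((summable_geometric_of_lt_one (norm_nonneg z) hz).mul_left C) (fun n => ?_)
    (Eventually.of_forall fun k n => ?_)
  · exact (tendsto_pi_nhds.mp hcd n).mul_const _
  · rw [norm_mul, norm_pow]
    gcongr
    exact hc k n

/-- Every function in `H¹` is a product of two functions in `H²`. -/
theorem exists_factorization_h1 {f : ℂ → ℂ} (hf : f ∈ HardySpace 1) :
    ∃ a g : ℕ → ℂ, (Summable fun n => ‖a n‖ ^ 2) ∧ (Summable fun n => ‖g n‖ ^ 2) ∧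
      ∀ z, ‖z‖ < 1 → f z = (∑' n, a n * z ^ n) * ∑' n, g n * z ^ n := by
  have hd : DifferentiableOn ℂ f (Metric.ball 0 1) := hf.1.differentiableOn
  set B := (hardyNorm 1 f).toReal
  have hfac := fun N => exists_factor_polynomial (cesaroPolynomial (taylorCoeff f) N)
    (integral_cesaroPolynomial_le (hasSum_taylorCoeff hd) hd.continuousOn hf.2 N)
  choose a ha g hg hag using hfac
  -- The two factors of every Cesàro polynomial have coefficients in one compact set, so a common
  -- subsequence converges coordinatewise. The coefficients stay bounded, hence the power series
  -- converge pointwise in the disk.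
  obtain ⟨⟨a', g'⟩, hmem, φ, hφ, hlim⟩ :=
    ((isCompact_squareBounded B).prod (isCompact_squareBounded B)).tendsto_subseq
      (x := fun N => (a N, g N)) fun N => ⟨ha N, hg N⟩
  refine ⟨a', g', summable_of_mem_squareBounded hmem.1, summable_of_mem_squareBounded hmem.2,
    fun z hz => ?_⟩
  have h1 : Tendsto (fun k => a (φ k)) atTop (𝓝 a') := (continuous_fst.tendsto _).comp hlim
  have h2 : Tendsto (fun k => g (φ k)) atTop (𝓝 g') := (continuous_snd.tendsto _).comp hlim
  have h3 := (tendsto_powerSeries_of_bounded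
    (fun k => norm_le_of_mem_squareBounded (ha (φ k))) h1 hz).mul
    (tendsto_powerSeries_of_bounded (fun k => norm_le_of_mem_squareBounded (hg (φ k))) h2 hz)
  have h4 := (tendsto_eval_cesaroPolynomial (hasSum_taylorCoeff hd z hz)).comp hφ.tendsto_atTop
  refine tendsto_nhds_unique h4 (h3.congr fun k => ?_)
  exact (hag (φ k) z hz).symm

/-! ### Boundary values and Cauchy's formula in `H¹` -/

theorem aestronglyMeasurable_dilation {f : ℂ → ℂ} (hf : ContinuousOn f (Metric.ball 0 1)) {r : ℝ}
    (hr : r ∈ Ioo (0 : ℝ) 1) : AEStronglyMeasurable (fun ζ => f (r * ζ)) circleMeasure :=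
  aestronglyMeasurable_of_continuousOn (continuousOn_dilation hf hr)

/-- Boundary values of functions in `H¹`: they exist almost everywhere as radial limits, and the
dilations converge to them in the mean. -/
theorem exists_boundary_h1 {f : ℂ → ℂ} (hf : f ∈ HardySpace 1) :
    Integrable (boundaryValue f) circleMeasure ∧
      Tendsto (fun j => ∫⁻ ζ, ‖f (radius j * ζ) - boundaryValue f ζ‖ₑ ∂circleMeasure) atTop (𝓝 0) ∧
      ∀ᵐ ζ ∂circleMeasure, Tendsto (fun r : ℝ => f (r * ζ)) (𝓝[<] 1) (𝓝 (boundaryValue f ζ)) := by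
  obtain ⟨a, g, ha, hg, hag⟩ := exists_factorization_h1 hf
  obtain ⟨u, hu, hul, hur⟩ := exists_boundary_h2 ha
  obtain ⟨v, hv, hvl, hvr⟩ := exists_boundary_h2 hg
  have hr : ∀ᵐ ζ ∂circleMeasure, Tendsto (fun r : ℝ => f (r * ζ)) (𝓝[<] 1) (𝓝 (u ζ * v ζ)) := by
    filter_upwards [hur, hvr, ae_norm_eq_one] with ζ h1 h2 h3
    refine (h1.mul h2).congr' ?_
    filter_upwards [Ioo_mem_nhdsLT (show (0 : ℝ) < 1 by norm_num)] with r hr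
    exact (hag _ (norm_mul_lt_one hr h3.le)).symm
  have hb : ∀ᵐ ζ ∂circleMeasure, boundaryValue f ζ = u ζ * v ζ := by
    filter_upwards [hr] with ζ h using h.limUnder_eq
  have hi : Integrable (fun ζ => u ζ * v ζ) circleMeasure := hu.integrable_mul hv
  have hcont : ∀ {c : ℕ → ℂ}, (Summable fun n => ‖c n‖ ^ 2) →
      ContinuousOn (fun z => ∑' n, c n * z ^ n) (Metric.ball 0 1) := by
    intro c hc z hz
    obtain ⟨C, hC⟩ := bounded_of_summable_sq hc
    exact (hasDerivAt_powerSeries hC (by simpa using hz)).continuousAt.continuousWithinAt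
  refine ⟨hi.congr (by filter_upwards [hb] with ζ h using h.symm), ?_, ?_⟩
  · set U : ℕ → ℂ → ℂ := fun j ζ => (∑' n, a n * (radius j * ζ) ^ n) - u ζ with hU
    set V : ℕ → ℂ → ℂ := fun j ζ => (∑' n, g n * (radius j * ζ) ^ n) - v ζ with hV
    have hUm : ∀ j, AEStronglyMeasurable (U j) circleMeasure := fun j =>
      (aestronglyMeasurable_dilation (hcont ha) (radius_mem j)).sub hu.1
    have hVm : ∀ j, AEStronglyMeasurable (V j) circleMeasure := fun j =>
      (aestronglyMeasurable_dilation (hcont hg) (radius_mem j)).sub hv.1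
    -- Expands `(U + u) (V + v) - u v = U V + U v + u V` and applies Hölder's inequality to each
    -- product.
    have hle : ∀ j, ∫⁻ ζ, ‖f (radius j * ζ) - boundaryValue f ζ‖ₑ ∂circleMeasure ≤
        eLpNorm (U j) 2 circleMeasure * eLpNorm (V j) 2 circleMeasure +
        eLpNorm (U j) 2 circleMeasure * eLpNorm v 2 circleMeasure +
        eLpNorm u 2 circleMeasure * eLpNorm (V j) 2 circleMeasure := by
      intro j
      have h1 : ∀ᵐ ζ ∂circleMeasure, ‖f (radius j * ζ) - boundaryValue f ζ‖ₑ ≤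
          ‖(U j • V j) ζ‖ₑ + ‖(U j • v) ζ‖ₑ + ‖(u • V j) ζ‖ₑ := by
        filter_upwards [hb, ae_norm_eq_one] with ζ h1 h2
        rw [h1, hag _ (norm_mul_lt_one (radius_mem j) h2.le)]
        refine le_trans (le_of_eq ?_) ((enorm_add_le _ _).trans
          (add_le_add_left (enorm_add_le _ _) _))
        congr 1
        simp only [hU, hV, Pi.smul_apply', smul_eq_mul]
        ring
      refine (lintegral_mono_ae h1).trans ?_
      rw [lintegral_add_right' _ (hu.1.smul (hVm j)).enorm,
        lintegral_add_left' ((hUm j).smul (hVm j)).enorm]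
      simp only [← eLpNorm_one_eq_lintegral_enorm]
      gcongr
      · exact eLpNorm_smul_le_mul_eLpNorm (hVm j) (hUm j)
      · exact eLpNorm_smul_le_mul_eLpNorm hv.1 (hUm j)
      · exact eLpNorm_smul_le_mul_eLpNorm (hVm j) hu.1
    refine tendsto_of_tendsto_of_tendsto_of_le_of_le tendsto_const_nhds ?_ (fun _ => zero_le) hle
    have e1 := ENNReal.Tendsto.mul hul (Or.inr ENNReal.zero_ne_top) hvl
      (Or.inr ENNReal.zero_ne_top)
    have e2 := ENNReal.Tendsto.mul_const (b := eLpNorm v 2 circleMeasure) hul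
      (Or.inr hv.eLpNorm_ne_top)
    have e3 := ENNReal.Tendsto.const_mul (a := eLpNorm u 2 circleMeasure) hvl
      (Or.inr hu.eLpNorm_ne_top)
    simpa using (e1.add e2).add e3
  · filter_upwards [hr, hb] with ζ h1 h2
    rwa [h2]

theorem lintegral_boundaryValue_le {f : ℂ → ℂ} (hf : f ∈ HardySpace 1) :
    ∫⁻ ζ, ‖boundaryValue f ζ‖ₑ ∂circleMeasure ≤ hardyNorm 1 f := by
  obtain ⟨hi, hl, -⟩ := exists_boundary_h1 hf
  have hm := fun j => aestronglyMeasurable_dilation hf.1.continuousOn (radius_mem j)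
  have h1 : ∀ j, ∫⁻ ζ, ‖boundaryValue f ζ‖ₑ ∂circleMeasure ≤
      (∫⁻ ζ, ‖f (radius j * ζ) - boundaryValue f ζ‖ₑ ∂circleMeasure) + hardyNorm 1 f := by
    intro j
    refine le_trans ?_ (add_le_add_right (lintegral_le_hardyNorm_one f (radius_mem j)) _)
    rw [← lintegral_add_right' _ (hm j).enorm]
    refine lintegral_mono fun ζ => ?_
    rw [← enorm_neg (f (radius j * ζ) - boundaryValue f ζ)]
    refine le_trans (le_of_eq ?_) (enorm_add_le _ _)
    congr 1
    ring
  have h2 := hl.add_const (hardyNorm 1 f)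
  rw [zero_add] at h2
  exact ge_of_tendsto' h2 h1

theorem cauchyKernel_bound {z : ℂ} (hz : ‖z‖ < 1) {ζ : ℂ} (hζ : ‖ζ‖ = 1) :
    ‖1 / (1 - conj ζ * z)‖ ≤ 1 / (1 - ‖z‖) := by
  rw [norm_div, norm_one]
  have h1 : 1 - ‖z‖ ≤ ‖1 - conj ζ * z‖ := by
    have := norm_sub_norm_le (1 : ℂ) (conj ζ * z)
    simpa [hζ] using this
  have h2 : 0 < 1 - ‖z‖ := by linarith
  gcongr

theorem measurable_cauchyKernel (z : ℂ) : Measurable fun ζ : ℂ => 1 / (1 - conj ζ * z) := by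
  fun_prop

theorem integral_pow_mul_cauchyKernel {z : ℂ} (hz : ‖z‖ < 1) (n : ℕ) :
    ∫ ζ, ζ ^ n * (1 / (1 - conj ζ * z)) ∂circleMeasure = z ^ n := by
  have hw : ‖conj z‖ < 1 := by simpa using hz
  have hc : Summable fun n => ‖conj z ^ n‖ := by
    simpa using summable_geometric_of_lt_one (norm_nonneg _) hz
  have h := integral_powerSeries_mul_conj_pow hc n
  have h2 : ∫ ζ, ζ ^ n * (1 / (1 - conj ζ * z)) ∂circleMeasure =
      conj (∫ ζ, (∑' n, conj z ^ n * ζ ^ n) * conj ζ ^ n ∂circleMeasure) := by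
    rw [← integral_conj]
    refine integral_congr_ae (ae_circleMeasure_of_forall fun ζ hζ => ?_)
    simp only [← mul_pow]
    rw [tsum_geometric_of_norm_lt_one (by simpa [hζ] using hz)]
    simp only [map_mul, map_inv₀, map_sub, map_one, map_pow, Complex.conj_conj]
    rw [one_div, mul_comm z]
    ring
  rw [h2, h]
  simp

/-- Cauchy's formula for the boundary values of a function in `H¹`. -/
theorem cauchy_formula_h1 {f : ℂ → ℂ} (hf : f ∈ HardySpace 1) {z : ℂ} (hz : ‖z‖ < 1) :
    ∫ ζ, boundaryValue f ζ * (1 / (1 - conj ζ * z)) ∂circleMeasure = f z := by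
  obtain ⟨hi, hl, -⟩ := exists_boundary_h1 hf
  have hd : DifferentiableOn ℂ f (Metric.ball 0 1) := hf.1.differentiableOn
  have hm := fun j => aestronglyMeasurable_dilation hd.continuousOn (radius_mem j)
  have hk : Integrable (fun ζ => 1 / (1 - conj ζ * z)) circleMeasure :=
    integrable_of_bounded (measurable_cauchyKernel z).aestronglyMeasurable
      fun ζ hζ => cauchyKernel_bound hz hζ
  -- A dilation has an absolutely convergent series on the circle, so its Cauchy formula holds
  -- termwise. For fixed `z` the kernel is bounded, and mean convergence of dilations gives the
  -- limit.
  have h1 : ∀ j, HasSum (fun n => taylorCoeff f n * (radius j * z) ^ n)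
      (∫ ζ, f (radius j * ζ) * (1 / (1 - conj ζ * z)) ∂circleMeasure) := by
    intro j
    have hs := (hasSum_taylorCoeff hd (radius j)
      (by simpa using norm_mul_lt_one (radius_mem j) (ζ := 1) (by simp))).summable.norm
    have := hasSum_integral_powerSeries_mul hs hk
    simp only [integral_pow_mul_cauchyKernel hz] at this
    convert this using 1
    · ext n; rw [mul_pow, mul_assoc]
    · refine integral_congr_ae (ae_circleMeasure_of_forall fun ζ hζ => ?_)
      have h2 := (hasSum_taylorCoeff hd _ (norm_mul_lt_one (radius_mem j) hζ.le)).tsum_eq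
      simp only [mul_pow, ← mul_assoc] at h2
      simp only [h2]
  have h2 : ∀ j, ∫ ζ, f (radius j * ζ) * (1 / (1 - conj ζ * z)) ∂circleMeasure =
      f (radius j * z) := fun j =>
    (h1 j).unique (hasSum_taylorCoeff hd _ (norm_mul_lt_one (radius_mem j) hz.le))
  have h3 : Tendsto (fun j => ∫ ζ, f (radius j * ζ) * (1 / (1 - conj ζ * z)) ∂circleMeasure) atTop
      (𝓝 (∫ ζ, boundaryValue f ζ * (1 / (1 - conj ζ * z)) ∂circleMeasure)) := by
    have hbd : ∀ {φ : ℂ → ℂ}, AEStronglyMeasurable φ circleMeasure →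
        AEStronglyMeasurable (fun ζ => φ ζ * (1 / (1 - conj ζ * z))) circleMeasure := fun hφ =>
      hφ.mul hk.1
    refine tendsto_integral_of_L1 _ (hbd hi.1) (Eventually.of_forall fun j => ?_) ?_
    · obtain ⟨K, hK⟩ := (isCompact_closedBall (0 : ℂ) 1).exists_bound_of_continuousOn
        (continuousOn_dilation hd.continuousOn (radius_mem j))
      exact hk.bdd_mul (hm j) (ae_circleMeasure_of_forall fun ζ hζ => hK ζ (by simp [hζ]))
    · refine tendsto_of_tendsto_of_tendsto_of_le_of_le
        (h := fun j => (∫⁻ ζ, ‖f (radius j * ζ) - boundaryValue f ζ‖ₑ ∂circleMeasure) *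
          ENNReal.ofReal (1 / (1 - ‖z‖))) tendsto_const_nhds ?_ (fun _ => zero_le) fun j => ?_
      · have := ENNReal.Tendsto.mul_const (b := ENNReal.ofReal (1 / (1 - ‖z‖))) hl
          (Or.inr ENNReal.ofReal_ne_top)
        rwa [zero_mul] at this
      · dsimp only
        have h5 : AEStronglyMeasurable (fun ζ => f (radius j * ζ) - boundaryValue f ζ)
            circleMeasure := (hm j).sub hi.1
        rw [← lintegral_mul_const'' _ h5.enorm]
        refine lintegral_mono_ae (ae_circleMeasure_of_forall fun ζ hζ => ?_)
        rw [← sub_mul, enorm_mul, ← ofReal_norm (1 / (1 - conj ζ * z))]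
        gcongr
        exact cauchyKernel_bound hz hζ
  simp only [h2] at h3
  have h4 : Tendsto (fun j => f (radius j * z)) atTop (𝓝 (f z)) := by
    have h5 : Tendsto (fun j => (radius j : ℂ) * z) atTop (𝓝 z) := by
      have := ((Complex.continuous_ofReal.tendsto 1).comp tendsto_radius).mul_const z
      rwa [Complex.ofReal_one, one_mul] at this
    exact (hf.1 z (by simpa using hz)).continuousAt.tendsto.comp h5
  exact tendsto_nhds_unique h3 h4

theorem hardyNorm_one_le_top (f : ℂ → ℂ) : hardyNorm 1 f ≤ hardyNorm ∞ f := by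
  rw [hardyNorm_one]
  refine iSup₂_le fun r hr => ?_
  calc ∫⁻ ζ, ‖f (r * ζ)‖ₑ ∂circleMeasure ≤ ∫⁻ _, hardyNorm ∞ f ∂circleMeasure :=
        lintegral_mono_ae (ae_circleMeasure_of_forall fun ζ hζ =>
          enorm_le_hardyNorm_top f (norm_mul_lt_one hr hζ.le))
    _ = hardyNorm ∞ f := by simp

theorem hardySpace_top_subset_one : HardySpace ∞ ⊆ HardySpace 1 := fun f hf =>
  ⟨hf.1, (hardyNorm_one_le_top f).trans_lt hf.2⟩

/-- Expanding the kernel in a geometric series gives a power series with coefficients bounded by the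
`L¹` norm of `φ`. -/
theorem differentiableOn_cauchyTransform {φ : ℂ → ℂ} (hφ : Integrable φ circleMeasure) :
    DifferentiableOn ℂ (fun z => ∫ ζ, φ ζ / (1 - conj ζ * z) ∂circleMeasure) (Metric.ball 0 1) := by
  have hφc : Integrable (fun ζ => conj (φ ζ)) circleMeasure :=
    Complex.conjCLE.integrable_comp_iff.mpr hφ
  set c : ℕ → ℂ := fun n => conj (∫ ζ, ζ ^ n * conj (φ ζ) ∂circleMeasure) with hc
  have hcb : ∀ n, ‖c n‖ ≤ ∫ ζ, ‖φ ζ‖ ∂circleMeasure := by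
    intro n
    rw [hc, RCLike.norm_conj]
    refine norm_integral_le_of_norm_le hφ.norm (ae_circleMeasure_of_forall fun ζ hζ => ?_)
    simp [hζ]
  have heq : ∀ z, ‖z‖ < 1 → ∫ ζ, φ ζ / (1 - conj ζ * z) ∂circleMeasure = ∑' n, c n * z ^ n := by
    intro z hz
    have hs : Summable fun n => ‖conj z ^ n‖ := by
      simpa using summable_geometric_of_lt_one (norm_nonneg _) hz
    have h := (hasSum_integral_powerSeries_mul hs hφc).tsum_eq
    have h2 : ∫ ζ, φ ζ / (1 - conj ζ * z) ∂circleMeasure =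
        conj (∫ ζ, (∑' n, conj z ^ n * ζ ^ n) * conj (φ ζ) ∂circleMeasure) := by
      rw [← integral_conj]
      refine integral_congr_ae (ae_circleMeasure_of_forall fun ζ hζ => ?_)
      simp only [← mul_pow]
      rw [tsum_geometric_of_norm_lt_one (by simpa [hζ] using hz)]
      simp only [map_mul, map_inv₀, map_sub, map_one, Complex.conj_conj]
      rw [div_eq_mul_inv, mul_comm z, mul_comm]
    rw [h2, ← h, Complex.conj_tsum]
    congr 1; ext n
    simp [hc, mul_comm]
  refine DifferentiableOn.congr (f := fun z => ∑' n, c n * z ^ n) (fun z hz => ?_)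
    fun z hz => heq z (by simpa using hz)
  exact (hasDerivAt_powerSeries hcb (by simpa using hz)).differentiableAt.differentiableWithinAt

/-! ### Boundedness of the Toeplitz operator -/

/-- Triangle inequality through `r η`: its distance to `η` is `1 - r`, which is at most its distance
to `ζ`. -/
theorem norm_sub_le_two_mul {r : ℝ} (hr : r ∈ Ico (0 : ℝ) 1) {ζ η : ℂ} (hζ : ‖ζ‖ = 1)
    (hη : ‖η‖ = 1) : ‖ζ - η‖ ≤ 2 * ‖1 - conj ζ * (r * η)‖ := by
  have h1 : ‖1 - conj ζ * (r * η)‖ = ‖ζ - r * η‖ := by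
    have h2 : ζ * conj ζ = 1 := by rw [mul_conj_eq_norm_sq, hζ]; simp
    have h3 : ζ - r * η = ζ * (1 - conj ζ * (r * η)) := by
      linear_combination (r * η) * h2
    rw [h3, norm_mul, hζ, one_mul]
  have h2 : ‖r * η - η‖ = 1 - r := by
    rw [show (r : ℂ) * η - η = -(((1 - r : ℝ) : ℂ) * η) by push_cast; ring, norm_neg, norm_mul, hη,
      Complex.norm_real, Real.norm_of_nonneg (by linarith [hr.2]), mul_one]
  have h3 : 1 - r ≤ ‖ζ - r * η‖ := by
    have := norm_sub_norm_le ζ (r * η)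
    simpa [hζ, hη, abs_of_nonneg hr.1] using this
  have h4 := norm_add_le (ζ - r * η) (r * η - η)
  rw [sub_add_sub_cancel] at h4
  rw [h1]
  linarith

/-- A continuous extension `G` of `g` to the closed disk, with bounds on the circle. -/
structure HasLambdaExtension (g G : ℂ → ℂ) (B K : ℝ≥0) : Prop where
  differentiableOn : DifferentiableOn ℂ G (Metric.ball 0 1)
  continuousOn : ContinuousOn G (Metric.closedBall 0 1)
  norm_le : ∀ z, ‖z‖ ≤ 1 → ‖G z‖ ≤ B
  lintegral_le : ∀ η : ℂ, ‖η‖ = 1 → ∫⁻ ζ, ‖G ζ - G η‖ₑ / ‖ζ - η‖ₑ ∂circleMeasure ≤ K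
  eq : ∀ z, ‖z‖ < 1 → g z = G z

namespace HasLambdaExtension

variable {g G h : ℂ → ℂ} {B K : ℝ≥0}

theorem boundaryValue_eq (hg : HasLambdaExtension g G B K) {ζ : ℂ} (hζ : ‖ζ‖ = 1) :
    boundaryValue g ζ = G ζ := boundaryValue_eq_of_continuousOn hg.continuousOn hg.eq hζ

theorem enorm_le (hg : HasLambdaExtension g G B K) {z : ℂ} (hz : ‖z‖ ≤ 1) : ‖G z‖ₑ ≤ B := by
  rw [← ofReal_norm, ← ENNReal.ofReal_coe_nnreal]
  exact ENNReal.ofReal_le_ofReal (hg.norm_le z hz)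

theorem mem_classN (hg : HasLambdaExtension g G B K) : g ∈ classN := by
  refine ⟨⟨?_, ?_⟩, ?_⟩
  · refine DifferentiableOn.analyticOnNhd (hg.differentiableOn.congr fun z hz => ?_)
      Metric.isOpen_ball
    exact hg.eq z (by simpa using hz)
  · rw [hardyNorm_top]
    refine lt_of_le_of_lt (iSup₂_le fun z hz => ?_) (ENNReal.coe_lt_top (r := B))
    have hz1 : ‖z‖ < 1 := by simpa using hz
    rw [hg.eq z hz1]
    exact hg.enorm_le hz1.le
  · refine lt_of_le_of_lt (essSup_le_of_ae_le (K : ℝ≥0∞) ?_) ENNReal.coe_lt_top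
    refine ae_circleMeasure_of_forall fun η hη => ?_
    refine le_trans (lintegral_mono_ae ?_) (hg.lintegral_le η hη)
    refine ae_circleMeasure_of_forall fun ζ hζ => ?_
    rw [hg.boundaryValue_eq hζ, hg.boundaryValue_eq hη]

theorem integrable_mul (hg : HasLambdaExtension g G B K) (hh : h ∈ HardySpace 1) :
    Integrable (fun ζ => conj (boundaryValue g ζ) * boundaryValue h ζ) circleMeasure := by
  have h1 : Integrable (fun ζ => conj (G ζ) * boundaryValue h ζ) circleMeasure := by
    refine (exists_boundary_h1 hh).1.bdd_mul (c := B) ?_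
      (ae_circleMeasure_of_forall fun ζ hζ => ?_)
    · exact Complex.continuous_conj.comp_aestronglyMeasurable
        (aestronglyMeasurable_of_continuousOn hg.continuousOn)
    · rw [RCLike.norm_conj]; exact hg.norm_le ζ hζ.le
  refine h1.congr (ae_circleMeasure_of_forall fun ζ hζ => ?_)
  dsimp only
  rw [hg.boundaryValue_eq hζ]

theorem analyticOnNhd_toeplitz (hg : HasLambdaExtension g G B K) (hh : h ∈ HardySpace 1) :
    AnalyticOnNhd ℂ (toeplitz g h) (Metric.ball 0 1) :=
  (differentiableOn_cauchyTransform (hg.integrable_mul hh)).analyticOnNhd Metric.isOpen_ball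

/-- Cauchy's formula for `h` removes the constant `conj (G η)` from the symbol. What remains has the
difference `G ζ - G η` to compensate the singularity of the Cauchy kernel, uniformly in `r`. -/
theorem enorm_toeplitz_le (hg : HasLambdaExtension g G B K) (hh : h ∈ HardySpace 1) {r : ℝ}
    (hr : r ∈ Ico (0 : ℝ) 1) {η : ℂ} (hη : ‖η‖ = 1) :
    ‖toeplitz g h (r * η)‖ₑ ≤
      2 * (∫⁻ ζ, ‖G ζ - G η‖ₑ / ‖ζ - η‖ₑ * ‖boundaryValue h ζ‖ₑ ∂circleMeasure) +
        B * ‖h (r * η)‖ₑ := by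
  have hz : ‖(r : ℂ) * η‖ < 1 := by simp [hη, abs_of_nonneg hr.1, hr.2]
  set z := (r : ℂ) * η with hzdef
  have hk : ∀ {φ : ℂ → ℂ}, Integrable φ circleMeasure →
      Integrable (fun ζ => φ ζ * (1 / (1 - conj ζ * z))) circleMeasure := fun hφ =>
    hφ.mul_bdd (c := 1 / (1 - ‖z‖)) (measurable_cauchyKernel z).aestronglyMeasurable
      (ae_circleMeasure_of_forall fun ζ hζ => cauchyKernel_bound hz hζ)
  have hi1 := hk (hg.integrable_mul hh)
  have hi2 := (hk (exists_boundary_h1 hh).1).const_mul (conj (G η))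
  have hsplit : toeplitz g h z =
      (∫ ζ, (conj (boundaryValue g ζ) * boundaryValue h ζ * (1 / (1 - conj ζ * z)) -
        conj (G η) * (boundaryValue h ζ * (1 / (1 - conj ζ * z)))) ∂circleMeasure) +
      conj (G η) * h z := by
    rw [integral_sub hi1 hi2, integral_const_mul, cauchy_formula_h1 hh hz, sub_add_cancel, toeplitz]
    simp only [mul_one_div]
  rw [hsplit]
  refine (enorm_add_le _ _).trans (add_le_add ?_ ?_)
  · refine (enorm_integral_le_lintegral_enorm _).trans ?_
    rw [← lintegral_const_mul' _ _ (by norm_num)]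
    refine lintegral_mono_ae (ae_circleMeasure_of_forall fun ζ hζ => ?_)
    rw [hg.boundaryValue_eq hζ]
    have h1 : conj (G ζ) * boundaryValue h ζ * (1 / (1 - conj ζ * z)) -
        conj (G η) * (boundaryValue h ζ * (1 / (1 - conj ζ * z))) =
        conj (G ζ - G η) * (1 / (1 - conj ζ * z)) * boundaryValue h ζ := by
      rw [map_sub]; ring
    rw [h1, enorm_mul, enorm_mul, ← mul_assoc 2]
    refine mul_le_mul' ?_ le_rfl
    have hD : 0 < ‖1 - conj ζ * z‖ := by
      have := norm_one_sub_mul_pos (w := z) (ζ := conj ζ) hz (by simp [hζ])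
      rwa [mul_comm]
    rw [← ofReal_norm (conj (G ζ - G η)), RCLike.norm_conj, ofReal_norm]
    rcases eq_or_ne ζ η with rfl | hne
    · simp
    have hpos : 0 < ‖ζ - η‖ := norm_pos_iff.mpr (sub_ne_zero.mpr hne)
    rw [← ofReal_norm, ← ofReal_norm, ← ofReal_norm, ← ENNReal.ofReal_div_of_pos hpos,
      ← ENNReal.ofReal_mul (norm_nonneg _), ← ENNReal.ofReal_ofNat 2,
      ← ENNReal.ofReal_mul (by norm_num)]
    refine ENNReal.ofReal_le_ofReal ?_
    rw [norm_div, norm_one, mul_one_div, ← mul_div_assoc, div_le_div_iff₀ hD hpos]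
    have := norm_sub_le_two_mul hr hζ hη
    calc ‖G ζ - G η‖ * ‖ζ - η‖ ≤ ‖G ζ - G η‖ * (2 * ‖1 - conj ζ * z‖) := by gcongr
      _ = _ := by ring
  · rw [enorm_mul, ← ofReal_norm (conj (G η)), RCLike.norm_conj, ofReal_norm]
    gcongr
    exact hg.enorm_le hη.le

theorem enorm_boundaryValue_le (hh : h ∈ HardySpace ∞) :
    ∀ᵐ ζ ∂circleMeasure, ‖boundaryValue h ζ‖ₑ ≤ hardyNorm ∞ h := by
  filter_upwards [(exists_boundary_h1 (hardySpace_top_subset_one hh)).2.2, ae_norm_eq_one]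
    with ζ h1 h2
  refine le_of_tendsto ((continuous_enorm.tendsto _).comp h1) ?_
  filter_upwards [Ioo_mem_nhdsLT (show (0 : ℝ) < 1 by norm_num)] with r hr
  exact enorm_le_hardyNorm_top h (norm_mul_lt_one hr h2.le)

theorem toeplitzBoundedOn_top (hg : HasLambdaExtension g G B K) : ToeplitzBoundedOn ∞ g := by
  refine ⟨2 * K + B, fun h hh => ?_⟩
  have hh1 := hardySpace_top_subset_one hh
  have hle : hardyNorm ∞ (toeplitz g h) ≤ ((2 * K + B : ℝ≥0) : ℝ≥0∞) * hardyNorm ∞ h := by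
    rw [hardyNorm_top (toeplitz g h)]
    refine iSup₂_le fun z hz => ?_
    have hz1 : ‖z‖ < 1 := by simpa using hz
    -- The origin is included, with radius zero; hence the half-open range of `r` in
    -- `enorm_toeplitz_le`.
    obtain ⟨η, hη, hzη⟩ : ∃ η : ℂ, ‖η‖ = 1 ∧ z = (‖z‖ : ℂ) * η :=
      ⟨Complex.exp (z.arg * Complex.I), Complex.norm_exp_ofReal_mul_I _,
        (Complex.norm_mul_exp_arg_mul_I z).symm⟩
    have h1 := hg.enorm_toeplitz_le hh1 ⟨norm_nonneg z, hz1⟩ hη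
    rw [← hzη] at h1
    refine h1.trans ?_
    have h2 : ∫⁻ ζ, ‖G ζ - G η‖ₑ / ‖ζ - η‖ₑ * ‖boundaryValue h ζ‖ₑ ∂circleMeasure ≤
        K * hardyNorm ∞ h := by
      refine (lintegral_mono_ae (g := fun ζ => ‖G ζ - G η‖ₑ / ‖ζ - η‖ₑ * hardyNorm ∞ h) ?_).trans ?_
      · filter_upwards [enorm_boundaryValue_le hh] with ζ hζ
        gcongr
      · rw [lintegral_mul_const' _ _ hh.2.ne]
        gcongr
        exact hg.lintegral_le η hη
    have h3 := enorm_le_hardyNorm_top h hz1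
    calc _ ≤ 2 * (K * hardyNorm ∞ h) + B * hardyNorm ∞ h := by gcongr
      _ = _ := by push_cast; ring
  exact ⟨hg.integrable_mul hh1, ⟨hg.analyticOnNhd_toeplitz hh1,
    hle.trans_lt (ENNReal.mul_lt_top ENNReal.coe_lt_top hh.2)⟩, hle⟩

/-- The kernel is symmetric in `ζ` and `η`, so after Tonelli the inner integral is again bounded by
`K`. -/
theorem lintegral_toeplitz_le (hg : HasLambdaExtension g G B K) (hh : h ∈ HardySpace 1) :
    ∫⁻ η, ∫⁻ ζ, ‖G ζ - G η‖ₑ / ‖ζ - η‖ₑ * ‖boundaryValue h ζ‖ₑ ∂circleMeasure ∂circleMeasure ≤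
      K * hardyNorm 1 h := by
  classical
  have hi := (exists_boundary_h1 hh).1
  -- Tonelli needs joint measurability: `boundaryValue h` is replaced by a measurable
  -- representative, and `G` is cut off outside the closed disk, where nothing is known about it.
  set H := hi.1.mk (boundaryValue h) with hH
  have hHm : Measurable H := hi.1.stronglyMeasurable_mk.measurable
  have hHe : boundaryValue h =ᵐ[circleMeasure] H := hi.1.ae_eq_mk
  set G₀ : ℂ → ℂ := (Metric.closedBall (0 : ℂ) 1).indicator G with hG₀
  have hGm : Measurable G₀ := by
    rw [hG₀, ← piecewise_eq_indicator]
    exact hg.continuousOn.measurable_piecewise continuousOn_const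
      Metric.isClosed_closedBall.measurableSet
  have hGe : ∀ ζ : ℂ, ‖ζ‖ = 1 → G ζ = G₀ ζ := fun ζ hζ => by
    rw [hG₀, indicator_of_mem (by simp [hζ])]
  calc _ = ∫⁻ η, ∫⁻ ζ, ‖G₀ ζ - G₀ η‖ₑ / ‖ζ - η‖ₑ * ‖H ζ‖ₑ ∂circleMeasure ∂circleMeasure := by
        refine lintegral_congr_ae (ae_circleMeasure_of_forall fun η hη => ?_)
        refine lintegral_congr_ae ?_
        filter_upwards [hHe, ae_norm_eq_one] with ζ h1 h2
        rw [h1, hGe ζ h2, hGe η hη]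
    _ = ∫⁻ ζ, ∫⁻ η, ‖G₀ ζ - G₀ η‖ₑ / ‖ζ - η‖ₑ * ‖H ζ‖ₑ ∂circleMeasure ∂circleMeasure :=
        lintegral_lintegral_swap (Measurable.aemeasurable (by fun_prop))
    _ ≤ ∫⁻ ζ, K * ‖H ζ‖ₑ ∂circleMeasure := by
        refine lintegral_mono_ae (ae_circleMeasure_of_forall fun ζ hζ => ?_)
        rw [lintegral_mul_const _ (by fun_prop)]
        gcongr
        refine le_trans (le_of_eq ?_) (hg.lintegral_le ζ hζ)
        refine lintegral_congr_ae (ae_circleMeasure_of_forall fun η hη => ?_)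
        dsimp only
        rw [← hGe ζ hζ, ← hGe η hη, ← enorm_neg (G ζ - G η), neg_sub, ← enorm_neg (ζ - η), neg_sub]
    _ ≤ K * hardyNorm 1 h := by
        rw [lintegral_const_mul _ (by fun_prop)]
        gcongr
        refine le_trans (le_of_eq ?_) (lintegral_boundaryValue_le hh)
        refine lintegral_congr_ae ?_
        filter_upwards [hHe] with ζ h1
        rw [h1]

theorem toeplitzBoundedOn_one (hg : HasLambdaExtension g G B K) : ToeplitzBoundedOn 1 g := by
  refine ⟨2 * K + B, fun h hh => ?_⟩
  have hle : hardyNorm 1 (toeplitz g h) ≤ ((2 * K + B : ℝ≥0) : ℝ≥0∞) * hardyNorm 1 h := by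
    rw [hardyNorm_one (toeplitz g h)]
    refine iSup₂_le fun r hr => ?_
    have hm := aestronglyMeasurable_dilation hh.1.continuousOn hr
    calc ∫⁻ η, ‖toeplitz g h (r * η)‖ₑ ∂circleMeasure
        ≤ ∫⁻ η, (2 * (∫⁻ ζ, ‖G ζ - G η‖ₑ / ‖ζ - η‖ₑ * ‖boundaryValue h ζ‖ₑ ∂circleMeasure) +
            B * ‖h (r * η)‖ₑ) ∂circleMeasure :=
          lintegral_mono_ae (ae_circleMeasure_of_forall fun η hη =>
            hg.enorm_toeplitz_le hh ⟨hr.1.le, hr.2⟩ hη)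
      _ = 2 * (∫⁻ η, ∫⁻ ζ, ‖G ζ - G η‖ₑ / ‖ζ - η‖ₑ * ‖boundaryValue h ζ‖ₑ ∂circleMeasure
            ∂circleMeasure) + B * ∫⁻ η, ‖h (r * η)‖ₑ ∂circleMeasure := by
          rw [lintegral_add_right' _ (hm.enorm.const_mul _),
            lintegral_const_mul' _ _ (by norm_num), lintegral_const_mul' _ _ ENNReal.coe_ne_top]
      _ ≤ 2 * (K * hardyNorm 1 h) + B * hardyNorm 1 h := by
          gcongr
          · exact hg.lintegral_toeplitz_le hh
          · exact lintegral_le_hardyNorm_one h hr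
      _ = _ := by push_cast; ring
  exact ⟨hg.integrable_mul hh, ⟨hg.analyticOnNhd_toeplitz hh,
    hle.trans_lt (ENNReal.mul_lt_top ENNReal.coe_lt_top hh.2)⟩, hle⟩

end HasLambdaExtension

/-! ### Conclusion for coefficient products -/

/-- Starting the sum at `m` means removing a Taylor polynomial from `f`; the remainder is still
bounded on the disk, so every starting index is covered by the same estimate. -/
theorem exists_lambdaExtension_coeffProduct {α : ℕ → ℝ} (hα : IsSlowConvex α) (m : ℕ) {f : ℂ → ℂ}
    (hf : f ∈ HardySpace ∞) : ∃ G B K, HasLambdaExtension (coeffProduct m f α) G B K := by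
  have hsum := hasSum_taylorCoeff hf.1.differentiableOn
  set a : ℕ → ℂ := fun n => if n < m then 0 else taylorCoeff f n with ha
  set f₁ : ℂ → ℂ := fun z => f z - ∑ n ∈ Finset.range m, taylorCoeff f n * z ^ n with hf₁
  have ha0 : ∀ i ∈ Finset.range m, a i = 0 := fun i hi => if_pos (Finset.mem_range.mp hi)
  have ham : ∀ n, a (n + m) = taylorCoeff f (n + m) := fun n => if_neg (by omega)
  have hshift : ∀ {F : ℕ → ℂ} {s : ℂ}, (∀ i ∈ Finset.range m, F i = 0) →
      (HasSum (fun n => F (n + m)) s ↔ HasSum F s) := by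
    intro F s hF
    have := hasSum_nat_add_iff' (f := F) (g := s) m
    rwa [Finset.sum_eq_zero hF, sub_zero] at this
  have hs : ∀ z, ‖z‖ < 1 → HasSum (fun n => a n * z ^ n) (f₁ z) := by
    intro z hz
    rw [← hshift fun i hi => by rw [ha0 i hi, zero_mul]]
    simp only [ham]
    exact (hasSum_nat_add_iff' m).mpr (hsum z hz)
  have hM : ∀ z, ‖z‖ < 1 →
      ‖f₁ z‖ ≤ (hardyNorm ∞ f).toReal + ∑ n ∈ Finset.range m, ‖taylorCoeff f n‖ := by
    intro z hz
    refine (norm_sub_le _ _).trans (add_le_add ?_ ((norm_sum_le _ _).trans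
      (Finset.sum_le_sum fun n _ => ?_)))
    · rw [← toReal_enorm]
      exact ENNReal.toReal_mono hf.2.ne (enorm_le_hardyNorm_top f hz)
    · rw [norm_mul, norm_pow]
      exact mul_le_of_le_one_right (norm_nonneg _) (pow_le_one₀ (norm_nonneg _) hz.le)
  obtain ⟨K, hK⟩ := exists_lintegral_superposition_le hα hs hM
  refine ⟨cesaroSuperposition α a, _, K, differentiableOn_superposition hα hs hM,
    continuousOn_superposition hα hs hM,
    fun z hz => (norm_superposition_le hα hs hM hz).trans (Real.le_coe_toNNReal _), hK,
    fun z hz => ?_⟩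
  have h1 := (hshift fun i hi => by rw [ha0 i hi, zero_mul, zero_mul]).mpr
    (superposition_eq hα hs hz)
  simp only [ham] at h1
  exact h1.tsum_eq

theorem theorem3 (ε : ℝ) (hε : 0 < ε) (α : ℕ → ℝ)
    (hα : (∀ n : ℕ, α n = 1 / ((n : ℝ) + 1) ^ ε) ∨
      (∀ n : ℕ, α n = 1 / (Real.log ((n : ℝ) + 2)) ^ (1 + ε)) ∨
      (∀ n : ℕ, α n = 1 / (Real.log ((n : ℝ) + 2) *
        (Real.log (Real.log ((n : ℝ) + 3))) ^ (1 + ε))) ∨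
      IsIteratedLogSequence ε α)
    (m : ℕ) (hm : m = 0 ∨ m = 1)
    (f : ℂ → ℂ) (hf : f ∈ HardySpace ∞) :
    coeffProduct m f α ∈ classN ∧
      ToeplitzBoundedOn 1 (coeffProduct m f α) ∧
      ToeplitzBoundedOn ∞ (coeffProduct m f α) := by
  obtain ⟨G, B, K, hG⟩ :=
    exists_lambdaExtension_coeffProduct (isSlowConvex_of_cases hε hα) m hf
  exact ⟨hG.mem_classN, hG.toeplitzBoundedOn_one, hG.toeplitzBoundedOn_top⟩
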